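/- Half-integers are the elements of $\mathbb Z+\tfrac12$. A *cup diagram* $\underline\lambda$ is a partition of $\mathbb Z+\frac12$ into blocks of size at most $2$, with finitely many blocks of size $2$ (*cups*; one-element blocks are *rays*), such that whenever $\{i,j\}$ is a cup and $i<k<j$, then $k$ lies in a cup $\{k,k'\}$ with $i<k'<j$. Let $\Lambda_n$ be the set of cup diagrams with exactly $n$ cups ($n\ge 0$), partially ordered by $\lambda\le\mu$ iff the right endpoints $b_1>\dots>b_n$ of the cups of $\lambda$ and $b'_1>\dots>b'_n$ of those of $\mu$ satisfy $b_i\ge b_i'$ for all $i$. The *cap diagram* $\overline\lambda$ is the mirror image of $\underline\lambda$ shifted by one to the right (a cap $\{a+1,b+1\}$ for each cup $\{a,b\}$), and the *circle diagram* $\underline\lambda\overline\mu$ is $\underline\lambda$ drawn below $\overline\mu$. Redraw the rays of a cup diagram with $k$ cups, in order and without moving those far away, so that their bottom ends avoid exactly $-k-\frac12,\dots,k-\frac32$, and those of a cap diagram with $k$ caps so that their top ends avoid exactly $-k+\frac12,\dots,k-\frac12$. A line is *non-propagating* if both its ends are at the top or both at the bottom. A diagram is *orientable* if it contains no circle and every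 non-propagating line has one end on each side of the centre, which is $0$ for lines ending at the top and $-1$ for lines ending at the bottom. Let $e\mathbb Ke$ be the complex vector space with basis the orientable circle diagrams $\underline\lambda\overline\mu$, $\lambda,\mu\in\Lambda_n$, with the bilinear multiplication in which $\underline\lambda\overline\mu\cdot\underline{\mu'}\overline\nu=0$ if $\mu\ne\mu'$, while for $\mu=\mu'$ one draws $\underline\lambda\overline\mu$ below $\underline\mu\overline\nu$, joins the rays of $\overline\mu$ to those of $\underline\mu$ in order, by lines that are vertical outside a finite strip, and successively replaces each cup of $\underline\mu$, together with the corresponding cap of $\overline\mu$ and the line between them, by three vertical lines (surgery; a cup is treated after all cups containing it); the product is $0$ if one of these diagrams is not orientable and $\underline\lambda\overline\nu$ otherwise. Let $\mathbb I_n\subseteq e\mathbb Ke$ be the span of the orientable circle diagrams having a non-propagating line, let $\mathbb K_n=e\mathbb Ke/\mathbb I_n$, and let $e_\lambda\in\mathbb K_n$ be the class of $\underline\lambda\overline\lambda$. A *$\Delta$-orientation* of $\overline\mu$ assigns to its caps pairwise distinct integers such that the cap with endpoints $a<b$ gets some $k$ with $a<k<b$ for which every other cap with endpoints $a'<k<b'$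 satisfies $a'<a<b<b'$. A *$\nabla$-orientation* of $\underline\lambda$ assigns to its cups pairwise distinct integers such that the cup with endpoints $a<b$ gets $a-\frac12$ or $b+\frac12$. The weight $\nu\in\Lambda_n$ *is* such an orientation if the set of assigned integers is $\{b+\frac12 : b \text{ a right endpoint of a cup of }\underline\nu\}$. For $\lambda,\mu\in\Lambda_n$ let $X(\lambda,\mu)=\{\underline\lambda\overline\mu\}\subseteq\mathbb K_n$ if $\lambda$ is a $\Delta$-orientation of $\overline\mu$, and $X(\lambda,\mu)=\emptyset$ otherwise; let $Y(\lambda,\mu)=\{\underline\lambda\overline\mu\}\subseteq\mathbb K_n$ if $\mu$ is a $\nabla$-orientation of $\underline\lambda$, and $Y(\lambda,\mu)=\emptyset$ otherwise. Put $Y(\lambda)=\bigcup_\mu Y(\mu,\lambda)$ and $X(\lambda)=\bigcup_\mu X(\lambda,\mu)$. **Theorem.** For every $n\ge0$, $\mathbb I_n$ is a two-sided ideal of $e\mathbb Ke$, and $\mathbb K_n$ with the idempotents $e_\lambda$ ($\lambda\in\Lambda_n$), the partial order $\le$ and the sets $X(\lambda,\mu)$, $Y(\lambda,\mu)$ is an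 essentially finite based quasi-hereditary algebra in the sense of Brundan–Stroppel. That is: 1. $\mathbb K_n$ is associative, the $e_\lambda$ are mutually orthogonal idempotents, $\mathbb K_n=\bigoplus_{\lambda,\mu\in\Lambda_n}e_\lambda\mathbb K_ne_\mu$, and $e_\lambda\mathbb K_n$ and $\mathbb K_ne_\lambda$ are finite-dimensional for every $\lambda\in\Lambda_n$; 2. $\le$ is a partial order on $\Lambda_n$ all of whose intervals are finite; 3. $Y(\lambda,\mu),X(\lambda,\mu)\subseteq e_\lambda\mathbb K_ne_\mu$, and the products $yx$, for $(y,x)\in\bigsqcup_{\lambda\in\Lambda_n}Y(\lambda)\times X(\lambda)$, form a basis of $\mathbb K_n$; 4. $Y(\mu,\lambda)$ and $X(\lambda,\mu)$ are empty unless $\mu\le\lambda$; 5. $Y(\lambda,\lambda)=X(\lambda,\lambda)=\{e_\lambda\}$ for every $\lambda\in\Lambda_n$. -/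

import Mathlib

noncomputable section

namespace KhovanovP

/-! ### Cup diagrams

Throughout, the integer `i` is the code of the half-integer `i + 1/2`. -/

/-- A cup diagram: a partition of `ℤ + 1/2` into blocks of size at most two, recorded by the
involution `partner` that fixes the one-element blocks (rays) and exchanges the two elements of each
two-element block (cups). There are finitely many cups, and every point below a cup lies on a cup
nested inside it. -/
@[ext]
structure CupDiagram where
  partner : ℤ → ℤ
  invol : ∀ i, partner (partner i) = i
  finite_cups : {i | partner i ≠ i}.Finite
  noncrossing : ∀ i k, i < k → k < partner i →
    partner k ≠ k ∧ i < partner k ∧ partner k < partner i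

namespace CupDiagram

/-- The endpoints of the cups. -/
def endpoints (c : CupDiagram) : Finset ℤ := c.finite_cups.toFinset

/-- The right endpoints of the cups; there is one for each cup. -/
def rightEnds (c : CupDiagram) : Finset ℤ := c.endpoints.filter (fun i => c.partner i < i)

/-- The number of cups. -/
def numCups (c : CupDiagram) : ℕ := c.rightEnds.card

/-- The cup diagram without cups. -/
def empty : CupDiagram where
  partner := id
  invol _ := rfl
  finite_cups := by simp
  noncrossing i k h1 h2 := absurd (h1.trans h2) (lt_irrefl i)

/-- The cap diagram of `c`: the mirror image of `c`, shifted one to the right. It has a cap with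
endpoints `a + 1`, `b + 1` for each cup of `c` with endpoints `a`, `b`. (As a pairing of points, a
cap diagram is the same kind of object as a cup diagram.) -/
def cap (c : CupDiagram) : CupDiagram where
  partner i := c.partner (i - 1) + 1
  invol i := by simp [c.invol]
  finite_cups := by
    refine (c.finite_cups.image (fun i => i + 1)).subset ?_
    intro i hi
    refine ⟨i - 1, ?_, by simp⟩
    simp only [Set.mem_ofPred_eq] at hi ⊢
    omega
  noncrossing i k h1 h2 := by
    have h := c.noncrossing (i - 1) (k - 1) (by omega) (by omega)
    omega

/-- `d` arises from `c` by deleting some of its cups, their endpoints becoming rays. As `d` is a cup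
diagram, a cup can only be deleted together with all cups that contain it. -/
def IsSub (d c : CupDiagram) : Prop :=
  ∀ i, d.partner i = i ∨ d.partner i = c.partner i

/-- `i ↦ c.straight i` is the unique order preserving bijection from the rays of `c` onto all of
`ℤ + 1/2` that is the identity far to the right. -/
def straight (c : CupDiagram) (i : ℤ) : ℤ :=
  i + ((c.endpoints.filter (fun p => i < p)).card : ℤ)

/-- The position of the bottom end of the ray at `i` of a cup diagram with `k` cups, after the rays
are redrawn, in order and without moving those far away, so that exactly the `2k` positions
`-k-1/2, …, k-3/2` are free of bottom ends. -/
def bottomPos (c : CupDiagram) (i : ℤ) : ℤ :=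
  if (c.numCups : ℤ) - 1 ≤ c.straight i then c.straight i else c.straight i - 2 * c.numCups

/-- The position of the top end of the ray at `i` of a cap diagram with `k` caps, after the rays are
redrawn, in order and without moving those far away, so that exactly the `2k` positions
`-k+1/2, …, k-1/2` are free of top ends. -/
def topPos (c : CupDiagram) (i : ℤ) : ℤ :=
  if (c.numCups : ℤ) ≤ c.straight i then c.straight i else c.straight i - 2 * c.numCups

end CupDiagram

open CupDiagram

/-! ### Stacked diagrams and orientability

For cup diagrams `l`, `d`, `m` consider the diagram which consists, from bottom to top, of the cup
diagram of `l`, the cap diagram of `d`, the cup diagram of `d`, and the cap diagram of `m`, where the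
rays in the middle section (from the cap diagram of `d` to the cup diagram of `d`) are joined in order
by straight lines that are vertical outside a finite strip. If `d` is empty, the middle section
consists of vertical lines and the picture is the circle diagram of `l` and `m`.

The vertices `Sum.inl i` are the points where `l` meets the middle section, and the vertices
`Sum.inr i` are the points where the middle section meets the cap diagram of `m`. -/

/-- The arcs and lines of the stacked diagram (a ray of `l` or of the cap diagram of `m` contributes
only a pair of equal points). -/
def StackRel (l d m : CupDiagram) : ℤ ⊕ ℤ → ℤ ⊕ ℤ → Prop
  | Sum.inl x, Sum.inl y => y = l.partner x ∨ y = d.cap.partner x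
  | Sum.inr x, Sum.inr y => y = d.partner x ∨ y = m.cap.partner x
  | Sum.inl x, Sum.inr y =>
      x ∉ d.cap.endpoints ∧ y ∉ d.endpoints ∧ d.cap.straight x = d.straight y
  | Sum.inr _, Sum.inl _ => False

/-- Two points lie on the same component of the stacked diagram. -/
def Joined (l d m : CupDiagram) (v w : ℤ ⊕ ℤ) : Prop :=
  Relation.EqvGen (StackRel l d m) v w

/-- `x < y` are the two rays at the bottom of a non-propagating line ending at the bottom. -/
def BottomLine (l d m : CupDiagram) (x y : ℤ) : Prop :=
  x < y ∧ l.partner x = x ∧ l.partner y = y ∧ Joined l d m (Sum.inl x) (Sum.inl y)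

/-- `x < y` are the two rays at the top of a non-propagating line ending at the top. -/
def TopLine (l d m : CupDiagram) (x y : ℤ) : Prop :=
  x < y ∧ m.cap.partner x = x ∧ m.cap.partner y = y ∧ Joined l d m (Sum.inr x) (Sum.inr y)

/-- The stacked diagram is orientable: it contains no circle (every component runs out to the bottom
or to the top along some ray), and after redrawing the rays, every non-propagating line has an end on
each side of the centre, which is `-1` at the bottom and `0` at the top. -/
def Orientable (l d m : CupDiagram) : Prop :=
  (∀ v, ∃ x, (l.partner x = x ∧ Joined l d m v (Sum.inl x)) ∨
    (m.cap.partner x = x ∧ Joined l d m v (Sum.inr x))) ∧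
  (∀ x y, BottomLine l d m x y → l.bottomPos x < -1 ∧ -1 ≤ l.bottomPos y) ∧
  (∀ x y, TopLine l d m x y → m.cap.topPos x < 0 ∧ 0 ≤ m.cap.topPos y)

/-- The stacked diagram has a non-propagating line. -/
def HasNonPropagating (l d m : CupDiagram) : Prop :=
  ∃ x y, BottomLine l d m x y ∨ TopLine l d m x y

/-! ### The algebra -/

/-- Cup diagrams with exactly `n` cups. -/
def Lambda (n : ℕ) : Type := {c : CupDiagram // c.numCups = n}

/-- The partial order: `l ≤ m` if the `i`-th right endpoint of `l` is at least the `i`-th right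
endpoint of `m`, for each `i`. -/
def weightLE {n : ℕ} (l m : Lambda n) : Prop :=
  ∀ i : Fin n, m.1.rightEnds.orderEmbOfFin m.2 i ≤ l.1.rightEnds.orderEmbOfFin l.2 i

/-- The idempotent truncation `e K e` of the Khovanov algebra `K` of type `P` at the cup diagrams with
`n` cups: the complex vector space on the orientable circle diagrams with `n` cups and `n` caps. -/
abbrev Trunc (n : ℕ) : Type :=
  {p : Lambda n × Lambda n // Orientable p.1.1 CupDiagram.empty p.2.1} →₀ ℂ

open Classical in
/-- The circle diagram of `l` and `m` as an element of `e K e` (zero if it is not orientable). -/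
def circ {n : ℕ} (l m : Lambda n) : Trunc n :=
  if h : Orientable l.1 CupDiagram.empty m.1 then Finsupp.single ⟨(l, m), h⟩ 1 else 0

open Classical in
/-- The product of the circle diagrams `p.1 p.2` and `q.1 q.2`. It vanishes unless `p.2 = q.1`. If
`p.2 = q.1 = c`, the middle section starts as the cap diagram of `c` below the cup diagram of `c`, and
a surgery replaces a cup, the corresponding cap and the line between them by three vertical lines. It
can be applied as soon as the cup and cap are adjacent to that line, that is, after the surgeries at
all cups that contain the given one. So the middle sections that occur are given by the `d` with
`d.IsSub c`, the final one by the empty `d`. The product is zero if one of these results is not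
orientable and is the circle diagram of `p.1` and `q.2` otherwise. -/
def circMul {n : ℕ} (p q : Lambda n × Lambda n) : Trunc n :=
  if p.2 = q.1 ∧ ∀ d : CupDiagram, d.IsSub p.2.1 → Orientable p.1.1 d q.2.1 then
    circ p.1 q.2 else 0

/-- The bilinear multiplication of `e K e`. -/
def truncMul (n : ℕ) : Trunc n →ₗ[ℂ] Trunc n →ₗ[ℂ] Trunc n :=
  Finsupp.linearCombination ℂ (fun p => Finsupp.linearCombination ℂ (fun q => circMul p.1 q.1))

/-- The span of the orientable circle diagrams with at least one non-propagating line. -/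
def nonPropSpan (n : ℕ) : Submodule ℂ (Trunc n) :=
  Submodule.span ℂ {v | ∃ l m : Lambda n, Orientable l.1 CupDiagram.empty m.1 ∧
    HasNonPropagating l.1 CupDiagram.empty m.1 ∧ v = circ l m}

/-- A two-sided ideal for a bilinear multiplication. -/
def IsTwoSided {k A : Type*} [CommRing k] [AddCommGroup A] [Module k A]
    (mul : A →ₗ[k] A →ₗ[k] A) (J : Submodule k A) : Prop :=
  ∀ a, ∀ x ∈ J, mul a x ∈ J ∧ mul x a ∈ J

/-- The multiplication induced on the quotient by a two-sided ideal. -/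
def quotMul {k A : Type*} [CommRing k] [AddCommGroup A] [Module k A]
    (mul : A →ₗ[k] A →ₗ[k] A) (J : Submodule k A) (hJ : IsTwoSided mul J) :
    (A ⧸ J) →ₗ[k] (A ⧸ J) →ₗ[k] (A ⧸ J) :=
  J.liftQ
    (LinearMap.flip (J.liftQ (LinearMap.flip (mul.compr₂ J.mkQ)) (by
      intro x hx
      refine LinearMap.mem_ker.2 (LinearMap.ext fun a => ?_)
      simpa using (hJ a x hx).1)))
    (by
      intro x hx
      refine LinearMap.mem_ker.2 (LinearMap.ext fun a => ?_)
      obtain ⟨a, rfl⟩ := J.mkQ_surjective a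
      simpa using (hJ a x hx).2)

theorem quotMul_mk {k A : Type*} [CommRing k] [AddCommGroup A] [Module k A]
    (mul : A →ₗ[k] A →ₗ[k] A) (J : Submodule k A) (hJ : IsTwoSided mul J) (a b : A) :
    quotMul mul J hJ (J.mkQ a) (J.mkQ b) = J.mkQ (mul a b) := by
  simp [quotMul]

/-- The vector space underlying `K_n = e K e / I_n`. -/
abbrev Kn (n : ℕ) : Type := Trunc n ⧸ nonPropSpan n

/-- The multiplication of `K_n = e K e / I_n`, given that `I_n` is a two-sided ideal. -/
def knMul (n : ℕ) (h : IsTwoSided (truncMul n) (nonPropSpan n)) :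
    Kn n →ₗ[ℂ] Kn n →ₗ[ℂ] Kn n :=
  quotMul (truncMul n) (nonPropSpan n) h

/-- The class of a circle diagram in `K_n`. -/
def knCirc {n : ℕ} (l m : Lambda n) : Kn n := (nonPropSpan n).mkQ (circ l m)

/-- The idempotent `e_l`. -/
def knIdem {n : ℕ} (l : Lambda n) : Kn n := knCirc l l

/-! ### Orientations

Here integers are honest integers: the integer `k` lies between the half-integers with codes
`k - 1` and `k`. -/

/-- The set of dots of a weight: the integers `b + 1/2` for the right endpoints `b` of its cups. -/
def dots (c : CupDiagram) : Finset ℤ := c.rightEnds.image (fun b => b + 1)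

/-- The integer `k` lies strictly between the endpoints of the arc of `c` with right endpoint `b`. -/
def Under (c : CupDiagram) (b k : ℤ) : Prop := c.partner b < k ∧ k ≤ b

/-- `w` is the set of integers of a `Δ`-orientation of the cap diagram of `m`: each cap gets an
integer below it such that every other cap above this integer contains the given cap, and distinct
caps get distinct integers. -/
def IsDelta (w : Finset ℤ) (m : CupDiagram) : Prop :=
  ∃ f : ℤ → ℤ,
    (∀ b ∈ m.cap.rightEnds, Under m.cap b (f b) ∧
      ∀ b' ∈ m.cap.rightEnds, b' ≠ b → Under m.cap b' (f b) →
        m.cap.partner b' < m.cap.partner b ∧ b < b') ∧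
    Set.InjOn f m.cap.rightEnds ∧ m.cap.rightEnds.image f = w

/-- `w` is the set of integers of a `∇`-orientation of the cup diagram `l`: each cup with endpoints
`a < b` gets one of the integers `a - 1/2`, `b + 1/2`, and distinct cups get distinct integers. -/
def IsNabla (w : Finset ℤ) (l : CupDiagram) : Prop :=
  ∃ f : ℤ → ℤ,
    (∀ b ∈ l.rightEnds, f b = l.partner b ∨ f b = b + 1) ∧
    Set.InjOn f l.rightEnds ∧ l.rightEnds.image f = w

/-- `Y(l, m)`. -/
def Yset {n : ℕ} (l m : Lambda n) : Set (Kn n) :=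
  {y | IsNabla (dots m.1) l.1 ∧ y = knCirc l m}

/-- `X(l, m)`. -/
def Xset {n : ℕ} (l m : Lambda n) : Set (Kn n) :=
  {x | IsDelta (dots l.1) m.1 ∧ x = knCirc l m}

/-! ### Based quasi-hereditary algebras -/

/-- The subspace `e_i A e_j`. -/
def peirce {k A I : Type*} [Field k] [AddCommGroup A] [Module k A]
    (mul : A →ₗ[k] A →ₗ[k] A) (e : I → A) (i j : I) : Submodule k A :=
  LinearMap.range ((mul (e i)).comp (mul.flip (e j)))

open Classical in
/-- The vector space `A` with multiplication `mul`, idempotents `e i` for `i : I`, special idempotents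
indexed by `L` (a subset of `I` through `ι`), relation `le` on `L`, and sets `Y i l`, `X l j`, is an
essentially finite based quasi-hereditary algebra in the sense of Brundan and Stroppel. -/
structure IsEssFiniteBasedQuasiHereditary {k A I L : Type*} [Field k] [AddCommGroup A] [Module k A]
    (mul : A →ₗ[k] A →ₗ[k] A) (e : I → A) (ι : L ↪ I) (le : L → L → Prop)
    (Y : I → L → Set A) (X : L → I → Set A) : Prop where
  assoc : ∀ a b c, mul (mul a b) c = mul a (mul b c)
  idem : ∀ i, mul (e i) (e i) = e i
  orthogonal : ∀ i j, i ≠ j → mul (e i) (e j) = 0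
  locally_unital : DirectSum.IsInternal (fun p : I × I => peirce mul e p.1 p.2)
  finite_left : ∀ j, FiniteDimensional k (LinearMap.range (mul.flip (e j)))
  finite_right : ∀ i, FiniteDimensional k (LinearMap.range (mul (e i)))
  le_refl : ∀ l, le l l
  le_trans : ∀ l m p, le l m → le m p → le l p
  le_antisymm : ∀ l m, le l m → le m l → l = m
  interval_finite : ∀ l m, {p | le l p ∧ le p m}.Finite
  Y_subset : ∀ i l, Y i l ⊆ peirce mul e i (ι l)
  X_subset : ∀ l j, X l j ⊆ peirce mul e (ι l) j
  linearIndependent : LinearIndependent k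
    (fun z : (Σ l : L, (⋃ i, Y i l : Set A) × (⋃ j, X l j : Set A)) =>
      mul (z.2.1 : A) (z.2.2 : A))
  span_eq_top : Submodule.span k (Set.range
    (fun z : (Σ l : L, (⋃ i, Y i l : Set A) × (⋃ j, X l j : Set A)) =>
      mul (z.2.1 : A) (z.2.2 : A))) = ⊤
  Y_triangular : ∀ l m, (Y (ι m) l).Nonempty → le m l
  X_triangular : ∀ l m, (X l (ι m)).Nonempty → le m l
  Y_diag : ∀ l, Y (ι l) l = {e (ι l)}
  X_diag : ∀ l, X l (ι l) = {e (ι l)}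

end KhovanovP

end

noncomputable section
namespace KhovanovP
open Function

/-! ### The form `Om` -/

/-! A stacked diagram is translated into linear equations for finitely supported rational functions
on its regions. The integer `x` stands for the gap just left of the point with code `x`. Functions
in `compatM c` are constant on the regions cut out by the cups and rays of `c`; functions in
`closedM c` also agree across rays and hence vanish outside the cups. For diagrams with equally many
cups, `PairInj l m`, i.e. `compatM l ⊓ closedM m.cap = ⊥`, is the nonsingularity of a square system.
It holds exactly if the circle diagram is orientable with only propagating lines (`pairInj_iff`): a
component with no end at the top integrates to a nonzero solution, and conversely a conserved flux
along propagating lines forces every solution to vanish. So these diagrams index a basis of `K_n`,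
and a product of two of them is nonzero exactly if `ProdInj` holds, which is uniqueness for all
diagrams met during the surgery.

The alternating form `Om` vanishes between `closedM c` and `compatM c`. Therefore each system has an
opposite one, with the conditions at bottom and top exchanged, and both are uniquely solvable
together. A reversed surgery (insertion of a cup and a cap) replaces two conditions "no jump" by two
equations `func`. The solution spaces are closed under products and under restriction to gaps of one
parity. Hence a solution with a single jump (`Peak`) takes at most two values and lives on one
parity, and the 2×2 matrix of an insertion is diagonal with entries 0 or 1. For two independent
insertions, these facts and the duality give `diamond`: if the diagrams with none and with both are
good, the two intermediate ones are good together. Walking through the grid of pairs of subdiagrams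
yields associativity (`prodInj_assoc`).

The ideal property rests on `good_of_orientable`. If a reversed surgery on a good diagram gave an
orientable diagram that is not good, the peaks would produce a non-propagating line at the bottom
and one at the top, each joining neighbouring rays around the centre. Propagating lines preserve the
numbering of rays, and the two centres differ by one, so three consecutive lines are pinned down and
the equations contradict each other. Hence a product with only propagating lines has only such lines
at every intermediate stage and in both factors (`prodInj_of_orientable`, `circMul_mem`).

For the based structure, expand the determinant of the system of a pair. A nonzero term is a choice
of one end gap for each cup of `l` such that each region below a cap of `m` is hit once: a common
`∇`- and `Δ`-orientation (`exists_state`). Two such choices would give a singular block, so it is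
unique (`state_unique`). Conversely, removing innermost caps one at a time is a symplectic reduction
that preserves coisotropy and the dots, so a state forces uniqueness (`eq_zero_of_state`). The same
reduction carries a state through a middle section (`pass_state`), so the product `yx` is the
diagram with that state. Finally, finite subsets of `ℤ` correspond to cup diagrams through their
dots, and an orientation never moves a dot to the right of the one given by the right endpoint,
which gives triangularity. -/

/-- The alternating form on finitely supported functions on `ℤ`. -/
def Om (f g : ℤ → ℚ) : ℚ := ∑ᶠ k, (f k * g (k + 1) - f (k + 1) * g k)

theorem om_support_finite {f g : ℤ → ℚ} (hf : (support f).Finite) :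
    (support fun k => f k * g (k + 1) - f (k + 1) * g k).Finite := by
  refine (hf.union (hf.image (fun k => k - 1))).subset ?_
  intro k hk
  by_contra h
  simp only [Set.mem_union, mem_support, Set.mem_image, not_or, not_not, not_exists, not_and] at h
  apply hk
  have h2 : f (k + 1) = 0 := by
    by_contra h3
    exact h.2 (k + 1) h3 (by ring)
  simp [h.1, h2]

theorem om_neg_swap (f g : ℤ → ℚ) : Om g f = - Om f g := by
  unfold Om
  rw [← finsum_neg_distrib]
  refine finsum_congr fun k => ?_
  ring

theorem om_add_left {f f' g : ℤ → ℚ} (hf : (support f).Finite) (hf' : (support f').Finite) :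
    Om (f + f') g = Om f g + Om f' g := by
  unfold Om
  rw [← finsum_add_distrib (om_support_finite hf) (om_support_finite hf')]
  refine finsum_congr fun k => ?_
  simp only [Pi.add_apply]; ring

theorem om_smul_left (c : ℚ) (f g : ℤ → ℚ) : Om (c • f) g = c * Om f g := by
  unfold Om
  rw [← smul_eq_mul, smul_finsum]
  refine finsum_congr fun k => ?_
  simp only [Pi.smul_apply, smul_eq_mul]; ring

theorem om_smul_right (c : ℚ) (f g : ℤ → ℚ) : Om f (c • g) = c * Om f g := by
  rw [om_neg_swap, om_smul_left, om_neg_swap]; ring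

theorem om_add_right {f g g' : ℤ → ℚ} (hg : (support g).Finite) (hg' : (support g').Finite) :
    Om f (g + g') = Om f g + Om f g' := by
  rw [om_neg_swap, om_add_left hg hg', om_neg_swap, om_neg_swap g' f]; ring

theorem support_single_finite (k : ℤ) (c : ℚ) : (support (Pi.single k c : ℤ → ℚ)).Finite :=
  (Set.finite_singleton k).subset (Pi.support_single_subset)

theorem om_single_left (k : ℤ) (g : ℤ → ℚ) :
    Om (Pi.single k 1) g = g (k + 1) - g (k - 1) := by
  unfold Om
  rw [finsum_eq_sum_of_support_subset (s := {k, k - 1})]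
  · rw [Finset.sum_pair (by omega)]
    simp
    ring
  · intro x hx
    simp only [mem_support, Pi.single_apply] at hx
    simp only [Finset.coe_insert, Finset.coe_singleton, Set.mem_insert_iff, Set.mem_singleton_iff]
    by_contra h
    push Not at h
    apply hx
    rw [if_neg h.1, if_neg (by omega)]
    ring

theorem om_single_right (k : ℤ) (f : ℤ → ℚ) :
    Om f (Pi.single k 1) = f (k - 1) - f (k + 1) := by
  rw [om_neg_swap, om_single_left]; ring

/-- Changing `f` first and `g` second makes the first correction involve the new `g` and the second
one the old `f'`. -/
theorem om_difference {f g f' g' : ℤ → ℚ} (hf : (support f').Finite) (hg : (support g').Finite)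
    (k l : ℤ) (c d : ℚ) (h1 : ∀ x, f x = f' x + if x = k then c else 0)
    (h2 : ∀ x, g x = g' x + if x = l then d else 0) :
    Om f g - Om f' g' = c * (g (k + 1) - g (k - 1)) + d * (f' (l - 1) - f' (l + 1)) := by
  have e1 : f = f' + c • Pi.single k 1 := by
    ext x; simp [h1 x, Pi.single_apply]
  have e2 : g = g' + d • Pi.single l 1 := by
    ext x; simp [h2 x, Pi.single_apply]
  have hs : ∀ (c : ℚ) (k : ℤ), (support (c • Pi.single k 1 : ℤ → ℚ)).Finite := fun c k =>
    (support_single_finite k 1).subset (support_const_smul_subset c _)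
  have e3 : Om f g = Om f' g + c * (g (k + 1) - g (k - 1)) := by
    conv_lhs => rw [e1]
    rw [om_add_left hf (hs c k), om_smul_left, om_single_left]
  have e4 : Om f' g = Om f' g' + d * (f' (l - 1) - f' (l + 1)) := by
    conv_lhs => rw [e2]
    rw [om_add_right hg (hs d l), om_smul_right, om_single_right]
  rw [e3, e4]; ring

/-! ### Two strips -/

/-- Two spaces of functions on a set of regions, which meet along two strips (indexed by `Bool`).
In each strip, the regions are met from below at `lo` and from above at `up`. -/
structure Strips (Γ : Type) where
  lo : Bool → ℤ → Γ
  up : Bool → ℤ → Γ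
  par : Γ → Prop
  par_lo : ∀ i k, par (lo i k) ↔ Even k
  par_up : ∀ i k, par (up i k) ↔ Even k
  X : Submodule ℚ (Γ → ℚ)
  Y : Submodule ℚ (Γ → ℚ)
  mulX : ∀ x ∈ X, ∀ y ∈ X, x * y ∈ X
  mulY : ∀ x ∈ Y, ∀ y ∈ Y, x * y ∈ Y
  parX : ∀ x ∈ X, {γ | par γ}.indicator x ∈ X
  parY : ∀ x ∈ Y, {γ | par γ}.indicator x ∈ Y
  finX_lo : ∀ x ∈ X, ∀ i, (support fun k => x (lo i k)).Finite
  finX_up : ∀ x ∈ X, ∀ i, (support fun k => x (up i k)).Finite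
  finY_lo : ∀ x ∈ Y, ∀ i, (support fun k => x (lo i k)).Finite
  finY_up : ∀ x ∈ Y, ∀ i, (support fun k => x (up i k)).Finite
  dual : ∀ x ∈ X, ∀ y ∈ Y,
    (Om (fun k => x (lo false k)) (fun k => y (lo false k)) -
      Om (fun k => x (up false k)) (fun k => y (up false k))) +
    (Om (fun k => x (lo true k)) (fun k => y (lo true k)) -
      Om (fun k => x (up true k)) (fun k => y (up true k))) = 0

namespace Strips
variable {Γ : Type} (S : Strips Γ)

/-- Exchange of the two spaces. -/
def swap : Strips Γ where
  lo := S.lo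
  up := S.up
  par := S.par
  par_lo := S.par_lo
  par_up := S.par_up
  X := S.Y
  Y := S.X
  mulX := S.mulY
  mulY := S.mulX
  parX := S.parY
  parY := S.parX
  finX_lo := S.finY_lo
  finX_up := S.finY_up
  finY_lo := S.finX_lo
  finY_up := S.finX_up
  dual := fun x hx y hy => by
    have h := S.dual y hy x hx
    rw [om_neg_swap (fun k => x (S.lo false k)), om_neg_swap (fun k => x (S.up false k)),
      om_neg_swap (fun k => x (S.lo true k)), om_neg_swap (fun k => x (S.up true k))] at h
    linarith

/-- The jump of a function across a strip. -/
def jump (x : Γ → ℚ) (i : Bool) (k : ℤ) : ℚ := x (S.lo i k) - x (S.up i k)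

/-- Functions with only one jump. -/
def Peak (x : Γ → ℚ) (i : Bool) (k : ℤ) : Prop :=
  x ∈ S.X ∧ ∀ i' k', S.jump x i' k' = if i' = i ∧ k' = k then 1 else 0

def Inj : Prop := ∀ x ∈ S.X, (∀ i k, S.jump x i k = 0) → x = 0

/-- By linearity, existence for a single unit jump gives existence for any finite set of jumps; with
`Inj` the peaks are dual to the jumps. -/
def Solv : Prop := S.Inj ∧ ∀ i k, ∃ x, S.Peak x i k

/-- The two new equations when a cup and a cap are inserted in the strip `i` at position `j`. -/
def func (i : Bool) (j : ℤ) (τ : Bool) (x : Γ → ℚ) : ℚ :=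
  if τ then x (S.up i (j - 1)) - x (S.up i (j + 1)) else x (S.lo i j) - x (S.lo i (j + 2))

/-- The position of the jump that is replaced by the equation `func`. -/
def idx (j : ℤ) (τ : Bool) : ℤ := if τ then j + 1 else j

/-- Uniqueness after inserting a cup and a cap in the strip `i` at position `j`. -/
def InjStep (i : Bool) (j : ℤ) : Prop :=
  ∀ x ∈ S.X, (∀ i' k, ¬ (i' = i ∧ (k = j ∨ k = j + 1)) → S.jump x i' k = 0) →
    (∀ τ, S.func i j τ x = 0) → x = 0

/-- Uniqueness after inserting a cup and a cap in both strips. -/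
def InjBoth (j : Bool → ℤ) : Prop :=
  ∀ x ∈ S.X, (∀ i k, ¬ (k = j i ∨ k = j i + 1) → S.jump x i k = 0) →
    (∀ i τ, S.func i (j i) τ x = 0) → x = 0

variable {S}

theorem jump_add (x y : Γ → ℚ) (i k) : S.jump (x + y) i k = S.jump x i k + S.jump y i k := by
  simp [jump]; ring
theorem jump_sub (x y : Γ → ℚ) (i k) : S.jump (x - y) i k = S.jump x i k - S.jump y i k := by
  simp [jump]; ring
theorem jump_smul (c : ℚ) (y : Γ → ℚ) (i k) : S.jump (c • y) i k = c * S.jump y i k := by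
  simp [jump]; ring
theorem func_add (i j τ) (x y : Γ → ℚ) :
    S.func i j τ (x + y) = S.func i j τ x + S.func i j τ y := by
  cases τ <;> simp [func] <;> ring
theorem func_sub (i j τ) (x y : Γ → ℚ) :
    S.func i j τ (x - y) = S.func i j τ x - S.func i j τ y := by
  cases τ <;> simp [func] <;> ring
theorem func_smul (i j τ) (c : ℚ) (y : Γ → ℚ) :
    S.func i j τ (c • y) = c * S.func i j τ y := by
  cases τ <;> simp [func] <;> ring

theorem Peak.lo_self {x : Γ → ℚ} {i k} (h : S.Peak x i k) : x (S.lo i k) = x (S.up i k) + 1 := by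
  have := h.2 i k
  simp [jump] at this; linarith

theorem Peak.lo_of_ne {x : Γ → ℚ} {i k} (h : S.Peak x i k) {i' k'} (hne : ¬ (i' = i ∧ k' = k)) :
    x (S.lo i' k') = x (S.up i' k') := by
  have := h.2 i' k'
  rw [if_neg hne] at this
  simp [jump] at this; linarith

theorem eq_of_jump (hS : S.Inj) {x y : Γ → ℚ} (hx : x ∈ S.X) (hy : y ∈ S.X)
    (h : ∀ i k, S.jump x i k = S.jump y i k) : x = y := by
  have := hS (x - y) (S.X.sub_mem hx hy) (fun i k => by rw [jump_sub, h, sub_self])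
  exact sub_eq_zero.1 this

/-- A function with only one jump takes at most two values. -/
theorem Peak.two_values (hS : S.Inj) {x : Γ → ℚ} {i k} (h : S.Peak x i k) (γ : Γ) :
    x γ = 0 ∨ x γ = 2 * x (S.up i k) + 1 := by
  set c := x (S.up i k) with hc
  -- Since `(c + 1)² - c² = 2c + 1`, this combination has no jump at the peak; elsewhere `x` has
  -- none.
  have h0 : x * x - (2 * c + 1) • x = 0 := by
    refine hS _ (S.X.sub_mem (S.mulX _ h.1 _ h.1) (S.X.smul_mem _ h.1)) ?_
    intro i' k'
    rw [jump_sub, jump_smul]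
    by_cases hk : i' = i ∧ k' = k
    · obtain ⟨rfl, rfl⟩ := hk
      simp only [jump, Pi.mul_apply, h.lo_self, ← hc]; ring
    · simp only [jump, Pi.mul_apply, h.lo_of_ne hk]; ring
  have := congrFun h0 γ
  simp only [Pi.sub_apply, Pi.mul_apply, Pi.smul_apply, smul_eq_mul, Pi.zero_apply] at this
  have h2 : x γ * (x γ - (2 * c + 1)) = 0 := by linarith
  rcases mul_eq_zero.1 h2 with h3 | h3
  · exact Or.inl h3
  · right; linarith

theorem Peak.base (hS : S.Inj) {x : Γ → ℚ} {i k} (h : S.Peak x i k) :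
    x (S.up i k) = 0 ∨ x (S.up i k) = -1 := by
  rcases h.two_values hS (S.up i k) with h1 | h1
  · exact Or.inl h1
  · right; linarith

theorem Peak.values (hS : S.Inj) {x : Γ → ℚ} {i k} (h : S.Peak x i k) (γ : Γ) :
    x γ = x (S.up i k) ∨ x γ = x (S.up i k) + 1 := by
  rcases h.base hS with h1 | h1 <;> rcases h.two_values hS γ with h2 | h2 <;>
    rw [h2, h1] <;> norm_num

/-- The product of two peaks, corrected by multiples of both factors, has no jumps and hence
vanishes. Its value at `S.up i k` shows that the remaining constant `δ * β` is zero as well. -/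
theorem Peak.cross (hS : S.Inj) {x y : Γ → ℚ} {i k i' k'} (hx : S.Peak x i k)
    (hy : S.Peak y i' k') (hne : ¬ (i' = i ∧ k' = k)) (γ : Γ) :
    (x γ - x (S.up i' k')) * (y γ - y (S.up i k)) = 0 := by
  have hne' : ¬ (i = i' ∧ k = k') := fun h => hne ⟨h.1.symm, h.2.symm⟩
  set δ := x (S.up i' k') with hδ
  set β := y (S.up i k) with hβ
  have hδ2 : x (S.lo i' k') = δ := hx.lo_of_ne hne
  have hβ2 : y (S.lo i k) = β := hy.lo_of_ne hne'
  have h0 : x * y - β • x - δ • y = 0 := by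
    refine hS _ (S.X.sub_mem (S.X.sub_mem (S.mulX _ hx.1 _ hy.1) (S.X.smul_mem _ hx.1))
      (S.X.smul_mem _ hy.1)) ?_
    intro i'' k''
    rw [jump_sub, jump_sub, jump_smul, jump_smul]
    by_cases h1 : i'' = i ∧ k'' = k
    · obtain ⟨rfl, rfl⟩ := h1
      simp only [jump, Pi.mul_apply, hx.lo_self, hβ2, ← hβ]; ring
    · by_cases h2 : i'' = i' ∧ k'' = k'
      · obtain ⟨rfl, rfl⟩ := h2
        simp only [jump, Pi.mul_apply, hy.lo_self, hδ2, ← hδ]; ring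
      · simp only [jump, Pi.mul_apply, hx.lo_of_ne h1, hy.lo_of_ne h2]; ring
  have h1 : ∀ γ, x γ * y γ - β * x γ - δ * y γ = 0 := fun γ => by
    simpa using congrFun h0 γ
  have h2 := h1 (S.lo i k)
  have h3 := h1 (S.up i k)
  rw [hβ2, hx.lo_self] at h2
  rw [← hβ] at h3
  have h4 := h1 γ
  linear_combination h4 - h3

/-- The restriction of a peak to the regions in `par` is again a solution; it has either the same
jumps or none, depending on the parity of `k`. -/
theorem Peak.indicator (hS : S.Inj) {x : Γ → ℚ} {i k} (h : S.Peak x i k) {γ : Γ}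
    (hγ : ¬ (S.par γ ↔ Even k)) : x γ = 0 := by
  by_cases hk : Even k
  · have : {γ | S.par γ}.indicator x = x := by
      refine eq_of_jump hS (S.parX _ h.1) h.1 fun i' k' => ?_
      by_cases h1 : Even k'
      · simp [jump, Set.indicator, S.par_lo, S.par_up, h1]
      · have : ¬ (i' = i ∧ k' = k) := fun h2 => h1 (h2.2 ▸ hk)
        rw [h.2, if_neg this]
        simp [jump, Set.indicator, S.par_lo, S.par_up, h1]
    rw [← this]
    exact Set.indicator_of_notMem (by simpa [hk] using hγ) _
  · have : {γ | S.par γ}.indicator x = 0 := by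
      refine hS _ (S.parX _ h.1) fun i' k' => ?_
      by_cases h1 : Even k'
      · have h2 : ¬ (i' = i ∧ k' = k) := fun h2 => hk (h2.2 ▸ h1)
        have h3 := h.2 i' k'
        rw [if_neg h2] at h3
        simpa [jump, Set.indicator, S.par_lo, S.par_up, h1] using h3
      · simp [jump, Set.indicator, S.par_lo, S.par_up, h1]
    have h2 := congrFun this γ
    rw [Set.indicator_of_mem (by simpa [hk] using hγ)] at h2
    exact h2

theorem Peak.func_parity (hS : S.Inj) {x : Γ → ℚ} {i k} (h : S.Peak x i k) {i' j τ}
    (hp : ¬ (Even (idx j τ) ↔ Even k)) : S.func i' j τ x = 0 := by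
  cases τ
  · simp only [idx, Bool.false_eq_true, if_false] at hp
    simp only [func, Bool.false_eq_true, if_false]
    rw [h.indicator hS (γ := S.lo i' j) (by rwa [S.par_lo]),
      h.indicator hS (γ := S.lo i' (j + 2)) (by
        rw [S.par_lo]; rwa [Int.even_add (n := 2), iff_true_right (by decide : Even (2:ℤ))])]
    simp
  · simp only [idx, if_true] at hp
    simp only [func, if_true]
    rw [h.indicator hS (γ := S.up i' (j + 1)) (by rwa [S.par_up]),
      h.indicator hS (γ := S.up i' (j - 1)) (by
        rw [S.par_up]
        rw [Int.even_add_one] at hp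
        rwa [Int.even_sub_one])]
    simp

/-- At its own jump a peak takes its larger value below and its smaller value above, and `func`
compares precisely this extreme value with another one. -/
theorem Peak.func_self (hS : S.Inj) {x : Γ → ℚ} {i j τ} (h : S.Peak x i (idx j τ)) :
    S.func i j τ x = 0 ∨ S.func i j τ x = 1 := by
  cases τ
  · simp only [idx, Bool.false_eq_true, if_false] at h
    simp only [func, Bool.false_eq_true, if_false]
    rcases h.values hS (S.lo i (j + 2)) with h1 | h1 <;> rw [h1, h.lo_self] <;> norm_num
  · simp only [idx, if_true] at h
    simp only [func, if_true]
    rcases h.values hS (S.up i (j - 1)) with h1 | h1 <;> rw [h1] <;> norm_num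

/-- In the identity `dual`, the forms below and above a strip differ only through the two jumps,
which `om_difference` evaluates. -/
theorem peak_dual {x y : Γ → ℚ} {i k i' k'} (hx : S.Peak x i k) (hy : S.swap.Peak y i' k') :
    y (S.lo i (k + 1)) - y (S.lo i (k - 1)) + (x (S.up i' (k' - 1)) - x (S.up i' (k' + 1))) = 0 := by
  have hd := S.dual x hx.1 y hy.1
  have e : ∀ i'', Om (fun k => x (S.lo i'' k)) (fun k => y (S.lo i'' k)) -
      Om (fun k => x (S.up i'' k)) (fun k => y (S.up i'' k)) =
      (if i'' = i then 1 else 0) * (y (S.lo i'' (k + 1)) - y (S.lo i'' (k - 1))) +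
      (if i'' = i' then 1 else 0) * (x (S.up i'' (k' - 1)) - x (S.up i'' (k' + 1))) := by
    intro i''
    refine om_difference (S.finX_up x hx.1 i'') (S.finY_up y hy.1 i'') k k' _ _ ?_ ?_
    · intro z
      have := hx.2 i'' z
      simp only [jump] at this
      by_cases h1 : i'' = i <;> by_cases h2 : z = k <;> simp [h1, h2] at this ⊢ <;> linarith
    · intro z
      have : y (S.lo i'' z) - y (S.up i'' z) = _ := hy.2 i'' z
      by_cases h1 : i'' = i' <;> by_cases h2 : z = k' <;> simp [h1, h2] at this ⊢ <;> linarith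
  rw [e, e] at hd
  cases i <;> cases i' <;> simp at hd <;> linarith

/-- A transposition rule. The gaps compared by one equation are the neighbours of the jump attached
to the other one, which is why `τ` is negated; in different strips the lower and upper values agree,
so only one term for each peak remains. -/
theorem Peak.func_dual {x y : Γ → ℚ} {i j τ i' j' τ'} (hx : S.Peak x i' (idx j' τ'))
    (hy : S.swap.Peak y i (idx j !τ)) (hne : i ≠ i') :
    S.func i j τ x = S.func i' j' (!τ') y := by
  have hd := peak_dual hx hy
  have e1 : ∀ k, x (S.lo i k) = x (S.up i k) := fun k => hx.lo_of_ne (fun h => hne h.1)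
  have e2 : ∀ k, y (S.lo i' k) = y (S.up i' k) := fun k =>
    hy.lo_of_ne (S := S.swap) (fun h => hne h.1.symm)
  cases τ <;> cases τ' <;> simp [func, idx, e1, e2] at hd ⊢ <;> ring_nf at hd ⊢ <;> linarith

theorem Peak.func_dual_self {x y : Γ → ℚ} {i j τ} (hx : S.Peak x i (idx j τ))
    (hy : S.swap.Peak y i (idx j !τ)) : S.func i j τ x = S.swap.func i j (!τ) y := by
  have hd := peak_dual hx hy
  cases τ
  · simp only [idx, Bool.false_eq_true, if_false, Bool.not_false, if_true] at hx hy hd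
    have e1 := hx.lo_self
    have e2 := hx.lo_of_ne (i' := i) (k' := j + 2) (by rintro ⟨-, h⟩; omega)
    have e3 := hy.lo_self
    have e4 := hy.lo_of_ne (i' := i) (k' := j - 1) (by rintro ⟨-, h⟩; omega)
    simp only [func, Bool.false_eq_true, if_false, Bool.not_false, if_true]
    change y (S.lo i (j + 1)) = y (S.up i (j + 1)) + 1 at e3
    change y (S.lo i (j - 1)) = y (S.up i (j - 1)) at e4
    change _ = y (S.up i (j - 1)) - y (S.up i (j + 1))
    rw [show j + 1 - 1 = j by ring, show j + 1 + 1 = j + 2 by ring] at hd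
    linarith
  · simp only [idx, Bool.false_eq_true, if_false, Bool.not_true, if_true] at hx hy hd
    simp only [func, Bool.false_eq_true, if_false, Bool.not_true, if_true]
    change _ = y (S.lo i j) - y (S.lo i (j + 2))
    rw [show j + 1 - 1 = j by ring, show j + 1 + 1 = j + 2 by ring] at hd
    linarith

theorem not_even_idx (j : ℤ) (τ : Bool) : ¬ (Even (idx j τ) ↔ Even (idx j !τ)) := by
  cases τ <;> simp only [idx, Bool.not_true, Bool.not_false, if_true, Bool.false_eq_true, if_false,
    Int.even_add_one] <;> tauto

/-- Candidates with jumps only at `j` and `j + 1` are combinations of the two peaks there. By parity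
each of the two new equations sees only one of them, so the 2×2 matrix is diagonal. -/
theorem injStep_iff (hS : S.Inj) {i j} {x : Bool → Γ → ℚ} (hx : ∀ τ, S.Peak (x τ) i (idx j τ)) :
    S.InjStep i j ↔ ∀ τ, S.func i j τ (x τ) ≠ 0 := by
  have hpar : ∀ τ τ', τ ≠ τ' → S.func i j τ (x τ') = 0 := by
    intro τ τ' h
    apply (hx τ').func_parity hS
    have : τ' = !τ := by cases τ <;> cases τ' <;> simp_all
    rw [this]; exact not_even_idx _ _
  constructor
  · intro h τ h0
    have := h (x τ) (hx τ).1 ?_ ?_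
    · have h1 := (hx τ).lo_self
      rw [this] at h1; simp at h1
    · intro i' k hk
      rw [(hx τ).2, if_neg]
      rintro ⟨rfl, rfl⟩
      apply hk
      cases τ <;> simp [idx]
    · intro τ'
      by_cases h2 : τ' = τ
      · rw [h2, h0]
      · exact hpar _ _ h2
  · intro h z hz hj hf
    have e : z = S.jump z i j • x false + S.jump z i (j + 1) • x true := by
      refine eq_of_jump hS hz (S.X.add_mem (S.X.smul_mem _ (hx _).1) (S.X.smul_mem _ (hx _).1)) ?_
      intro i' k
      rw [jump_add, jump_smul, jump_smul, (hx _).2, (hx _).2]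
      by_cases h1 : i' = i
      · subst h1
        by_cases h2 : k = j
        · subst h2; simp [idx]
        · by_cases h3 : k = j + 1
          · subst h3; simp [idx]
          · rw [hj i' k (by tauto)]
            simp [idx, h2, h3]
      · rw [hj i' k (by tauto)]; simp [h1]
    have h1 : S.jump z i j = 0 := by
      have := hf false
      rw [e, func_add, func_smul, func_smul, hpar false true (by simp)] at this
      simpa [h false] using this
    have h2 : S.jump z i (j + 1) = 0 := by
      have := hf true
      rw [e, func_add, func_smul, func_smul, hpar true false (by simp)] at this
      simpa [h true] using this
    rw [e, h1, h2]; simp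

/-- As `y` separates the two gaps of the equation in strip `i`, `cross` identifies a value of `x`
there with its value at the jump of `y`. As `x` separates the two gaps in strip `i'`, the other
value there is the other one of its two possible values. -/
theorem cross_func (hS : S.Inj) {i j τ i' j' τ'} {x y : Γ → ℚ} (hne : i ≠ i')
    (hx : S.Peak x i (idx j τ)) (hy : S.Peak y i' (idx j' τ'))
    (hu : S.func i j τ y ≠ 0) (hv : S.func i' j' τ' x ≠ 0) :
    S.func i' j' τ' x = (if τ = τ' then 1 else -1) * (1 - 2 * S.func i j τ x) := by
  have hcr := hx.cross hS hy (fun h => hne h.1.symm)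
  have hy1 : ∀ k, y (S.lo i k) = y (S.up i k) := fun k => hy.lo_of_ne (fun h => hne h.1)
  have hx1 : ∀ k, x (S.lo i' k) = x (S.up i' k) := fun k => hx.lo_of_ne (fun h => hne h.1.symm)
  have hval := hx.values hS
  have hself := hx.lo_self
  cases τ <;> cases τ' <;>
    simp only [func, idx, if_true, Bool.false_eq_true, if_false, Bool.true_eq_false] at *
  · have h1 := hcr (S.lo i (j + 2))
    rw [mul_eq_zero, or_iff_left (by rw [← hy1 j]; intro h; apply hu; linarith)] at h1
    have h2 : x (S.lo i' (j' + 2)) ≠ x (S.lo i' j') := fun h => hv (by linarith)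
    rw [hx1 j'] at h2 ⊢
    rcases hval (S.lo i' (j' + 2)) with h3 | h3 <;> rcases hval (S.up i' j') with h4 | h4 <;>
      rw [h3, h4] at h2 ⊢ <;> simp at h2 ⊢ <;> linarith
  · have h1 := hcr (S.lo i (j + 2))
    rw [mul_eq_zero, or_iff_left (by rw [← hy1 j]; intro h; apply hu; linarith)] at h1
    have h2 : x (S.up i' (j' - 1)) ≠ x (S.up i' (j' + 1)) := fun h => hv (by linarith)
    rcases hval (S.up i' (j' - 1)) with h3 | h3 <;> rcases hval (S.up i' (j' + 1)) with h4 | h4 <;>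
      rw [h3, h4] at h2 ⊢ <;> simp at h2 ⊢ <;> linarith
  · have h1 := hcr (S.up i (j - 1))
    rw [mul_eq_zero, or_iff_left (by intro h; apply hu; linarith)] at h1
    have h2 : x (S.lo i' (j' + 2)) ≠ x (S.lo i' j') := fun h => hv (by linarith)
    rw [hx1 j'] at h2 ⊢
    rcases hval (S.lo i' (j' + 2)) with h3 | h3 <;> rcases hval (S.up i' j') with h4 | h4 <;>
      rw [h3, h4] at h2 ⊢ <;> simp at h2 ⊢ <;> linarith
  · have h1 := hcr (S.up i (j - 1))
    rw [mul_eq_zero, or_iff_left (by intro h; apply hu; linarith)] at h1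
    have h2 : x (S.up i' (j' - 1)) ≠ x (S.up i' (j' + 1)) := fun h => hv (by linarith)
    rcases hval (S.up i' (j' - 1)) with h3 | h3 <;> rcases hval (S.up i' (j' + 1)) with h4 | h4 <;>
      rw [h3, h4] at h2 ⊢ <;> simp at h2 ⊢ <;> linarith

/-- If an off-diagonal entry vanishes, both diagonal entries are nonzero, hence equal to 1.
Otherwise `cross_func` expresses the same off-diagonal entry once through the diagonal entry of `y`
and once, in the opposite system, through that of `x`, with the same sign. -/
theorem func_eq_of_det (hS : S.Solv) (hS' : S.swap.Solv) {i j τ i' j' τ'} {x y : Γ → ℚ}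
    (hne : i ≠ i') (hx : S.Peak x i (idx j τ)) (hy : S.Peak y i' (idx j' τ'))
    (hdet : S.func i j τ x * S.func i' j' τ' y - S.func i j τ y * S.func i' j' τ' x ≠ 0) :
    S.func i j τ x = S.func i' j' τ' y := by
  by_cases huv : S.func i j τ y = 0 ∨ S.func i' j' τ' x = 0
  · have h0 : S.func i j τ y * S.func i' j' τ' x = 0 := by
      rcases huv with h | h <;> rw [h] <;> simp
    rw [h0, sub_zero] at hdet
    rcases hx.func_self hS.1 with h1 | h1 <;> rcases hy.func_self hS.1 with h2 | h2 <;>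
      rw [h1, h2] at hdet ⊢ <;> simp at hdet
  · push Not at huv
    obtain ⟨x', hx'⟩ := hS'.2 i (idx j !τ)
    obtain ⟨y', hy'⟩ := hS'.2 i' (idx j' !τ')
    have e1 : S.func i j τ y = S.swap.func i' j' (!τ') x' := hy.func_dual hx' hne
    have e2 : S.func i' j' τ' x = S.swap.func i j (!τ) y' := hx.func_dual hy' hne.symm
    have e3 := hx.func_dual_self hx'
    have c1 := cross_func hS.1 hne.symm hy hx huv.2 huv.1
    have c2 := cross_func hS'.1 hne hx' hy' (by rw [← e2]; exact huv.2) (by rw [← e1]; exact huv.1)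
    rw [← e1, ← e3, c1] at c2
    cases τ <;> cases τ' <;> simp at c2 <;> linarith

/-- If a diagram and the diagram with two insertions are good, then of the diagrams with one
insertion, either both or none are good. -/
theorem diamond (hS : S.Solv) (hS' : S.swap.Solv) {j : Bool → ℤ} (h11 : S.InjBoth j) :
    S.InjStep false (j false) ↔ S.InjStep true (j true) := by
  choose P hP using hS.2
  rw [injStep_iff hS.1 (x := fun τ => P false (idx (j false) τ)) (fun τ => hP _ _),
    injStep_iff hS.1 (x := fun τ => P true (idx (j true) τ)) (fun τ => hP _ _)]
  -- For matching parities the four numbers form one block of the matrix of the double insertion;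
  -- its determinant is nonzero because the double insertion is good.
  have key : ∀ τ τ', (Even (idx (j false) τ) ↔ Even (idx (j true) τ')) →
      S.func false (j false) τ (P false (idx (j false) τ)) =
      S.func true (j true) τ' (P true (idx (j true) τ')) := by
    intro τ τ' hpar
    have hx := hP false (idx (j false) τ)
    have hy := hP true (idx (j true) τ')
    refine func_eq_of_det hS hS' (by simp) hx hy ?_
    intro hdet
    set x := P false (idx (j false) τ)
    set y := P true (idx (j true) τ')
    have hx0 : S.func false (j false) (!τ) x = 0 ∧ S.func true (j true) (!τ') x = 0 :=
      ⟨hx.func_parity hS.1 (fun h => not_even_idx _ _ h.symm),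
        hx.func_parity hS.1 (fun h => not_even_idx (j true) τ' (hpar.symm.trans h.symm))⟩
    have hy0 : S.func false (j false) (!τ) y = 0 ∧ S.func true (j true) (!τ') y = 0 :=
      ⟨hy.func_parity hS.1 (fun h => not_even_idx (j false) τ (hpar.trans h.symm)),
        hy.func_parity hS.1 (fun h => not_even_idx _ _ h.symm)⟩
    have main : ∀ α β : ℚ,
        α * S.func false (j false) τ x + β * S.func false (j false) τ y = 0 →
        α * S.func true (j true) τ' x + β * S.func true (j true) τ' y = 0 → α = 0 ∧ β = 0 := by
      intro α β h1 h2
      have h3 := h11 (α • x + β • y) (S.X.add_mem (S.X.smul_mem _ hx.1) (S.X.smul_mem _ hy.1)) ?_ ?_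
      · have e1 : S.jump (α • x + β • y) false (idx (j false) τ) = α := by
          rw [jump_add, jump_smul, jump_smul, hx.2, hy.2]; simp
        have e2 : S.jump (α • x + β • y) true (idx (j true) τ') = β := by
          rw [jump_add, jump_smul, jump_smul, hx.2, hy.2]; simp
        rw [h3] at e1 e2
        exact ⟨by rw [← e1]; simp [jump], by rw [← e2]; simp [jump]⟩
      · intro i k hk
        rw [jump_add, jump_smul, jump_smul, hx.2, hy.2, if_neg, if_neg]
        · simp
        · rintro ⟨rfl, rfl⟩; apply hk; cases τ' <;> simp [idx]
        · rintro ⟨rfl, rfl⟩; apply hk; cases τ <;> simp [idx]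
      · intro i τ''
        rw [func_add, func_smul, func_smul]
        cases i
        · by_cases h : τ'' = τ
          · rw [h]; exact h1
          · have : τ'' = !τ := by cases τ'' <;> cases τ <;> simp_all
            rw [this, hx0.1, hy0.1]; simp
        · by_cases h : τ'' = τ'
          · rw [h]; exact h2
          · have : τ'' = !τ' := by cases τ'' <;> cases τ' <;> simp_all
            rw [this, hx0.2, hy0.2]; simp
    -- A zero determinant makes both of these vectors solutions, so all four entries vanish; then
    -- `(1, 0)` is a solution too, which is absurd.
    have m1 := main (S.func true (j true) τ' y) (- S.func true (j true) τ' x)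
      (by linarith) (by ring)
    have m2 := main (S.func false (j false) τ y) (- S.func false (j false) τ x)
      (by ring) (by linarith)
    have m3 := main 1 0 (by linarith [m2.2]) (by linarith [m1.2])
    simp at m3
  -- Between the two strips, parity matches the equations either straight or crosswise.
  by_cases hpar : Even (idx (j false) false) ↔ Even (idx (j true) false)
  · have k1 := key false false hpar
    have k2 := key true true (by
      simp only [idx, if_true, Bool.false_eq_true, if_false, Int.even_add_one] at hpar ⊢; tauto)
    simp [Bool.forall_bool, k1, k2]
  · have k1 := key false true (by
      simp only [idx, if_true, Bool.false_eq_true, if_false, Int.even_add_one] at hpar ⊢; tauto)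
    have k2 := key true false (by
      simp only [idx, if_true, Bool.false_eq_true, if_false, Int.even_add_one] at hpar ⊢; tauto)
    simp [Bool.forall_bool, k1, k2, and_comm]

/-- After a good insertion, the new system of equations is again solvable. -/
theorem peak_step (hS : S.Solv) {i j} (h : S.InjStep i j) {i' k}
    (hk : ¬ (i' = i ∧ (k = j ∨ k = j + 1))) :
    ∃ x ∈ S.X, (∀ τ, S.func i j τ x = 0) ∧
      ∀ i'' k'', ¬ (i'' = i ∧ (k'' = j ∨ k'' = j + 1)) →
        S.jump x i'' k'' = if i'' = i' ∧ k'' = k then 1 else 0 := by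
  choose P hP using hS.2
  have hr := (injStep_iff hS.1 (x := fun τ => P i (idx j τ)) (fun τ => hP _ _)).1 h
  have hpar : ∀ τ τ', τ ≠ τ' → S.func i j τ (P i (idx j τ')) = 0 := by
    intro τ τ' h
    apply (hP i (idx j τ')).func_parity hS.1
    have : τ' = !τ := by cases τ <;> cases τ' <;> simp_all
    rw [this]; exact not_even_idx _ _
  -- Each equation is repaired by its own peak; the other correction does not affect it, by parity.
  set c : Bool → ℚ := fun τ => S.func i j τ (P i' k) / S.func i j τ (P i (idx j τ)) with hc
  refine ⟨P i' k - (c false • P i (idx j false) + c true • P i (idx j true)),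
    S.X.sub_mem (hP _ _).1 (S.X.add_mem (S.X.smul_mem _ (hP _ _).1) (S.X.smul_mem _ (hP _ _).1)),
    ?_, ?_⟩
  · intro τ
    rw [func_sub, func_add, func_smul, func_smul]
    have hr' := hr τ
    cases τ
    · rw [hpar false true (by simp)]
      simp only [hc] at hr' ⊢
      field_simp; ring
    · rw [hpar true false (by simp)]
      simp only [hc] at hr' ⊢
      field_simp; ring
  · intro i'' k'' hk''
    rw [jump_sub, jump_add, jump_smul, jump_smul, (hP _ _).2, (hP _ _).2, (hP _ _).2,
      if_neg (c := i'' = i ∧ k'' = idx j false), if_neg (c := i'' = i ∧ k'' = idx j true)]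
    · simp
    · rintro ⟨rfl, rfl⟩; exact hk'' ⟨rfl, by simp [idx]⟩
    · rintro ⟨rfl, rfl⟩; exact hk'' ⟨rfl, by simp⟩

/-- The duality identifies the two diagonal entries of one system with those of the other, in
exchanged order. -/
theorem injStep_swap (hS : S.Solv) (hS' : S.swap.Solv) {i j} :
    S.swap.InjStep i j ↔ S.InjStep i j := by
  choose P hP using hS.2
  choose P' hP' using hS'.2
  rw [injStep_iff hS.1 (x := fun τ => P i (idx j τ)) (fun τ => hP _ _),
    injStep_iff hS'.1 (x := fun τ => P' i (idx j τ)) (fun τ => hP' _ _)]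
  have e : ∀ τ, S.func i j τ (P i (idx j τ)) = S.swap.func i j (!τ) (P' i (idx j !τ)) :=
    fun τ => (hP i (idx j τ)).func_dual_self (hP' i (idx j !τ))
  simp only [Bool.forall_bool, e, Bool.not_true, Bool.not_false]
  tauto

end Strips

/-! ### Parity and nesting of cups -/

namespace CupDiagram
variable (c : CupDiagram)

@[simp] theorem partner_partner (x : ℤ) : c.partner (c.partner x) = x := c.invol x

theorem partner_injective : Injective c.partner := fun x y h => by
  rw [← c.invol x, h, c.invol]

theorem mem_endpoints {x : ℤ} : x ∈ c.endpoints ↔ c.partner x ≠ x := by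
  simp [endpoints]

theorem mem_rightEnds {x : ℤ} : x ∈ c.rightEnds ↔ c.partner x < x := by
  simp only [rightEnds, Finset.mem_filter, mem_endpoints]
  exact ⟨fun h => h.2, fun h => ⟨h.ne, h⟩⟩

theorem partner_ne_partner {x : ℤ} (h : c.partner x ≠ x) :
    c.partner (c.partner x) ≠ c.partner x := by
  rw [c.invol]; exact h.symm

/-- A point strictly between the endpoints of a cup. -/
theorem nested {a k : ℤ} (h1 : a < k) (h2 : k < c.partner a) :
    c.partner k ≠ k ∧ a < c.partner k ∧ c.partner k < c.partner a := c.noncrossing a k h1 h2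

theorem nested' {b k : ℤ} (h1 : c.partner b < k) (h2 : k < b) :
    c.partner k ≠ k ∧ c.partner b < c.partner k ∧ c.partner k < b := by
  have := c.noncrossing (c.partner b) k h1 (by simpa using h2)
  simpa using this

/-- The terms cancel in pairs along the cups. Parity counts, the reduction of `Om` to the rays and
the flux all rest on this. -/
theorem sum_closed_eq_zero {M : Type*} [AddCommGroup M] {F : ℤ → M}
    (hF : ∀ x, c.partner x ≠ x → F (c.partner x) = - F x) (s : Finset ℤ)
    (hs : ∀ x ∈ s, c.partner x ∈ s) (hr : ∀ x ∈ s, c.partner x = x → F x = 0) :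
    ∑ x ∈ s, F x = 0 := by
  refine Finset.sum_involution (fun x _ => c.partner x) ?_ ?_ ?_ ?_
  · intro x hx
    by_cases h : c.partner x = x
    · rw [h, hr x hx h, add_zero]
    · rw [hF x h, add_neg_cancel]
  · intro x hx h0 h
    exact h0 (hr x hx h)
  · intro x hx; exact hs x hx
  · intro x hx; exact c.invol x

theorem even_card {s : Finset ℤ} (hs : ∀ x ∈ s, c.partner x ∈ s)
    (hr : ∀ x ∈ s, c.partner x ≠ x) : Even s.card := by
  -- In `ZMod 2` the constant 1 equals its negative, so the cancelling sum is the cardinality modulo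
  -- 2.
  have h := c.sum_closed_eq_zero (F := fun _ => (1 : ZMod 2)) (fun _ _ => by decide) s hs
    (fun x hx h => absurd h (hr x hx))
  simp only [Finset.sum_const, nsmul_eq_mul, mul_one] at h
  exact (ZMod.natCast_eq_zero_iff_even).1 h

/-- The points strictly inside a cup are paired among themselves, so their number is even. -/
theorem even_partner {x : ℤ} (h : c.partner x ≠ x) : ¬ (Even (c.partner x) ↔ Even x) := by
  have key : ∀ a, a < c.partner a → ¬ (Even (c.partner a) ↔ Even a) := by
    intro a ha
    have h1 := c.even_card (s := Finset.Ioo a (c.partner a))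
      (fun k hk => by
        rw [Finset.mem_Ioo] at hk ⊢
        exact (c.nested hk.1 hk.2).2)
      (fun k hk => by
        rw [Finset.mem_Ioo] at hk
        exact (c.nested hk.1 hk.2).1)
    rw [Int.card_Ioo] at h1
    intro h2
    obtain ⟨m, hm⟩ := h1
    have h3 : c.partner a = a + (m + m) + 1 := by omega
    rw [h3, Int.even_add_one, Int.even_add] at h2
    tauto
  rcases lt_or_gt_of_ne h with h1 | h1
  · have := key (c.partner x) (by simpa using h1)
    simp only [partner_partner] at this
    tauto
  · exact key x h1

/-! ### Enumeration of the rays -/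

theorem straight_succ (x : ℤ) :
    c.straight (x + 1) = c.straight x + if c.partner (x + 1) = x + 1 then 1 else 0 := by
  have h : (c.endpoints.filter (fun p => x < p)) =
      (c.endpoints.filter (fun p => x + 1 < p)) ∪ (c.endpoints.filter (fun p => p = x + 1)) := by
    ext p; simp only [Finset.mem_filter, Finset.mem_union]
    constructor
    · rintro ⟨h1, h2⟩
      by_cases h3 : p = x + 1
      · exact Or.inr ⟨h1, h3⟩
      · exact Or.inl ⟨h1, by omega⟩
    · rintro (⟨h1, h2⟩ | ⟨h1, h2⟩) <;> exact ⟨h1, by omega⟩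
  have hd : Disjoint (c.endpoints.filter (fun p => x + 1 < p))
      (c.endpoints.filter (fun p => p = x + 1)) := by
    rw [Finset.disjoint_left]
    intro p h1 h2
    simp only [Finset.mem_filter] at h1 h2
    omega
  unfold straight
  rw [h, Finset.card_union_of_disjoint hd, Finset.filter_eq']
  by_cases h1 : c.partner (x + 1) = x + 1
  · rw [if_pos h1, if_neg (by rw [mem_endpoints]; tauto)]
    simp; ring
  · rw [if_neg h1, if_pos (by rw [mem_endpoints]; tauto)]
    simp; ring

theorem straight_mono : Monotone c.straight :=
  monotone_int_of_le_succ fun x => by rw [straight_succ]; split_ifs <;> omega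

theorem le_straight (x : ℤ) : x ≤ c.straight x := by unfold straight; omega

theorem straight_le (x : ℤ) : c.straight x ≤ x + c.endpoints.card := by
  unfold straight
  have := Finset.card_filter_le c.endpoints (fun p => x < p)
  omega

/-- `straight` stays within bounded distance of the identity and increases by one exactly at the
rays, so the first point where it reaches `k` is a ray. -/
theorem exists_ray (k : ℤ) : ∃ r, c.partner r = r ∧ c.straight r = k := by
  obtain ⟨r, hr, hmin⟩ := Int.exists_least_of_bdd (P := fun x => k ≤ c.straight x)
    ⟨k - c.endpoints.card, fun z hz => by have := c.straight_le z; omega⟩ ⟨k, c.le_straight k⟩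
  have h1 : c.straight (r - 1) < k := by
    by_contra h
    have := hmin (r - 1) (by omega)
    omega
  have h2 := c.straight_succ (r - 1)
  rw [sub_add_cancel] at h2
  refine ⟨r, ?_, ?_⟩
  · by_contra h
    rw [if_neg h] at h2; omega
  · split_ifs at h2 <;> omega

/-- The ray with straightened position `k`. -/
def ray (k : ℤ) : ℤ := (c.exists_ray k).choose

@[simp] theorem partner_ray (k : ℤ) : c.partner (c.ray k) = c.ray k := (c.exists_ray k).choose_spec.1
@[simp] theorem straight_ray (k : ℤ) : c.straight (c.ray k) = k := (c.exists_ray k).choose_spec.2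

theorem straight_lt {r s : ℤ} (hs : c.partner s = s) (h : r < s) : c.straight r < c.straight s := by
  have h1 := c.straight_succ (s - 1)
  rw [sub_add_cancel, if_pos hs] at h1
  have := c.straight_mono (show r ≤ s - 1 by omega)
  omega

theorem ray_straight {r : ℤ} (hr : c.partner r = r) : c.ray (c.straight r) = r := by
  rcases lt_trichotomy (c.ray (c.straight r)) r with h | h | h
  · have := c.straight_lt hr h; simp at this
  · exact h
  · have := c.straight_lt (c.partner_ray _) h; simp at this

theorem ray_strictMono : StrictMono c.ray := by
  intro j k h
  by_contra h1
  have := c.straight_mono (not_lt.1 h1)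
  simp at this; omega

theorem ray_injective : Injective c.ray := c.ray_strictMono.injective

theorem partner_ne_of_between {x k : ℤ} (h1 : c.ray k < x) (h2 : x < c.ray (k + 1)) :
    c.partner x ≠ x := by
  intro h
  have h3 := c.straight_lt h h1
  have h4 := c.straight_lt (c.partner_ray (k + 1)) h2
  simp at h3 h4; omega

theorem ray_succ_eq {r s : ℤ} {k : ℤ} (hr : c.ray k = r) (hs : c.partner s = s) (h : r < s)
    (hb : ∀ x, r < x → x < s → c.partner x ≠ x) : c.ray (k + 1) = s := by
  subst hr
  have h1 : c.ray k < c.ray (k + 1) := c.ray_strictMono (by omega)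
  rcases lt_trichotomy (c.ray (k + 1)) s with h2 | h2 | h2
  · exact absurd (c.partner_ray _) (hb _ h1 h2)
  · exact h2
  · exact absurd hs (c.partner_ne_of_between h h2)

theorem exists_bound : ∃ N : ℤ, 0 ≤ N ∧ ∀ x, c.partner x ≠ x → |x| ≤ N := by
  obtain ⟨N, hN⟩ := (c.endpoints.image (fun x => |x|)).exists_le
  refine ⟨max N 0, le_max_right _ _, fun x hx => (hN _ ?_).trans (le_max_left _ _)⟩
  exact Finset.mem_image_of_mem _ (c.mem_endpoints.2 hx)

theorem straight_of_large {x : ℤ} (h : ∀ p, x < p → c.partner p = p) : c.straight x = x := by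
  unfold straight
  rw [Finset.filter_eq_empty_iff.2]
  · simp
  · intro p hp hx
    exact (c.mem_endpoints.1 hp) (h p hx)

/-- A gap that is not below a cup. -/
def Outer (x : ℤ) : Prop := ∀ z, z < x → c.partner z < x

theorem outer_ray {r : ℤ} (hr : c.partner r = r) : c.Outer r := by
  intro z hz
  by_contra h
  rcases lt_or_eq_of_le (not_lt.1 h) with h1 | h1
  · exact (c.nested hz h1).1 hr
  · rw [h1, partner_partner] at hr; omega

theorem outer_ray_succ {r : ℤ} (hr : c.partner r = r) : c.Outer (r + 1) := by
  intro z hz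
  by_cases h1 : z = r
  · rw [h1, hr]; omega
  · have := c.outer_ray hr z (by omega); omega

/-- A cup that ends just left of an outer gap is outermost, so the gap left of the whole cup is
outer again. -/
theorem Outer.step {x : ℤ} (h : c.Outer x) (hx : c.partner (x - 1) ≠ x - 1) :
    c.partner (x - 1) < x - 1 ∧ c.Outer (c.partner (x - 1)) := by
  have h1 := h (x - 1) (by omega)
  have h2 : c.partner (x - 1) < x - 1 := by omega
  refine ⟨h2, fun z hz => ?_⟩
  by_contra h3
  have h4 := h z (by omega)
  rcases lt_or_eq_of_le (not_lt.1 h3) with h5 | h5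
  · rcases lt_or_eq_of_le (show c.partner z ≤ x - 1 by omega) with h6 | h6
    · have := c.nested' h5 h6
      simp at this; omega
    · rw [← h6] at hz; simp at hz
  · have := c.partner_injective h5; omega

/-! ### Functions on the gaps -/

/-- The function `p` on the gaps agrees on gaps which are joined below a cup. -/
def Compat (p : ℤ → ℚ) : Prop := ∀ x, c.partner x ≠ x → p (c.partner x + 1) = p x

/-- The function `p` agrees on gaps which are joined below a cup, and on neighbours of a ray. -/
def Closed (p : ℤ → ℚ) : Prop := ∀ x, p (c.partner x + 1) = p x

variable {c}

theorem Closed.compat {p : ℤ → ℚ} (h : c.Closed p) : c.Compat p := fun x _ => h x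

theorem Compat.left {p : ℤ → ℚ} (h : c.Compat p) {x : ℤ} (hx : c.partner x ≠ x) :
    p (c.partner x) = p (x + 1) := by
  have := h (c.partner x) (c.partner_ne_partner hx)
  simpa using this.symm

theorem compat_cap {p : ℤ → ℚ} : c.cap.Compat p ↔ c.Compat (fun x => p (x + 1)) := by
  constructor
  · intro h x hx
    have := h (x + 1) (by simpa [cap] using hx)
    simpa [cap] using this
  · intro h x hx
    have := h (x - 1) (by intro h; apply hx; simp [cap, h])
    simpa [cap] using this

theorem closed_cap {p : ℤ → ℚ} : c.cap.Closed p ↔ c.Closed (fun x => p (x + 1)) := by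
  constructor
  · intro h x
    have := h (x + 1)
    simpa [cap] using this
  · intro h x
    have := h (x - 1)
    simpa [cap] using this

theorem Compat.mul {p q : ℤ → ℚ} (hp : c.Compat p) (hq : c.Compat q) : c.Compat (p * q) :=
  fun x hx => by simp [hp x hx, hq x hx]
theorem Closed.mul {p q : ℤ → ℚ} (hp : c.Closed p) (hq : c.Closed q) : c.Closed (p * q) :=
  fun x => by simp [hp x, hq x]

/-- Gaps joined below a cup have the same parity, by `even_partner`. -/
theorem Compat.par {p : ℤ → ℚ} (hp : c.Compat p) : c.Compat ({k | ¬ Even k}.indicator p) := by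
  intro x hx
  have := c.even_partner hx
  by_cases h : Even x <;> simp only [Set.indicator, Set.mem_ofPred_eq, Int.even_add_one, h, hp x hx] <;>
    simp_all
variable (c) in
/-- The values of a function on the outer gaps. -/
def hat (p : ℤ → ℚ) (k : ℤ) : ℚ := p (c.ray k + 1)

/-- From an outer gap one moves left by jumping over the outermost cups until the ray `c.ray k` is
reached. -/
theorem Compat.outer_eq {p : ℤ → ℚ} (hp : c.Compat p) {x : ℤ} (hx : c.Outer x) {k : ℤ}
    (h1 : c.ray k < x) (h2 : x ≤ c.ray (k + 1)) : p x = p (c.ray k + 1) := by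
  obtain ⟨m, hm⟩ : ∃ m : ℕ, x = c.ray k + 1 + m := ⟨(x - (c.ray k + 1)).toNat, by omega⟩
  induction m using Nat.strong_induction_on generalizing x with
  | _ m ih =>
    by_cases h0 : x = c.ray k + 1
    · rw [h0]
    · have h3 : c.partner (x - 1) ≠ x - 1 := c.partner_ne_of_between (k := k) (by omega) (by omega)
      obtain ⟨h4, h5⟩ := hx.step c h3
      have h6 : p (c.partner (x - 1)) = p x := by
        have := hp.left h3; simpa using this
      have h7 : c.ray k < c.partner (x - 1) := by
        by_contra h
        rcases lt_or_eq_of_le (not_lt.1 h) with h8 | h8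
        · exact (c.nested' h8 (by omega)).1 (c.partner_ray k)
        · have := c.partner_ray k
          rw [← h8] at this; simp at this; omega
      rw [← h6]
      exact ih (c.partner (x - 1) - (c.ray k + 1)).toNat (by omega) h5 h7 (by omega) (by omega)

theorem Compat.ray_left {p : ℤ → ℚ} (hp : c.Compat p) (k : ℤ) :
    p (c.ray k) = p (c.ray (k - 1) + 1) := by
  refine hp.outer_eq (c.outer_ray (c.partner_ray k)) (c.ray_strictMono (by omega)) ?_
  rw [sub_add_cancel]

theorem exists_ray_lt (x : ℤ) : ∃ k, c.ray k < x ∧ x ≤ c.ray (k + 1) := by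
  refine ⟨c.straight (x - 1), ?_, ?_⟩
  · by_contra h
    rcases lt_or_eq_of_le (not_lt.1 h) with h1 | h1
    · have := c.straight_lt (c.partner_ray (c.straight (x - 1))) (show x - 1 < _ by omega)
      simp at this
    · have := c.straight_lt (c.partner_ray (c.straight (x - 1))) (show x - 1 < _ by omega)
      simp at this
  · by_contra h
    have := c.straight_mono (show c.ray (c.straight (x - 1) + 1) ≤ x - 1 by omega)
    simp at this

/-- No cup straddles a ray, so the number of endpoints to its right, by which `straight` shifts, is
even. -/
theorem even_ray (k : ℤ) : Even (c.ray k) ↔ Even k := by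
  have h : Even ((c.endpoints.filter (fun p => c.ray k < p)).card) := by
    refine c.even_card ?_ ?_
    · intro x hx
      rw [Finset.mem_filter, mem_endpoints] at hx ⊢
      refine ⟨c.partner_ne_partner hx.1, ?_⟩
      by_contra h
      have h1 := c.outer_ray_succ (c.partner_ray k) (c.partner x) (by omega)
      simp at h1; omega
    · intro x hx
      rw [Finset.mem_filter, mem_endpoints] at hx
      exact hx.1
  have h2 := c.straight_ray k
  unfold straight at h2
  nth_rewrite 2 [← h2]
  rw [Int.even_add]
  simp [h]

theorem hat_finite {p : ℤ → ℚ} (hf : (support p).Finite) : (support (c.hat p)).Finite := by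
  refine (hf.preimage (f := fun k => c.ray k + 1) ?_)
  intro a _ b _ h
  exact c.ray_injective (by simpa using h)

theorem Closed.hat_eq {p : ℤ → ℚ} (hp : c.Closed p) (k : ℤ) : c.hat p k = c.hat p (k - 1) := by
  unfold hat
  have := hp (c.ray k)
  rw [partner_ray] at this
  rw [this, hp.compat.ray_left]

theorem eq_zero_of_succ_eq {f : ℤ → ℚ} (h : ∀ k, f k = f (k - 1)) (hf : (support f).Finite) :
    ∀ k, f k = 0 := by
  intro k
  by_contra h0
  have h1 : ∀ m : ℕ, f (k + m) = f k := by
    intro m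
    induction m with
    | zero => simp
    | succ m ih => rw [← ih, h (k + (m + 1 : ℕ))]; congr 1; push_cast; ring
  refine Set.infinite_of_injective_forall_mem (f := fun m : ℕ => k + (m : ℤ)) (s := support f) ?_ ?_ hf
  · intro a b hab; simpa using hab
  · intro m; rw [mem_support, h1]; exact h0

theorem Closed.hat_zero {p : ℤ → ℚ} (hp : c.Closed p) (hf : (support p).Finite) (k : ℤ) :
    c.hat p k = 0 :=
  eq_zero_of_succ_eq hp.hat_eq (hat_finite hf) k

theorem Closed.outer_zero {p : ℤ → ℚ} (hp : c.Closed p) (hf : (support p).Finite) {x : ℤ}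
    (hx : c.Outer x) : p x = 0 := by
  obtain ⟨k, h1, h2⟩ := exists_ray_lt (c := c) x
  rw [hp.compat.outer_eq hx h1 h2]
  exact hp.hat_zero hf k

/-- The two gaps next to a ray have different parities, but this does no harm: finite support makes
a closed function vanish on both. -/
theorem Closed.par {p : ℤ → ℚ} (hp : c.Closed p) (hf : (support p).Finite) :
    c.Closed ({k | ¬ Even k}.indicator p) := by
  intro x
  by_cases hx : c.partner x = x
  · have h1 := hp.outer_zero hf (c.outer_ray hx)
    have h2 := hp.outer_zero hf (c.outer_ray_succ hx)
    rw [hx, Set.indicator_apply, Set.indicator_apply, h1, h2]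
    simp
  · exact hp.compat.par x hx

/-! ### The form `Om` and the outer gaps -/

theorem finsum_eq_comp {ι : ℤ → ℤ} (hι : Injective ι) {s : Finset ℤ}
    (hs : ∀ x, x ∈ Set.range ι ↔ x ∉ s) {F : ℤ → ℚ} (hF : (support F).Finite)
    (h0 : ∑ x ∈ s, F x = 0) : ∑ᶠ x, F x = ∑ᶠ k, F (ι k) := by
  have h1 : ∑ᶠ x ∈ (s : Set ℤ) ∪ Set.range ι, F x =
      ∑ᶠ x ∈ (s : Set ℤ), F x + ∑ᶠ x ∈ Set.range ι, F x := by
    refine finsum_mem_union' ?_ (hF.subset Set.inter_subset_right) (hF.subset Set.inter_subset_right)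
    rw [Set.disjoint_left]
    intro x h2 h3
    exact (hs x).1 h3 h2
  have h2 : (s : Set ℤ) ∪ Set.range ι = Set.univ := by
    ext x
    by_cases h : x ∈ s
    · simp [h]
    · have := (hs x).2 h
      simp [this]
  rw [h2, finsum_mem_univ, finsum_mem_coe_finset, h0, zero_add, finsum_mem_range hι] at h1
  exact h1

theorem mem_range_ray {x : ℤ} : x ∈ Set.range c.ray ↔ x ∉ c.endpoints := by
  rw [mem_endpoints, not_not]
  constructor
  · rintro ⟨k, rfl⟩; simp
  · intro h; exact ⟨_, c.ray_straight h⟩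

theorem finsum_eq_rays {F : ℤ → ℚ} (hF : (support F).Finite)
    (ha : ∀ x, c.partner x ≠ x → F (c.partner x) = - F x) : ∑ᶠ x, F x = ∑ᶠ k, F (c.ray k) := by
  refine finsum_eq_comp c.ray_injective (fun x => mem_range_ray) hF ?_
  refine c.sum_closed_eq_zero ha _ ?_ ?_
  · intro x hx
    rw [mem_endpoints] at hx ⊢
    exact c.partner_ne_partner hx
  · intro x hx h
    exact absurd h (c.mem_endpoints.1 hx)

/-- The summands of `Om` at the two ends of a cup are opposite, so only the rays contribute, and the
gaps next to consecutive rays are the consecutive outer gaps. -/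
theorem om_hat {f g : ℤ → ℚ} (hf : (support f).Finite) (h1 : c.Compat f) (h2 : c.Compat g) :
    Om f g = Om (c.hat f) (c.hat g) := by
  unfold Om
  rw [finsum_eq_rays (c := c) (om_support_finite hf), ← finsum_comp_equiv (Equiv.addRight (1 : ℤ))]
  · refine finsum_congr fun k => ?_
    simp only [Equiv.coe_addRight, hat, h1.ray_left, h2.ray_left, add_sub_cancel_right]
  · intro x hx
    rw [h1.left hx, h2.left hx, h1 x hx, h2 x hx]; ring

/-- The ray of `c.cap` that comes from `c.ray k` sits at `c.ray k + 1`. So the gap used by `hat` at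
index `k` is left of this ray of the cap diagram, but right of the `k`-th ray of the cup diagram.
Hence lines of a middle section join `c.ray k + 1` below to `c.ray (k + 1)` above. -/
theorem Compat.ray_left_cap {p : ℤ → ℚ} (hp : c.cap.Compat p) (k : ℤ) :
    p (c.ray k + 2) = p (c.ray (k + 1) + 1) := by
  have := (compat_cap.1 hp).ray_left (k + 1)
  simp only [add_sub_cancel_right] at this
  rw [this]; ring_nf

theorem om_shift (f g : ℤ → ℚ) : Om (fun x => f (x + 1)) (fun x => g (x + 1)) = Om f g := by
  unfold Om
  rw [← finsum_comp_equiv (Equiv.addRight (1 : ℤ))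
    (f := fun k => f k * g (k + 1) - f (k + 1) * g k)]
  rfl

theorem support_shift_finite {f : ℤ → ℚ} (hf : (support f).Finite) (n : ℤ) :
    (support fun x => f (x + n)).Finite :=
  hf.preimage (f := fun x => x + n) (fun a _ b _ h => by simpa using h)

theorem om_hat_cap {f g : ℤ → ℚ} (hf : (support f).Finite) (h1 : c.cap.Compat f)
    (h2 : c.cap.Compat g) : Om f g = Om (c.hat f) (c.hat g) := by
  rw [← om_shift, om_hat (support_shift_finite hf 1) (compat_cap.1 h1) (compat_cap.1 h2),
    ← om_shift (c.hat f)]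
  congr 1 <;> ext k <;> simp only [hat]
  · rw [← h1.ray_left_cap]; ring_nf
  · rw [← h2.ray_left_cap]; ring_nf

/-- The form lives on the outer gaps, where closed functions vanish. -/
theorem om_zero_of_closed {f g : ℤ → ℚ} (hf : (support f).Finite) (hg : (support g).Finite)
    (h1 : c.Compat f) (h2 : c.Closed g) : Om f g = 0 := by
  rw [om_hat hf h1 h2.compat]
  have : c.hat g = 0 := funext (h2.hat_zero hg)
  rw [this]
  simp [Om]

end CupDiagram

/-! ### Insertion of a cup and a cap into a strip -/

namespace Strips
variable {Γ : Type}

/-- The positions of the old strip that survive an insertion at `j`. -/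
def skip (j k : ℤ) : ℤ := if j + 2 ≤ k then k else k - 2

theorem skip_ne (j k : ℤ) : ¬ (skip j k = j ∨ skip j k = j + 1) := by
  unfold skip; split_ifs <;> omega

theorem exists_skip {j k : ℤ} (h : ¬ (k = j ∨ k = j + 1)) : ∃ k', skip j k' = k := by
  by_cases h1 : j + 2 ≤ k
  · exact ⟨k, by simp [skip, h1]⟩
  · exact ⟨k + 2, by rw [skip, if_neg (by omega)]; ring⟩

theorem skip_inj {j k k' : ℤ} : skip j k = skip j k' ↔ k = k' := by
  unfold skip; split_ifs <;> omega

/-- `S'` arises from `S` by an insertion in the strip `i` at position `j`. -/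
structure Insertion (S S' : Strips Γ) (i : Bool) (j : ℤ) : Prop where
  memX : ∀ x, x ∈ S'.X ↔ x ∈ S.X ∧ ∀ τ, S.func i j τ x = 0
  memY : ∀ x, x ∈ S'.Y ↔ x ∈ S.Y ∧ ∀ τ, S.func i j τ x = 0
  lo_self : ∀ k, S'.lo i k = S.lo i (skip j k)
  up_self : ∀ k, S'.up i k = S.up i (skip j k)
  lo_other : ∀ k, S'.lo (!i) k = S.lo (!i) k
  up_other : ∀ k, S'.up (!i) k = S.up (!i) k

variable {S S' : Strips Γ} {i : Bool} {j : ℤ}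

theorem Insertion.swap (h : Insertion S S' i j) : Insertion S.swap S'.swap i j where
  memX := h.memY
  memY := h.memX
  lo_self := h.lo_self
  up_self := h.up_self
  lo_other := h.lo_other
  up_other := h.up_other

theorem Insertion.jump_self (h : Insertion S S' i j) (x : Γ → ℚ) (k : ℤ) :
    S'.jump x i k = S.jump x i (skip j k) := by simp [jump, h.lo_self, h.up_self]

theorem Insertion.jump_other (h : Insertion S S' i j) (x : Γ → ℚ) (k : ℤ) :
    S'.jump x (!i) k = S.jump x (!i) k := by simp [jump, h.lo_other, h.up_other]

theorem Insertion.func_other (h : Insertion S S' i j) (x : Γ → ℚ) (k : ℤ) (τ : Bool) :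
    S'.func (!i) k τ x = S.func (!i) k τ x := by simp [func, h.lo_other, h.up_other]

theorem Insertion.forall_jump (h : Insertion S S' i j) (x : Γ → ℚ) :
    (∀ i' k, S'.jump x i' k = 0) ↔
      ∀ i' k, ¬ (i' = i ∧ (k = j ∨ k = j + 1)) → S.jump x i' k = 0 := by
  constructor
  · intro h1 i' k hk
    by_cases hi : i' = i
    · subst hi
      obtain ⟨k', rfl⟩ := exists_skip (j := j) (k := k) (by tauto)
      rw [← h.jump_self]; exact h1 _ _
    · have : i' = !i := by cases i' <;> cases i <;> simp_all
      rw [this, ← h.jump_other]; exact h1 _ _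
  · intro h1 i' k
    by_cases hi : i' = i
    · subst hi
      rw [h.jump_self]
      exact h1 _ _ (fun h2 => skip_ne j k h2.2)
    · have : i' = !i := by cases i' <;> cases i <;> simp_all
      rw [this, h.jump_other]
      exact h1 _ _ (fun h2 => by cases i <;> simp at h2)

theorem Insertion.inj_iff (h : Insertion S S' i j) : S'.Inj ↔ S.InjStep i j := by
  constructor
  · intro h1 x hx h2 h3
    exact h1 x ((h.memX x).2 ⟨hx, h3⟩) ((h.forall_jump x).2 h2)
  · intro h1 x hx h2
    exact h1 x ((h.memX x).1 hx).1 ((h.forall_jump x).1 h2) ((h.memX x).1 hx).2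

theorem Insertion.solv (h : Insertion S S' i j) (hS : S.Solv) (h1 : S'.Inj) : S'.Solv := by
  refine ⟨h1, fun i' k => ?_⟩
  by_cases hi : i' = i
  · subst hi
    obtain ⟨x, hx, hf, hj⟩ := peak_step hS (h.inj_iff.1 h1) (i' := i') (k := skip j k)
      (fun h2 => skip_ne j k h2.2)
    refine ⟨x, (h.memX x).2 ⟨hx, hf⟩, fun i'' k'' => ?_⟩
    by_cases hi2 : i'' = i'
    · subst hi2
      rw [h.jump_self, hj _ _ (fun h2 => skip_ne j k'' h2.2)]
      simp only [skip_inj]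
    · have : i'' = !i' := by cases i'' <;> cases i' <;> simp_all
      rw [this, h.jump_other, hj _ _ (fun h2 => by cases i' <;> simp at h2)]
      cases i' <;> simp
  · have hi1 : i' = !i := by cases i' <;> cases i <;> simp_all
    subst hi1
    obtain ⟨x, hx, hf, hj⟩ := peak_step hS (h.inj_iff.1 h1) (i' := !i) (k := k)
      (fun h2 => by cases i <;> simp at h2)
    refine ⟨x, (h.memX x).2 ⟨hx, hf⟩, fun i'' k'' => ?_⟩
    by_cases hi2 : i'' = i
    · subst hi2
      rw [h.jump_self, hj _ _ (fun h2 => skip_ne j k'' h2.2)]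
      cases i'' <;> simp
    · have : i'' = !i := by cases i'' <;> cases i <;> simp_all
      rw [this, h.jump_other, hj _ _ (fun h2 => by cases i <;> simp at h2)]

/-- Both systems of equations of a diagram are uniquely solvable. -/
def Good (S : Strips Γ) : Prop := S.Solv ∧ S.swap.Solv

theorem Insertion.good (h : Insertion S S' i j) (hS : S.Good) (h1 : S'.Inj) : S'.Good :=
  ⟨h.solv hS.1 h1, h.swap.solv hS.2
    (h.swap.inj_iff.2 ((injStep_swap hS.1 hS.2).2 (h.inj_iff.1 h1)))⟩

theorem diamond_insertion {S S10 S01 S11 : Strips Γ} {j j' : ℤ} (hS : S.Good)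
    (h10 : Insertion S S10 false j) (h01 : Insertion S S01 true j')
    (h11 : Insertion S10 S11 true j') (hinj : S11.Inj) : S10.Inj ↔ S01.Inj := by
  rw [h10.inj_iff, h01.inj_iff]
  refine diamond hS.1 hS.2 (j := fun b => if b then j' else j) ?_
  intro x hx hj hf
  refine hinj x ((h11.memX x).2 ⟨(h10.memX x).2 ⟨hx, fun τ => by simpa using hf false τ⟩, ?_⟩) ?_
  · intro τ
    have := h10.func_other x j' τ
    simp only [Bool.not_false] at this
    rw [this]
    simpa using hf true τ
  · rw [h11.forall_jump]
    rintro (_ | _) k hk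
    · rw [h10.jump_self]
      exact hj _ _ (by simpa using skip_ne j k)
    · have := h10.jump_other x k
      simp only [Bool.not_false] at this
      rw [this]
      exact hj _ _ (by simpa using hk)

end Strips

/-! ### Stacked diagrams -/

/-- Finitely supported compatible functions. -/
def compatM (c : CupDiagram) : Submodule ℚ (ℤ → ℚ) where
  carrier := {p | (support p).Finite ∧ c.Compat p}
  add_mem' {p q} hp hq := ⟨(hp.1.union hq.1).subset (support_add p q),
    fun x hx => by simp [hp.2 x hx, hq.2 x hx]⟩
  zero_mem' := ⟨by simp, fun x _ => rfl⟩
  smul_mem' a p hp := ⟨hp.1.subset (support_const_smul_subset a p),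
    fun x hx => by simp [hp.2 x hx]⟩

/-- Finitely supported closed functions. -/
def closedM (c : CupDiagram) : Submodule ℚ (ℤ → ℚ) where
  carrier := {p | (support p).Finite ∧ c.Closed p}
  add_mem' {p q} hp hq := ⟨(hp.1.union hq.1).subset (support_add p q),
    fun x => by simp [hp.2 x, hq.2 x]⟩
  zero_mem' := ⟨by simp, fun x => rfl⟩
  smul_mem' a p hp := ⟨hp.1.subset (support_const_smul_subset a p),
    fun x => by simp [hp.2 x]⟩

theorem mem_compatM {c : CupDiagram} {p : ℤ → ℚ} :
    p ∈ compatM c ↔ (support p).Finite ∧ c.Compat p := Iff.rfl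
theorem mem_closedM {c : CupDiagram} {p : ℤ → ℚ} :
    p ∈ closedM c ↔ (support p).Finite ∧ c.Closed p := Iff.rfl

theorem closedM_le (c : CupDiagram) : closedM c ≤ compatM c := fun _ h => ⟨h.1, h.2.compat⟩

theorem support_mul_finite {p q : ℤ → ℚ} (h : (support p).Finite) : (support (p * q)).Finite :=
  h.subset (support_mul_subset_left p q)

theorem support_indicator_finite {p : ℤ → ℚ} (s : Set ℤ) (h : (support p).Finite) :
    (support (s.indicator p)).Finite :=
  h.subset (by rw [Set.support_indicator]; exact Set.inter_subset_right)

/-- The three levels of a stacked diagram. -/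
def lev (i : Fin 3) : (Fin 3 × ℤ → ℚ) →ₗ[ℚ] (ℤ → ℚ) := LinearMap.funLeft ℚ ℚ (fun k => (i, k))

@[simp] theorem lev_apply (i : Fin 3) (x : Fin 3 × ℤ → ℚ) (k : ℤ) : lev i x k = x (i, k) := rfl

/-- Functions on the regions of the diagram which consists of cup and cap diagrams with boundary
conditions `B` and `T`, the cap and cup diagram of `d`, and the cap and cup diagram of `e`, cut along
the two strips between the caps and the cups. -/
def tri (B T : Submodule ℚ (ℤ → ℚ)) (d e : CupDiagram) : Submodule ℚ (Fin 3 × ℤ → ℚ) :=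
  (B ⊓ compatM d.cap).comap (lev 0) ⊓ (compatM d ⊓ compatM e.cap).comap (lev 1) ⊓
    (compatM e ⊓ T).comap (lev 2)

theorem mem_tri {B T : Submodule ℚ (ℤ → ℚ)} {d e : CupDiagram} {x : Fin 3 × ℤ → ℚ} :
    x ∈ tri B T d e ↔ (lev 0 x ∈ B ∧ lev 0 x ∈ compatM d.cap) ∧
      (lev 1 x ∈ compatM d ∧ lev 1 x ∈ compatM e.cap) ∧ lev 2 x ∈ compatM e ∧ lev 2 x ∈ T := by
  simp only [tri, Submodule.mem_inf, Submodule.mem_comap]; tauto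

theorem compatM_mul {c : CupDiagram} {p q : ℤ → ℚ} (hp : p ∈ compatM c) (hq : q ∈ compatM c) :
    p * q ∈ compatM c := ⟨support_mul_finite hp.1, hp.2.mul hq.2⟩
theorem closedM_mul {c : CupDiagram} {p q : ℤ → ℚ} (hp : p ∈ closedM c) (hq : q ∈ closedM c) :
    p * q ∈ closedM c := ⟨support_mul_finite hp.1, hp.2.mul hq.2⟩
theorem compatM_par {c : CupDiagram} {p : ℤ → ℚ} (hp : p ∈ compatM c) :
    {k | ¬ Even k}.indicator p ∈ compatM c := ⟨support_indicator_finite _ hp.1, hp.2.par⟩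
theorem closedM_par {c : CupDiagram} {p : ℤ → ℚ} (hp : p ∈ closedM c) :
    {k | ¬ Even k}.indicator p ∈ closedM c := ⟨support_indicator_finite _ hp.1, hp.2.par hp.1⟩

theorem lev_mul (i : Fin 3) (x y : Fin 3 × ℤ → ℚ) : lev i (x * y) = lev i x * lev i y := rfl
theorem lev_par (i : Fin 3) (x : Fin 3 × ℤ → ℚ) :
    lev i ({γ | ¬ Even γ.2}.indicator x) = {k | ¬ Even k}.indicator (lev i x) := by
  ext k; simp [Set.indicator]

theorem tri_mul {B T : Submodule ℚ (ℤ → ℚ)} {d e : CupDiagram}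
    (hB : ∀ p ∈ B, ∀ q ∈ B, p * q ∈ B) (hT : ∀ p ∈ T, ∀ q ∈ T, p * q ∈ T) :
    ∀ x ∈ tri B T d e, ∀ y ∈ tri B T d e, x * y ∈ tri B T d e := by
  intro x hx y hy
  rw [mem_tri] at *
  simp only [lev_mul]
  exact ⟨⟨hB _ hx.1.1 _ hy.1.1, compatM_mul hx.1.2 hy.1.2⟩,
    ⟨compatM_mul hx.2.1.1 hy.2.1.1, compatM_mul hx.2.1.2 hy.2.1.2⟩,
    compatM_mul hx.2.2.1 hy.2.2.1, hT _ hx.2.2.2 _ hy.2.2.2⟩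

theorem tri_par {B T : Submodule ℚ (ℤ → ℚ)} {d e : CupDiagram}
    (hB : ∀ p ∈ B, {k | ¬ Even k}.indicator p ∈ B) (hT : ∀ p ∈ T, {k | ¬ Even k}.indicator p ∈ T) :
    ∀ x ∈ tri B T d e, {γ | ¬ Even γ.2}.indicator x ∈ tri B T d e := by
  intro x hx
  rw [mem_tri] at *
  simp only [lev_par]
  exact ⟨⟨hB _ hx.1.1, compatM_par hx.1.2⟩, ⟨compatM_par hx.2.1.1, compatM_par hx.2.1.2⟩,
    compatM_par hx.2.2.1, hT _ hx.2.2.2⟩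

theorem even_ray_succ (c : CupDiagram) (k : ℤ) : ¬ Even (c.ray k + 1) ↔ Even k := by
  rw [Int.even_add_one, not_not, CupDiagram.even_ray]

/-- The two spaces of functions on the regions of the diagram stacked from the cup diagram of `l`, the
cap and cup diagrams of `d`, the cap and cup diagrams of `e`, and the cap diagram of `m`. -/
def strips (l d e m : CupDiagram) : Strips (Fin 3 × ℤ) where
  lo i k := if i then (1, e.ray k + 1) else (0, d.ray k + 1)
  up i k := if i then (2, e.ray k + 1) else (1, d.ray k + 1)
  par γ := ¬ Even γ.2
  par_lo i k := by cases i <;> exact even_ray_succ _ k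
  par_up i k := by cases i <;> exact even_ray_succ _ k
  X := tri (compatM l) (closedM m.cap) d e
  Y := tri (closedM l) (compatM m.cap) d e
  mulX := tri_mul (fun _ hp _ hq => compatM_mul hp hq) (fun _ hp _ hq => closedM_mul hp hq)
  mulY := tri_mul (fun _ hp _ hq => closedM_mul hp hq) (fun _ hp _ hq => compatM_mul hp hq)
  parX := tri_par (fun _ hp => compatM_par hp) (fun _ hp => closedM_par hp)
  parY := tri_par (fun _ hp => closedM_par hp) (fun _ hp => compatM_par hp)
  finX_lo x hx i := by
    rw [mem_tri] at hx
    cases i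
    · exact CupDiagram.hat_finite (c := d) hx.1.2.1
    · exact CupDiagram.hat_finite (c := e) hx.2.1.2.1
  finX_up x hx i := by
    rw [mem_tri] at hx
    cases i
    · exact CupDiagram.hat_finite (c := d) hx.2.1.2.1
    · exact CupDiagram.hat_finite (c := e) hx.2.2.1.1
  finY_lo x hx i := by
    rw [mem_tri] at hx
    cases i
    · exact CupDiagram.hat_finite (c := d) hx.1.2.1
    · exact CupDiagram.hat_finite (c := e) hx.2.1.2.1
  finY_up x hx i := by
    rw [mem_tri] at hx
    cases i
    · exact CupDiagram.hat_finite (c := d) hx.2.1.2.1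
    · exact CupDiagram.hat_finite (c := e) hx.2.2.1.1
  dual x hx y hy := by
    rw [mem_tri] at hx hy
    -- At the bottom and at the top one of the two functions is closed, so the form vanishes. On the
    -- middle level it can be computed from the rays of `d` or from those of `e`, and the sum
    -- telescopes.
    have h0 : Om (d.hat (lev 0 x)) (d.hat (lev 0 y)) = 0 := by
      rw [← CupDiagram.om_hat_cap hx.1.2.1 hx.1.2.2 hy.1.2.2]
      exact CupDiagram.om_zero_of_closed hx.1.1.1 hy.1.1.1 hx.1.1.2 hy.1.1.2
    have h1 : Om (d.hat (lev 1 x)) (d.hat (lev 1 y)) = Om (e.hat (lev 1 x)) (e.hat (lev 1 y)) := by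
      rw [← CupDiagram.om_hat_cap hx.2.1.2.1 hx.2.1.2.2 hy.2.1.2.2,
        ← CupDiagram.om_hat hx.2.1.1.1 hx.2.1.1.2 hy.2.1.1.2]
    have h2 : Om (e.hat (lev 2 x)) (e.hat (lev 2 y)) = 0 := by
      rw [← CupDiagram.om_hat hx.2.2.1.1 hx.2.2.1.2 hy.2.2.1.2, om_neg_swap,
        CupDiagram.om_zero_of_closed hy.2.2.2.1 hx.2.2.2.1 hy.2.2.2.2 hx.2.2.2.2, neg_zero]
    change (Om (d.hat (lev 0 x)) (d.hat (lev 0 y)) - Om (d.hat (lev 1 x)) (d.hat (lev 1 y))) +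
      (Om (e.hat (lev 1 x)) (e.hat (lev 1 y)) - Om (e.hat (lev 2 x)) (e.hat (lev 2 y))) = 0
    rw [h0, h1, h2]; ring

/-! ### Adding a cup -/

namespace CupDiagram

/-- `d'` has one more cup than `d`, which joins the rays at positions `j` and `j + 1` of `d`. -/
structure AddCup (d d' : CupDiagram) (j : ℤ) : Prop where
  left : d'.partner (d.ray j) = d.ray (j + 1)
  right : d'.partner (d.ray (j + 1)) = d.ray j
  other : ∀ x, x ≠ d.ray j → x ≠ d.ray (j + 1) → d'.partner x = d.partner x

variable {d d' : CupDiagram} {j : ℤ}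

theorem AddCup.lt (_h : AddCup d d' j) : d.ray j < d.ray (j + 1) := d.ray_strictMono (by omega)

theorem AddCup.endpoints (h : AddCup d d' j) :
    d'.endpoints = insert (d.ray j) (insert (d.ray (j + 1)) d.endpoints) := by
  ext x
  have hlt := h.lt
  simp only [Finset.mem_insert, mem_endpoints]
  by_cases h1 : x = d.ray j
  · subst h1; simp [h.left]; omega
  · by_cases h2 : x = d.ray (j + 1)
    · subst h2; simp [h.right]; omega
    · simp [h1, h2, h.other x h1 h2]

/-- `straight` counts from the right: rays right of the new cup keep their number, and those to its
left move up by two. -/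
theorem AddCup.ray_eq (h : AddCup d d' j) (k : ℤ) : d'.ray k = d.ray (Strips.skip j k) := by
  have hne := Strips.skip_ne j k
  push Not at hne
  have h1 : d.ray (Strips.skip j k) ≠ d.ray j := fun h => hne.1 (d.ray_injective h)
  have h2 : d.ray (Strips.skip j k) ≠ d.ray (j + 1) := fun h => hne.2 (d.ray_injective h)
  have h3 : d'.partner (d.ray (Strips.skip j k)) = d.ray (Strips.skip j k) := by
    rw [h.other _ h1 h2, partner_ray]
  have h4 : d'.straight (d.ray (Strips.skip j k)) = k := by
    have h5 := d.straight_ray (Strips.skip j k)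
    have hlt := h.lt
    have m1 : d.ray j ∉ d.endpoints := by simp [mem_endpoints]
    have m2 : d.ray (j + 1) ∉ d.endpoints := by simp [mem_endpoints]
    unfold straight at h5 ⊢
    rw [h.endpoints, Finset.filter_insert, Finset.filter_insert]
    by_cases hk : j + 2 ≤ k
    · have e : Strips.skip j k = k := by simp [Strips.skip, hk]
      rw [e] at h5 ⊢
      have g1 : d.ray (j + 1) < d.ray k := d.ray_strictMono (by omega)
      rw [if_neg (by omega), if_neg (by omega)]
      exact h5
    · have e : Strips.skip j k = k - 2 := by simp [Strips.skip, hk]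
      rw [e] at h5 ⊢
      have g1 : d.ray (k - 2) < d.ray j := d.ray_strictMono (by omega)
      rw [if_pos (by omega), if_pos (by omega), Finset.card_insert_of_notMem,
        Finset.card_insert_of_notMem]
      · push_cast; omega
      · simp [m2]
      · simp only [Finset.mem_insert, Finset.mem_filter, m1, false_and, or_false]; omega
  rw [← h4, d'.ray_straight h3, h4]

theorem AddCup.compat_iff (h : AddCup d d' j) {q : ℤ → ℚ} :
    d'.Compat q ↔ d.Compat q ∧ d.hat q (j - 1) = d.hat q (j + 1) := by
  have hlt := h.lt
  constructor
  · intro h1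
    have h2 : d.Compat q := by
      intro x hx
      have e1 : x ≠ d.ray j := by rintro rfl; simp at hx
      have e2 : x ≠ d.ray (j + 1) := by rintro rfl; simp at hx
      rw [← h.other x e1 e2]
      exact h1 x (by rwa [h.other x e1 e2])
    refine ⟨h2, ?_⟩
    have h3 := h1 (d.ray j) (by rw [h.left]; omega)
    rw [h.left, h2.ray_left] at h3
    exact h3.symm
  · rintro ⟨h1, h2⟩ x hx
    by_cases e1 : x = d.ray j
    · rw [e1, h.left, h1.ray_left]; exact h2.symm
    · by_cases e2 : x = d.ray (j + 1)
      · rw [e2, h.right, h1.ray_left, add_sub_cancel_right]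
      · rw [h.other x e1 e2] at hx ⊢
        exact h1 x hx

theorem AddCup.compat_cap_iff (h : AddCup d d' j) {p : ℤ → ℚ} :
    d'.cap.Compat p ↔ d.cap.Compat p ∧ d.hat p j = d.hat p (j + 2) := by
  rw [compat_cap, h.compat_iff, ← compat_cap]
  refine and_congr_right fun h1 => ?_
  have e1 := h1.ray_left_cap (j - 1)
  have e2 := h1.ray_left_cap (j + 1)
  simp only [hat, add_assoc] at e1 e2 ⊢
  norm_num at e1 e2 ⊢
  rw [e1, e2]

end CupDiagram

open CupDiagram

theorem mem_compatM_addCup {d d' : CupDiagram} {j : ℤ} (h : AddCup d d' j) {q : ℤ → ℚ} :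
    q ∈ compatM d' ↔ q ∈ compatM d ∧ q (d.ray (j - 1) + 1) - q (d.ray (j + 1) + 1) = 0 := by
  simp only [mem_compatM, h.compat_iff, hat, sub_eq_zero]; tauto

theorem mem_compatM_cap_addCup {d d' : CupDiagram} {j : ℤ} (h : AddCup d d' j) {q : ℤ → ℚ} :
    q ∈ compatM d'.cap ↔
      q ∈ compatM d.cap ∧ q (d.ray j + 1) - q (d.ray (j + 2) + 1) = 0 := by
  simp only [mem_compatM, h.compat_cap_iff, hat, sub_eq_zero]; tauto

theorem insertion_left {d d' : CupDiagram} {j : ℤ} (h : AddCup d d' j) (l e m : CupDiagram) :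
    Strips.Insertion (strips l d e m) (strips l d' e m) false j where
  memX x := by
    simp only [strips, mem_tri, Bool.forall_bool, Strips.func, if_true, Bool.false_eq_true, if_false,
      mem_compatM_addCup h, mem_compatM_cap_addCup h, lev_apply]
    tauto
  memY x := by
    simp only [strips, mem_tri, Bool.forall_bool, Strips.func, if_true, Bool.false_eq_true, if_false,
      mem_compatM_addCup h, mem_compatM_cap_addCup h, lev_apply]
    tauto
  lo_self k := by simp [strips, h.ray_eq]
  up_self k := by simp [strips, h.ray_eq]
  lo_other k := by simp [strips]
  up_other k := by simp [strips]

theorem insertion_right {e e' : CupDiagram} {j : ℤ} (h : AddCup e e' j) (l d m : CupDiagram) :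
    Strips.Insertion (strips l d e m) (strips l d e' m) true j where
  memX x := by
    simp only [strips, mem_tri, Bool.forall_bool, Strips.func, if_true, Bool.false_eq_true, if_false,
      mem_compatM_addCup h, mem_compatM_cap_addCup h, lev_apply]
    tauto
  memY x := by
    simp only [strips, mem_tri, Bool.forall_bool, Strips.func, if_true, Bool.false_eq_true, if_false,
      mem_compatM_addCup h, mem_compatM_cap_addCup h, lev_apply]
    tauto
  lo_self k := by simp [strips, h.ray_eq]
  up_self k := by simp [strips, h.ray_eq]
  lo_other k := by simp [strips]
  up_other k := by simp [strips]

/-! ### Regions below arcs and the dimension count -/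

namespace CupDiagram
variable (c : CupDiagram)

theorem rightEnds_cap : c.cap.rightEnds = c.rightEnds.image (fun b => b + 1) := by
  ext x
  simp only [mem_rightEnds, Finset.mem_image, cap]
  constructor
  · intro h
    exact ⟨x - 1, by omega, by ring⟩
  · rintro ⟨b, hb, rfl⟩
    simpa using hb

theorem numCups_cap : c.cap.numCups = c.numCups := by
  rw [numCups, rightEnds_cap, Finset.card_image_of_injective _ (fun a b h => by simpa using h)]
  rfl

/-- Crossing below an arc `{x, c x}` does not change the arcs above. -/
theorem under_step {b x : ℤ} (hb : b ∈ c.rightEnds) :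
    Under c b (c.partner x + 1) ↔ Under c b x := by
  rw [mem_rightEnds] at hb
  unfold Under
  rcases lt_trichotomy (c.partner x) x with h | h | h
  · rcases lt_trichotomy x b with h1 | h1 | h1
    · by_cases h2 : c.partner b < x
      · have := c.nested' h2 h1; omega
      · by_cases h3 : x = c.partner b
        · have : c.partner x = b := by rw [h3, c.invol]
          omega
        · omega
    · subst h1; omega
    · by_cases h2 : c.partner x < b
      · have := c.nested' h2 h1; omega
      · by_cases h3 : c.partner x = b
        · have : x = c.partner b := by rw [← h3, c.invol]
          omega
        · omega
  · rw [h]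
    constructor
    · rintro ⟨h1, h2⟩
      by_cases h3 : x = c.partner b
      · have : c.partner x = b := by rw [h3, c.invol]
        omega
      · omega
    · rintro ⟨h1, h2⟩
      by_cases h3 : x = b
      · subst h3; omega
      · have := c.nested' h1 (by omega); omega
  · rcases lt_trichotomy x (c.partner b) with h1 | h1 | h1
    · by_cases h2 : c.partner b < c.partner x
      · have := c.nested h1 h2
        simp at this; omega
      · by_cases h3 : c.partner b = c.partner x
        · have := c.partner_injective h3; omega
        · omega
    · rw [h1, c.invol]; omega
    · by_cases h2 : x < b
      · have := c.nested' h1 h2; omega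
      · by_cases h3 : x = b
        · subst h3; omega
        · omega

/-- The gap `x` lies below the arc with right endpoint `b` and below no arc inside that arc. -/
def Inner (b x : ℤ) : Prop := Under c b x ∧ ∀ b' ∈ c.rightEnds, Under c b' x → b ≤ b'

theorem inner_step {b x : ℤ} (hb : b ∈ c.rightEnds) :
    c.Inner b (c.partner x + 1) ↔ c.Inner b x := by
  unfold Inner
  rw [c.under_step hb]
  refine and_congr_right fun _ => forall₂_congr fun b' hb' => ?_
  rw [c.under_step hb']

theorem inner_self {b b' : ℤ} (hb : b ∈ c.rightEnds) :
    c.Inner b' b ↔ b' = b := by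
  rw [mem_rightEnds] at hb
  constructor
  · rintro ⟨h1, h2⟩
    have := h2 b (c.mem_rightEnds.2 hb) ⟨hb, le_rfl⟩
    have := h1.2
    omega
  · rintro rfl
    exact ⟨⟨hb, le_rfl⟩, fun _ _ h => h.2⟩

open Classical in
/-- The indicator function of the region just below the arc with right endpoint `b`. -/
def reg (b : ℤ) : ℤ → ℚ := fun x => if c.Inner b x then 1 else 0

theorem reg_mem {b : ℤ} (hb : b ∈ c.rightEnds) : c.reg b ∈ closedM c := by
  refine ⟨(Set.finite_Icc (c.partner b) b).subset fun x hx => ?_, fun x => ?_⟩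
  · by_contra h
    apply hx
    unfold reg
    rw [if_neg]
    rintro ⟨h1, -⟩
    exact h ⟨h1.1.le, h1.2⟩
  · have h := c.inner_step hb (x := x)
    by_cases hx : c.Inner b x <;> simp [reg, hx, h]

theorem reg_self {b b' : ℤ} (hb : b ∈ c.rightEnds) :
    c.reg b' b = if b' = b then 1 else 0 := by
  have h := c.inner_self hb (b' := b')
  by_cases hx : b' = b
  · rw [if_pos hx, reg, if_pos (h.2 hx)]
  · rw [if_neg hx, reg, if_neg (fun h' => hx (h.1 h'))]

/-- Evaluate at the gap `b`, just inside the right end of the arc: it lies in the region of this arc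
only. -/
theorem reg_independent : LinearIndependent ℚ
    (fun b : c.rightEnds => (⟨c.reg b, c.reg_mem b.2⟩ : closedM c)) := by
  rw [Fintype.linearIndependent_iff]
  intro g hg i
  have h := congrFun (congrArg Subtype.val hg) i.1
  simp only [Submodule.coe_sum, Finset.sum_apply, Submodule.coe_smul, Pi.smul_apply,
    reg_self c i.2, smul_eq_mul, mul_ite, mul_one, mul_zero,
    ← Subtype.ext_iff, Finset.sum_ite_eq', Finset.mem_univ, if_true] at h
  exact h

variable {c}

/-- Equality across the arcs on the outside propagates. -/
theorem eq_of_outside {p : ℤ → ℚ} (h : ∀ b ∈ c.rightEnds, p (b + 1) = p (c.partner b)) {x y : ℤ}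
    (hxy : x ≤ y) (h1 : ∀ z, x ≤ z → z < y → c.partner z ≠ z ∧ x ≤ c.partner z ∧ c.partner z < y) :
    p x = p y := by
  obtain ⟨m, hm⟩ : ∃ m : ℕ, y = x + m := ⟨(y - x).toNat, by omega⟩
  induction m using Nat.strong_induction_on generalizing x with
  | _ m ih =>
    by_cases h0 : x = y
    · rw [h0]
    · have h2 := h1 x le_rfl (by omega)
      have h3 := h (c.partner x) (by rw [mem_rightEnds, c.invol]; omega)
      rw [c.invol] at h3
      rw [← h3]
      refine ih (y - (c.partner x + 1)).toNat (by omega) (by omega) ?_ (by omega)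
      intro z hz1 hz2
      have h4 := h1 z (by omega) hz2
      refine ⟨h4.1, ?_, h4.2.2⟩
      by_contra h5
      by_cases h6 : c.partner z = c.partner x
      · have := c.partner_injective h6; omega
      · by_cases h7 : c.partner z = x
        · rw [← h7, c.invol] at hz1; omega
        · have := c.nested (a := x) (k := c.partner z) (by omega) (by omega)
          rw [c.invol] at this; omega

/-- The two gaps just inside the ends of a cup are connected by passing outside the cups immediately
nested in it, so the inner equations follow from the outer ones. -/
theorem compat_of_outside {p : ℤ → ℚ} (h : ∀ b ∈ c.rightEnds, p (b + 1) = p (c.partner b)) :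
    c.Compat p := by
  intro x hx
  rcases lt_or_gt_of_ne hx with h1 | h1
  · refine eq_of_outside h (by omega) ?_
    intro z hz1 hz2
    have := c.nested' (b := x) (k := z) (by omega) hz2
    omega
  · have := h (c.partner x) (by rw [mem_rightEnds, c.invol]; omega)
    rw [c.invol] at this
    exact this

end CupDiagram

/-- The jumps of a function across the cups of `c`. -/
def across (c : CupDiagram) : (ℤ → ℚ) →ₗ[ℚ] (c.rightEnds → ℚ) where
  toFun p b := p (b.1 + 1) - p (c.partner b.1)
  map_add' p q := by ext b; simp; ring
  map_smul' a p := by ext b; simp; ring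

theorem across_apply (c : CupDiagram) (p : ℤ → ℚ) (b : c.rightEnds) :
    across c p b = p (b.1 + 1) - p (c.partner b) := rfl

theorem across_eq_zero {c : CupDiagram} {p : ℤ → ℚ} : across c p = 0 ↔ c.Compat p := by
  constructor
  · intro h
    refine compat_of_outside fun b hb => ?_
    have := congrFun h ⟨b, hb⟩
    rw [across_apply] at this
    exact sub_eq_zero.1 this
  · intro h
    ext b
    rw [across_apply, Pi.zero_apply, sub_eq_zero]
    have hb := c.mem_rightEnds.1 b.2
    have := h (c.partner b) (by rw [c.invol]; omega)
    rwa [c.invol] at this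

/-- Finitely supported functions. -/
def finM : Submodule ℚ (ℤ → ℚ) where
  carrier := {p | (support p).Finite}
  add_mem' {p q} hp hq := (hp.union hq).subset (support_add p q)
  zero_mem' := by simp
  smul_mem' a p hp := hp.subset (support_const_smul_subset a p)

theorem mem_finM {p : ℤ → ℚ} : p ∈ finM ↔ (support p).Finite := Iff.rfl

/-- The map is injective because its kernel is the intersection. Its source contains the independent
functions `reg`, one for each cup of `m`, so the dimensions agree. -/
theorem across_bijective {l m : CupDiagram} (hn : l.numCups = m.numCups)
    (h : compatM l ⊓ closedM m = ⊥) :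
    Bijective ((across l).comp (closedM m).subtype) := by
  have hinj : Injective ((across l).comp (closedM m).subtype) := by
    rw [← LinearMap.ker_eq_bot, LinearMap.ker_eq_bot']
    intro p hp
    have h1 : p.1 ∈ compatM l ⊓ closedM m := ⟨⟨p.2.1, across_eq_zero.1 hp⟩, p.2⟩
    rw [h] at h1
    exact Subtype.ext h1
  have : FiniteDimensional ℚ (closedM m) := FiniteDimensional.of_injective _ hinj
  have h1 := m.reg_independent.fintype_card_le_finrank
  have h2 := LinearMap.finrank_le_finrank_of_injective hinj
  refine ⟨hinj, (LinearMap.injective_iff_surjective_of_finrank_eq_finrank ?_).1 hinj⟩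
  simp only [Module.finrank_fintype_fun_eq_card, Fintype.card_coe] at h1 h2 ⊢
  simp only [numCups] at hn
  omega

/-- Subtract the closed function with the same jumps across the cups of `l`. -/
theorem sup_eq_finM {l m : CupDiagram} (hn : l.numCups = m.numCups)
    (h : compatM l ⊓ closedM m = ⊥) : compatM l ⊔ closedM m = finM := by
  refine le_antisymm (sup_le (fun _ h => h.1) (fun _ h => h.1)) fun f hf => ?_
  obtain ⟨t, ht⟩ := (across_bijective hn h).2 (across l f)
  refine Submodule.mem_sup.2 ⟨f - t, ⟨finM.sub_mem hf t.2.1, ?_⟩, t, t.2, by simp⟩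
  rw [← across_eq_zero, map_sub, ← ht]
  simp

theorem compatM_empty : compatM empty = finM := by
  ext p
  rw [mem_compatM, mem_finM]
  refine and_iff_left fun x hx => absurd rfl hx

theorem compatM_cap_empty : compatM empty.cap = finM := by
  ext p
  rw [mem_compatM, mem_finM]
  refine and_iff_left fun x hx => absurd ?_ hx
  simp [CupDiagram.cap, CupDiagram.empty]

theorem straight_empty (k : ℤ) : CupDiagram.empty.straight k = k := by
  simp [straight, endpoints, CupDiagram.empty]

theorem ray_empty (k : ℤ) : CupDiagram.empty.ray k = k := by
  have := CupDiagram.empty.straight_ray k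
  rwa [straight_empty] at this

theorem om_eq_zero {f g : ℤ → ℚ} {l : CupDiagram} (hf : f ∈ closedM l) (hg : g ∈ compatM l) :
    Om f g = 0 ∧ Om g f = 0 := by
  have h := om_hat hf.1 hf.2.compat hg.2
  have h0 : Om (l.hat f) (l.hat g) = 0 := by
    have : l.hat f = 0 := funext fun k => hf.2.hat_zero hf.1 k
    rw [this]
    simp [Om]
  rw [h0] at h
  exact ⟨h, by rw [om_neg_swap, h, neg_zero]⟩

/-- Uniqueness passes to the opposite diagram. -/
theorem inf_swap_eq_bot {l m : CupDiagram} (h : compatM l ⊔ closedM m = finM) :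
    closedM l ⊓ compatM m = ⊥ := by
  rw [eq_bot_iff]
  rintro y ⟨hy1, hy2⟩
  -- Here `y` is orthogonal to both summands of `finM`, hence to every unit function; pairing with
  -- the unit function at `k` compares the two neighbours of `k`.
  have key : ∀ k, y (k + 1) = y (k - 1) := by
    intro k
    have h1 : (Pi.single k 1 : ℤ → ℚ) ∈ compatM l ⊔ closedM m := by
      rw [h]; exact support_single_finite k 1
    obtain ⟨p, hp, t, ht, hs⟩ := Submodule.mem_sup.1 h1
    have h2 := om_single_left k y
    rw [← hs, om_add_left hp.1 ht.1, (om_eq_zero hy1 hp).2, (om_eq_zero ht hy2).1] at h2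
    linarith
  have h0 : (fun k => y (2 * k)) = 0 := by
    funext k
    refine eq_zero_of_succ_eq (f := fun k => y (2 * k)) (fun k => ?_) ?_ k
    · have := key (2 * k - 1)
      ring_nf at this ⊢
      rw [this]
    · exact hy1.1.preimage (f := fun k => 2 * k) (fun a _ b _ h => by simpa using h)
  have h1 : (fun k => y (2 * k + 1)) = 0 := by
    funext k
    refine eq_zero_of_succ_eq (f := fun k => y (2 * k + 1)) (fun k => ?_) ?_ k
    · have := key (2 * k)
      ring_nf at this ⊢
      rw [this]
    · exact hy1.1.preimage (f := fun k => 2 * k + 1) (fun a _ b _ h => by simpa using h)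
  rw [Submodule.mem_bot]
  funext k
  rcases Int.even_or_odd' k with ⟨r, rfl | rfl⟩
  · exact congrFun h0 r
  · exact congrFun h1 r

/-! ### Uniqueness for stacked diagrams -/

/-- The function on three levels with given values. -/
def join3 (p q t : ℤ → ℚ) : Fin 3 × ℤ → ℚ := fun γ => ![p, q, t] γ.1 γ.2

@[simp] theorem lev_zero_join3 (p q t : ℤ → ℚ) : lev 0 (join3 p q t) = p := rfl
@[simp] theorem lev_one_join3 (p q t : ℤ → ℚ) : lev 1 (join3 p q t) = q := rfl
@[simp] theorem lev_two_join3 (p q t : ℤ → ℚ) : lev 2 (join3 p q t) = t := rfl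
@[simp] theorem join3_zero (p q t : ℤ → ℚ) (k : ℤ) : join3 p q t (0, k) = p k := rfl
@[simp] theorem join3_one (p q t : ℤ → ℚ) (k : ℤ) : join3 p q t (1, k) = q k := rfl
@[simp] theorem join3_two (p q t : ℤ → ℚ) (k : ℤ) : join3 p q t (2, k) = t k := rfl

theorem eq_zero_of_lev {x : Fin 3 × ℤ → ℚ} (h0 : lev 0 x = 0) (h1 : lev 1 x = 0)
    (h2 : lev 2 x = 0) : x = 0 := by
  funext ⟨i, k⟩
  fin_cases i
  · exact congrFun h0 k
  · exact congrFun h1 k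
  · exact congrFun h2 k

theorem strips_jump_false (l d e m : CupDiagram) (x : Fin 3 × ℤ → ℚ) (k : ℤ) :
    (strips l d e m).jump x false k = d.hat (lev 0 x) k - d.hat (lev 1 x) k := rfl
theorem strips_jump_true (l d e m : CupDiagram) (x : Fin 3 × ℤ → ℚ) (k : ℤ) :
    (strips l d e m).jump x true k = e.hat (lev 1 x) k - e.hat (lev 2 x) k := rfl

theorem strips_inj_iff {l d e m : CupDiagram} : (strips l d e m).Inj ↔
    ∀ p q t, p ∈ compatM l → p ∈ compatM d.cap → q ∈ compatM d → q ∈ compatM e.cap →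
      t ∈ compatM e → t ∈ closedM m.cap → (∀ k, d.hat p k = d.hat q k) →
      (∀ k, e.hat q k = e.hat t k) → p = 0 ∧ q = 0 ∧ t = 0 := by
  constructor
  · intro h p q t h1 h2 h3 h4 h5 h6 h7 h8
    have := h (join3 p q t) (mem_tri.2 ⟨⟨h1, h2⟩, ⟨h3, h4⟩, h5, h6⟩) (by
      rintro (_ | _) k
      · rw [strips_jump_false]; simp [h7]
      · rw [strips_jump_true]; simp [h8])
    exact ⟨congrArg (lev 0) this, congrArg (lev 1) this, congrArg (lev 2) this⟩
  · intro h x hx hj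
    obtain ⟨⟨h1, h2⟩, ⟨h3, h4⟩, h5, h6⟩ := mem_tri.1 hx
    obtain ⟨a, b, c⟩ := h _ _ _ h1 h2 h3 h4 h5 h6 (fun k => sub_eq_zero.1 (hj false k))
      (fun k => sub_eq_zero.1 (hj true k))
    exact eq_zero_of_lev a b c

theorem hat_empty (p : ℤ → ℚ) (k : ℤ) : CupDiagram.empty.hat p k = p (k + 1) := by
  rw [hat, ray_empty]

theorem eq_of_hat_empty {p q : ℤ → ℚ}
    (h : ∀ k, CupDiagram.empty.hat p k = CupDiagram.empty.hat q k) : p = q := by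
  funext k
  have := h (k - 1)
  simpa [hat_empty] using this

/-- Uniqueness for the diagram with one middle section. -/
def StackInj (l d m : CupDiagram) : Prop :=
  ∀ p q, p ∈ compatM l → p ∈ compatM d.cap → q ∈ compatM d → q ∈ closedM m.cap →
    (∀ k, d.hat p k = d.hat q k) → p = 0 ∧ q = 0

/-- Uniqueness for a circle diagram. -/
def PairInj (l m : CupDiagram) : Prop := compatM l ⊓ closedM m.cap = ⊥

theorem PairInj.eq_zero {l m : CupDiagram} (h : PairInj l m) {p : ℤ → ℚ} (h1 : p ∈ compatM l)
    (h2 : p ∈ closedM m.cap) : p = 0 := by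
  have : p ∈ compatM l ⊓ closedM m.cap := ⟨h1, h2⟩
  rw [h] at this
  exact this

theorem pairInj_of {l m : CupDiagram} (h : ∀ p, p ∈ compatM l → p ∈ closedM m.cap → p = 0) :
    PairInj l m := by
  rw [PairInj, eq_bot_iff]
  rintro p ⟨h1, h2⟩
  exact h p h1 h2

theorem stackInj_iff {l d m : CupDiagram} :
    StackInj l d m ↔ (strips l d CupDiagram.empty m).Inj := by
  rw [strips_inj_iff, compatM_cap_empty, compatM_empty]
  constructor
  · intro h p q t h1 h2 h3 h4 h5 h6 h7 h8
    obtain rfl := eq_of_hat_empty h8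
    have := h p q h1 h2 h3 h6 h7
    tauto
  · intro h p q h1 h2 h3 h4 h5
    have := h p q q h1 h2 h3 h3.1 h3.1 h4 h5 (fun _ => rfl)
    tauto

theorem strips_empty_left_inj {l e m : CupDiagram} :
    (strips l CupDiagram.empty e m).Inj ↔ StackInj l e m := by
  rw [strips_inj_iff, compatM_cap_empty, compatM_empty]
  constructor
  · intro h p q h1 h2 h3 h4 h5
    have := h p p q h1 h1.1 h1.1 h2 h3 h4 (fun _ => rfl) h5
    tauto
  · intro h p q t h1 h2 h3 h4 h5 h6 h7 h8
    obtain rfl := eq_of_hat_empty h7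
    have := h p t h1 h4 h5 h6 h8
    tauto

theorem stackInj_empty {l m : CupDiagram} : StackInj l CupDiagram.empty m ↔ PairInj l m := by
  unfold StackInj
  rw [compatM_cap_empty, compatM_empty]
  constructor
  · intro h
    exact pairInj_of fun p h1 h2 => (h p p h1 h1.1 h1.1 h2 (fun _ => rfl)).1
  · intro h p q h1 h2 h3 h4 h5
    obtain rfl := eq_of_hat_empty h5
    have := h.eq_zero h1 h4
    tauto

/-- Split a unit function as `p + t` along the two boundary spaces. The function `p` below the jump
and `-t` above it have exactly the required jump. -/
theorem strips_empty_solv {B T : CupDiagram} {S : Strips (Fin 3 × ℤ)}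
    (hX : S.X = tri (compatM B) (closedM T.cap) CupDiagram.empty CupDiagram.empty)
    (hj0 : ∀ x k, S.jump x false k = lev 0 x (k + 1) - lev 1 x (k + 1))
    (hj1 : ∀ x k, S.jump x true k = lev 1 x (k + 1) - lev 2 x (k + 1))
    (h : compatM B ⊔ closedM T.cap = finM) (h' : PairInj B T) : S.Solv := by
  constructor
  · intro x hx hj
    rw [hX, mem_tri] at hx
    have e0 : lev 0 x = lev 1 x := by
      funext k; have := hj false (k - 1); rw [hj0, sub_add_cancel] at this; linarith
    have e1 : lev 1 x = lev 2 x := by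
      funext k; have := hj true (k - 1); rw [hj1, sub_add_cancel] at this; linarith
    have h0 : lev 0 x = 0 := h'.eq_zero hx.1.1 (by rw [e0, e1]; exact hx.2.2.2)
    exact eq_zero_of_lev h0 (e0 ▸ h0) (e1 ▸ e0 ▸ h0)
  · intro i k
    have h1 : (Pi.single (k + 1) 1 : ℤ → ℚ) ∈ compatM B ⊔ closedM T.cap := by
      rw [h]; exact support_single_finite _ 1
    obtain ⟨p, hp, t, ht, hs⟩ := Submodule.mem_sup.1 h1
    have hs' : ∀ k', p (k' + 1) + t (k' + 1) = if k' = k then 1 else 0 := fun k' => by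
      have := congrFun hs (k' + 1)
      simpa [Pi.single_apply] using this
    have ht' : -t ∈ closedM T.cap := (closedM T.cap).neg_mem ht
    refine ⟨join3 p (if i then p else -t) (-t), ?_, ?_⟩
    · rw [hX, mem_tri, compatM_cap_empty, compatM_empty]
      refine ⟨⟨hp, hp.1⟩, ⟨?_, ?_⟩, ht'.1, ht'⟩ <;>
      · cases i
        · exact ht'.1
        · exact hp.1
    · rintro (_ | _) k'
      · rw [hj0]; cases i <;> simp [hs']
      · rw [hj1]; cases i <;> simp [hs']

/-- The opposite system is unique by `inf_swap_eq_bot`, and then solvable by the same dimension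
count with bottom and top exchanged. -/
theorem strips_empty_good {l m : CupDiagram} (hn : l.numCups = m.numCups) (h : PairInj l m) :
    (strips l CupDiagram.empty CupDiagram.empty m).Good := by
  have hs := sup_eq_finM (by rw [numCups_cap, hn]) h
  have hs2 := inf_swap_eq_bot hs
  have hn' : m.cap.numCups = l.numCups := by rw [numCups_cap, hn]
  have hs3 := sup_eq_finM hn' (by rw [inf_comm]; exact hs2)
  constructor
  · refine strips_empty_solv rfl ?_ ?_ hs h
    · intro x k; rw [strips_jump_false, hat_empty, hat_empty]
    · intro x k; rw [strips_jump_true, hat_empty, hat_empty]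
  · have hinj : ∀ x ∈ (strips l CupDiagram.empty CupDiagram.empty m).Y,
        lev 0 x ∈ closedM l ∧ lev 2 x ∈ compatM m.cap := fun x hx =>
      ⟨(mem_tri.1 hx).1.1, (mem_tri.1 hx).2.2.2⟩
    have hj0 : ∀ x k, (strips l CupDiagram.empty CupDiagram.empty m).swap.jump x false k =
        lev 0 x (k + 1) - lev 1 x (k + 1) := fun x k =>
      (strips_jump_false l CupDiagram.empty CupDiagram.empty m x k).trans (by rw [hat_empty, hat_empty])
    have hj1 : ∀ x k, (strips l CupDiagram.empty CupDiagram.empty m).swap.jump x true k =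
        lev 1 x (k + 1) - lev 2 x (k + 1) := fun x k =>
      (strips_jump_true l CupDiagram.empty CupDiagram.empty m x k).trans (by rw [hat_empty, hat_empty])
    constructor
    · intro x hx hj
      have hx' := hinj x hx
      have e0 : lev 0 x = lev 1 x := by
        funext k; have := hj false (k - 1); rw [hj0, sub_add_cancel] at this; linarith
      have e1 : lev 1 x = lev 2 x := by
        funext k; have := hj true (k - 1); rw [hj1, sub_add_cancel] at this; linarith
      have h0 : lev 0 x ∈ closedM l ⊓ compatM m.cap := ⟨hx'.1, by rw [e0, e1]; exact hx'.2⟩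
      rw [hs2, Submodule.mem_bot] at h0
      exact eq_zero_of_lev h0 (e0 ▸ h0) (e1 ▸ e0 ▸ h0)
    · intro i k
      have h1 : (Pi.single (k + 1) 1 : ℤ → ℚ) ∈ compatM m.cap ⊔ closedM l := by
        rw [hs3]; exact support_single_finite _ 1
      obtain ⟨t, ht, p, hp, hs⟩ := Submodule.mem_sup.1 h1
      have hs' : ∀ k', p (k' + 1) + t (k' + 1) = if k' = k then 1 else 0 := fun k' => by
        have := congrFun hs (k' + 1)
        rw [add_comm]
        simpa [Pi.single_apply] using this
      have ht' : -t ∈ compatM m.cap := (compatM m.cap).neg_mem ht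
      refine ⟨join3 p (if i then p else -t) (-t), ?_, ?_⟩
      · refine mem_tri.2 ?_
        rw [compatM_cap_empty, compatM_empty]
        refine ⟨⟨hp, hp.1⟩, ⟨?_, ?_⟩, ht'.1, ht'⟩ <;>
        · cases i
          · exact ht'.1
          · exact hp.1
      · rintro (_ | _) k'
        · rw [hj0]; cases i <;> simp [hs']
        · rw [hj1]; cases i <;> simp [hs']

/-! ### Subdiagrams -/

namespace CupDiagram

theorem isSub_refl (c : CupDiagram) : c.IsSub c := fun _ => Or.inr rfl
theorem empty_isSub (c : CupDiagram) : CupDiagram.empty.IsSub c := fun _ => Or.inl rfl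

theorem IsSub.trans {c d e : CupDiagram} (h1 : c.IsSub d) (h2 : d.IsSub e) : c.IsSub e := fun x => by
  rcases h1 x with h | h
  · exact Or.inl h
  · rcases h2 x with h' | h'
    · exact Or.inl (h.trans h')
    · exact Or.inr (h.trans h')

theorem addCup_of {d d' : CupDiagram} {a b : ℤ} (hab : a < b) (ha : d.partner a = a)
    (hb : d.partner b = b) (hbet : ∀ x, a < x → x < b → d.partner x ≠ x) (h1 : d'.partner a = b)
    (h2 : ∀ x, x ≠ a → x ≠ b → d'.partner x = d.partner x) : AddCup d d' (d.straight a) := by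
  have e1 : d.ray (d.straight a) = a := d.ray_straight ha
  have e2 : d.ray (d.straight a + 1) = b := d.ray_succ_eq e1 hb hab hbet
  exact ⟨by rw [e1, e2, h1], by rw [e1, e2, ← h1, d'.invol], by rw [e1, e2]; exact h2⟩

theorem AddCup.isSub {d d' : CupDiagram} {j : ℤ} (h : AddCup d d' j) : d.IsSub d' := fun x => by
  by_cases h1 : x = d.ray j
  · left; rw [h1, partner_ray]
  · by_cases h2 : x = d.ray (j + 1)
    · left; rw [h2, partner_ray]
    · right; rw [h.other x h1 h2]

theorem AddCup.card {d d' : CupDiagram} {j : ℤ} (h : AddCup d d' j) :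
    d'.endpoints.card = d.endpoints.card + 2 := by
  have hlt := h.lt
  rw [h.endpoints, Finset.card_insert_of_notMem, Finset.card_insert_of_notMem]
  · simp [mem_endpoints]
  · simp [mem_endpoints]; omega

theorem exists_addCup_of_ne_empty {d' : CupDiagram} (h : d' ≠ CupDiagram.empty) :
    ∃ d j, AddCup d d' j := by
  have hne : d'.rightEnds.Nonempty := by
    by_contra h1
    rw [Finset.not_nonempty_iff_eq_empty] at h1
    apply h
    ext x
    by_contra h2
    change d'.partner x ≠ x at h2
    rcases lt_or_gt_of_ne h2 with h3 | h3
    · have := d'.mem_rightEnds.2 h3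
      simp [h1] at this
    · have : d'.partner x ∈ d'.rightEnds := d'.mem_rightEnds.2 (by rw [d'.invol]; exact h3)
      simp [h1] at this
  -- The cup with the largest right endpoint is outermost, so deleting it leaves a cup diagram.
  obtain ⟨b, hb, hmax⟩ := d'.rightEnds.exists_max_image id hne
  simp only [id] at hmax
  have hab := d'.mem_rightEnds.1 hb
  set a := d'.partner b with ha
  have hpa : d'.partner a = b := by rw [ha, d'.invol]
  have hle : ∀ x, d'.partner x ≠ x → x ≤ b := by
    intro x hx
    rcases lt_or_gt_of_ne hx with h3 | h3
    · exact hmax x (d'.mem_rightEnds.2 h3)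
    · have := hmax (d'.partner x) (d'.mem_rightEnds.2 (by rw [d'.invol]; exact h3))
      omega
  let d : CupDiagram :=
    { partner := fun x => if x = a ∨ x = b then x else d'.partner x
      invol := by
        intro x
        by_cases hx : x = a ∨ x = b
        · simp [hx]
        · have h1 : ¬ (d'.partner x = a ∨ d'.partner x = b) := by
            rintro (h1 | h1)
            · exact hx (Or.inr (d'.partner_injective (h1.trans ha)))
            · exact hx (Or.inl (d'.partner_injective (h1.trans hpa.symm)))
          simp [hx, h1]
      finite_cups := by
        refine d'.finite_cups.subset fun x hx => ?_
        simp only [Set.mem_ofPred_eq] at hx ⊢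
        by_cases h1 : x = a ∨ x = b
        · simp [h1] at hx
        · simpa [h1] using hx
      noncrossing := by
        intro i k h1 h2
        by_cases hi : i = a ∨ i = b
        · simp [hi] at h2; omega
        · simp only [hi, if_false] at h2 ⊢
          have h3 := d'.nested h1 h2
          have hk : ¬ (k = a ∨ k = b) := by
            have h4 := hle (d'.partner i) (d'.partner_ne_partner (by omega))
            rintro (rfl | rfl)
            · rw [hpa] at h3; omega
            · omega
          simp only [hk, if_false]
          exact h3 }
  refine ⟨d, d.straight a, addCup_of (b := b) hab (by simp [d]) (by simp [d]) ?_ hpa ?_⟩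
  · intro x h1 h2
    have : ¬ (x = a ∨ x = b) := by omega
    simp only [d, this, if_false]
    exact (d'.nested h1 (by rw [hpa]; exact h2)).1
  · intro x h1 h2
    simp [d, h1, h2]

theorem exists_addCup_of_ne {e c : CupDiagram} (hs : e.IsSub c) (h : e ≠ c) :
    ∃ e' j, AddCup e e' j ∧ e'.IsSub c := by
  have hne : (c.rightEnds.filter (fun b => e.partner b = b)).Nonempty := by
    by_contra h1
    rw [Finset.not_nonempty_iff_eq_empty, Finset.filter_eq_empty_iff] at h1
    apply h
    ext x
    by_contra h2
    have h3 : e.partner x = x := (hs x).resolve_right h2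
    have h2' : c.partner x ≠ x := fun h4 => h2 (h3.trans h4.symm)
    rcases lt_or_gt_of_ne h2' with h4 | h4
    · exact h1 (c.mem_rightEnds.2 h4) h3
    · have h5 := h1 (x := c.partner x) (c.mem_rightEnds.2 (by rw [c.invol]; exact h4))
      have h6 := (hs (c.partner x)).resolve_left h5
      rw [c.invol] at h6
      have := congrArg e.partner h6
      rw [e.invol, h3] at this
      exact h2' this
  -- Among the missing cups, take the one with the smallest right endpoint: all cups inside it are
  -- already present, so its ends are neighbouring rays of `e`.
  obtain ⟨b, hb, hmin⟩ := Finset.exists_min_image _ id hne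
  simp only [id, Finset.mem_filter, mem_rightEnds] at hb hmin
  obtain ⟨hab, heb⟩ := hb
  set a := c.partner b with ha
  have hpa : c.partner a = b := by rw [ha, c.invol]
  have hea : e.partner a = a := by
    by_contra h1
    have h2 := (hs a).resolve_left h1
    rw [hpa] at h2
    have := congrArg e.partner h2
    rw [e.invol, heb] at this
    omega
  have hbet : ∀ x, a < x → x < b → e.partner x ≠ x := by
    intro x h1 h2 h3
    have h4 := c.nested h1 (by rw [hpa]; exact h2)
    rcases lt_or_gt_of_ne h4.1 with h5 | h5
    · have := hmin x ⟨h5, h3⟩; omega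
    · by_cases h6 : e.partner (c.partner x) = c.partner x
      · have := hmin (c.partner x) ⟨by rw [c.invol]; exact h5, h6⟩; omega
      · have h7 := (hs _).resolve_left h6
        rw [c.invol] at h7
        have := congrArg e.partner h7
        rw [e.invol, h3] at this
        omega
  let e' : CupDiagram :=
    { partner := fun x => if x = a then b else if x = b then a else e.partner x
      invol := by
        intro x
        by_cases hx : x = a
        · simp [hx, hab.ne']
        · by_cases hx2 : x = b
          · simp [hx2, hab.ne']
          · have h1 : e.partner x ≠ a := fun h1 => hx (e.partner_injective (h1.trans hea.symm))
            have h2 : e.partner x ≠ b := fun h1 => hx2 (e.partner_injective (h1.trans heb.symm))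
            simp [hx, hx2, h1, h2]
      finite_cups := by
        refine (e.finite_cups.union (Set.toFinite {a, b})).subset fun x hx => ?_
        simp only [Set.mem_ofPred_eq, Set.mem_union, Set.mem_insert_iff, Set.mem_singleton_iff] at hx ⊢
        by_cases h1 : x = a
        · tauto
        · by_cases h2 : x = b
          · tauto
          · left; simpa [h1, h2] using hx
      noncrossing := by
        intro i k h1 h2
        by_cases hi : i = a
        · simp only [hi, if_true] at h1 h2 ⊢
          have h3 : k ≠ a := by omega
          have h4 : k ≠ b := by omega
          simp only [h3, h4, if_false]
          have h5 := hbet k h1 h2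
          have h6 := c.nested h1 (by rw [hpa]; exact h2)
          rw [hpa, ← (hs k).resolve_left h5] at h6
          exact h6
        · by_cases hi2 : i = b
          · simp [hi2, hab.ne'] at h2; omega
          · simp only [hi, hi2, if_false] at h2 ⊢
            have h3 := e.nested h1 h2
            have h4 : k ≠ a := by rintro rfl; exact h3.1 hea
            have h5 : k ≠ b := by rintro rfl; exact h3.1 heb
            simp only [h4, h5, if_false]
            exact h3 }
  refine ⟨e', e.straight a, addCup_of (b := b) hab hea heb hbet (by simp [e']) ?_, ?_⟩
  · intro x h1 h2; simp [e', h1, h2]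
  · intro x
    by_cases h1 : x = a
    · right; simp [e', h1, hpa]
    · by_cases h2 : x = b
      · right; simp [e', h2, hab.ne', ← ha]
      · simpa [e', h1, h2] using hs x

theorem IsSub.card_le {d c : CupDiagram} (h : d.IsSub c) :
    d.endpoints.card ≤ c.endpoints.card := by
  refine Finset.card_le_card fun x hx => ?_
  rw [mem_endpoints] at hx ⊢
  rwa [← (h x).resolve_left hx]

/-- Induction that builds up a subdiagram. -/
theorem sub_induction {c : CupDiagram} {P : CupDiagram → Prop} (h0 : P CupDiagram.empty)
    (hs : ∀ d d' j, AddCup d d' j → d'.IsSub c → P d → P d') {d : CupDiagram} (hd : d.IsSub c) :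
    P d := by
  obtain ⟨N, hN⟩ : ∃ N, d.endpoints.card = N := ⟨_, rfl⟩
  induction N using Nat.strong_induction_on generalizing d with
  | _ N ih =>
    by_cases h1 : d = CupDiagram.empty
    · rw [h1]; exact h0
    · obtain ⟨d₀, j, hj⟩ := exists_addCup_of_ne_empty h1
      have := hj.card
      exact hs d₀ d j hj hd (ih _ (by omega) (hj.isSub.trans hd) rfl)

/-- Induction that takes away cups. -/
theorem sub_induction_down {c : CupDiagram} {P : CupDiagram → Prop} (h0 : P c)
    (hs : ∀ d d' j, AddCup d d' j → d'.IsSub c → P d' → P d) {d : CupDiagram} (hd : d.IsSub c) :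
    P d := by
  obtain ⟨N, hN⟩ : ∃ N, c.endpoints.card - d.endpoints.card = N := ⟨_, rfl⟩
  induction N using Nat.strong_induction_on generalizing d with
  | _ N ih =>
    by_cases h1 : d = c
    · rw [h1]; exact h0
    · obtain ⟨d₀, j, hj, hj2⟩ := exists_addCup_of_ne hd h1
      have := hj.card
      have := hj2.card_le
      exact hs d d₀ j hj hj2 (ih _ (by omega) hj2 rfl)

end CupDiagram

/-! ### Propagation through the grid of pairs of subdiagrams -/

/-- Propagation of uniqueness through a grid. -/
theorem grid {I G : CupDiagram → CupDiagram → Prop} {c c' : CupDiagram}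
    (hA : ∀ d d' j e, AddCup d d' j → G d e → I d' e → G d' e)
    (hB : ∀ e e' j d, AddCup e e' j → G d e → I d e' → G d e')
    (hd : ∀ d d' j e e' j', AddCup d d' j → AddCup e e' j' → G d e → I d' e' → I d e' → I d' e)
    (hGI : ∀ d e, G d e → I d e)
    (h0 : G CupDiagram.empty CupDiagram.empty) (h1 : ∀ e, e.IsSub c' → I CupDiagram.empty e)
    (h2 : ∀ d, d.IsSub c → I d c') : ∀ d, d.IsSub c → ∀ e, e.IsSub c' → G d e := by
  intro d hd0
  refine sub_induction (P := fun d => ∀ e, e.IsSub c' → G d e) ?_ ?_ hd0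
  · intro e he
    exact sub_induction (P := fun e => G CupDiagram.empty e) h0
      (fun e e' j hj hs hG => hB e e' j _ hj hG (h1 e' hs)) he
  · intro d d' j hj hs hG e he
    refine hA d d' j e hj (hG e he) ?_
    -- In row `d'` one descends from the edge `c'`, where uniqueness is assumed. Each step is a
    -- diamond whose lower corner and whose other side lie in the finished row `d`.
    refine sub_induction_down (P := fun e => I d' e) (h2 d' hs) ?_ he
    intro e e' j' hj' hs' hI
    exact hd d d' j e e' j' hj hj' (hG e (hj'.isSub.trans hs')) hI (hGI _ _ (hG e' hs'))

theorem strips_grid {l m c c' : CupDiagram} (hn : l.numCups = m.numCups)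
    (h1 : ∀ e, e.IsSub c' → StackInj l e m) (h2 : ∀ d, d.IsSub c → (strips l d c' m).Inj) :
    ∀ d, d.IsSub c → ∀ e, e.IsSub c' → (strips l d e m).Good := by
  refine grid (I := fun d e => (strips l d e m).Inj) (G := fun d e => (strips l d e m).Good)
    ?_ ?_ ?_ ?_ ?_ ?_ h2
  · intro d d' j e hj hG hI; exact (insertion_left hj l e m).good hG hI
  · intro e e' j d hj hG hI; exact (insertion_right hj l d m).good hG hI
  · intro d d' j e e' j' hj hj' hG hI hI'
    exact (Strips.diamond_insertion hG (insertion_left hj l e m) (insertion_right hj' l d m)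
      (insertion_right hj' l d' m) hI).2 hI'
  · intro d e h; exact h.1.1
  · exact strips_empty_good hn (stackInj_empty.1 (h1 _ (empty_isSub _)))
  · intro e he; exact strips_empty_left_inj.2 (h1 e he)

theorem strips_grid' {l m c c' : CupDiagram} (hn : l.numCups = m.numCups)
    (h1 : ∀ d, d.IsSub c → StackInj l d m) (h2 : ∀ e, e.IsSub c' → (strips l c e m).Inj) :
    ∀ d, d.IsSub c → ∀ e, e.IsSub c' → (strips l d e m).Good := by
  have := grid (I := fun e d => (strips l d e m).Inj) (G := fun e d => (strips l d e m).Good)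
    (c := c') (c' := c) ?_ ?_ ?_ ?_ ?_ ?_ h2
  · exact fun d hd e he => this e he d hd
  · intro e e' j d hj hG hI; exact (insertion_right hj l d m).good hG hI
  · intro d d' j e hj hG hI; exact (insertion_left hj l e m).good hG hI
  · intro e e' j' d d' j hj' hj hG hI hI'
    exact (Strips.diamond_insertion hG (insertion_left hj l e m) (insertion_right hj' l d m)
      (insertion_right hj' l d' m) hI).1 hI'
  · intro d e h; exact h.1.1
  · exact strips_empty_good hn (stackInj_empty.1 (h1 _ (empty_isSub _)))
  · intro e he; exact stackInj_iff.1 (h1 e he)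

/-! ### Factors of stacked diagrams -/

namespace CupDiagram

/-- Each gap on the ray line lies just to the right of or below a ray. -/
theorem exists_hat_eq {c : CupDiagram} {r : ℤ} (hr : c.partner r = r) (q : ℤ → ℚ) :
    q (r + 1) = c.hat q (c.straight r) := by rw [hat, c.ray_straight hr]

/-- Both neighbours of a ray are outer gaps, so the equation across the ray reads `0 = 0`. -/
theorem closed_of_hat_zero {c : CupDiagram} {p : ℤ → ℚ} (hp : p ∈ compatM c)
    (h : ∀ k, c.hat p k = 0) : p ∈ closedM c := by
  refine ⟨hp.1, fun x => ?_⟩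
  by_cases hx : c.partner x = x
  · rw [hx, exists_hat_eq hx p, h]
    have := hp.2.ray_left (c.straight x)
    rw [c.ray_straight hx] at this
    rw [this]; exact (h _).symm
  · exact hp.2 x hx

theorem hat_cap {c : CupDiagram} (p : ℤ → ℚ) (k : ℤ) :
    c.hat (fun x => p (x + 1)) k = p (c.ray k + 2) := by
  rw [hat]; congr 1; ring

theorem mem_compatM_cap {c : CupDiagram} {p : ℤ → ℚ} :
    p ∈ compatM c.cap ↔ (fun x => p (x + 1)) ∈ compatM c := by
  rw [mem_compatM, mem_compatM, compat_cap]
  refine and_congr_left fun _ => ⟨fun h => support_shift_finite h 1, fun h => ?_⟩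
  have := support_shift_finite h (-1)
  simpa using this

theorem mem_closedM_cap {c : CupDiagram} {p : ℤ → ℚ} :
    p ∈ closedM c.cap ↔ (fun x => p (x + 1)) ∈ closedM c := by
  rw [mem_closedM, mem_closedM, closed_cap]
  refine and_congr_left fun _ => ⟨fun h => support_shift_finite h 1, fun h => ?_⟩
  have := support_shift_finite h (-1)
  simpa using this

theorem closed_cap_of_hat_zero {c : CupDiagram} {p : ℤ → ℚ} (hp : p ∈ compatM c.cap)
    (h : ∀ k, c.hat p k = 0) : p ∈ closedM c.cap := by
  rw [mem_closedM_cap]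
  refine closed_of_hat_zero (mem_compatM_cap.1 hp) fun k => ?_
  rw [hat_cap, hp.2.ray_left_cap]
  exact h (k + 1)

theorem hat_zero_of_closed_cap {c : CupDiagram} {p : ℤ → ℚ} (hp : p ∈ closedM c.cap) (k : ℤ) :
    c.hat p k = 0 := by
  have h := mem_closedM_cap.1 hp
  have h1 := h.2.hat_zero h.1 (k - 1)
  rw [hat_cap, hp.2.compat.ray_left_cap, sub_add_cancel] at h1
  exact h1

theorem outer_iff (c : CupDiagram) (y : ℤ) :
    c.Outer y ↔ ∀ b ∈ c.rightEnds, ¬ Under c b y := by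
  constructor
  · intro h b hb h1
    have := h (c.partner b) h1.1
    rw [c.invol] at this
    have := h1.2
    omega
  · intro h z hz
    by_contra h1
    refine h (c.partner z) (by rw [mem_rightEnds, c.invol]; omega) ?_
    unfold Under
    rw [c.invol]; omega

theorem outer_step_iff (c : CupDiagram) (x : ℤ) :
    c.Outer (c.partner x + 1) ↔ c.Outer x := by
  rw [outer_iff, outer_iff]
  exact forall₂_congr fun b hb => by rw [c.under_step hb]

theorem between_step {c : CupDiagram} {x k : ℤ} (hx : c.partner x ≠ x)
    (h : c.ray k < x ∧ x ≤ c.ray (k + 1)) :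
    c.ray k < c.partner x + 1 ∧ c.partner x + 1 ≤ c.ray (k + 1) := by
  have h1 : c.ray (k + 1) ≠ x := by rintro rfl; simp at hx
  have h2 : c.ray (k + 1) ≠ c.partner x := fun h => by
    have := congrArg c.partner h
    rw [partner_ray, c.invol] at this; exact h1 this
  have h3 : c.ray k ≠ c.partner x := fun h => by
    have := congrArg c.partner h
    rw [partner_ray, c.invol] at this; omega
  have h4 : ¬ (c.partner x < c.ray k ∧ c.ray k < x) := fun h => by
    have := c.nested' h.1 h.2; simp at this
  have h5 : ¬ (x < c.ray (k + 1) ∧ c.ray (k + 1) < c.partner x) := fun h => by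
    have := c.nested h.1 h.2; simp at this
  omega

/-- Compatible functions with given values on the outer gaps. -/
theorem exists_compat_hat (c : CupDiagram) {g : ℤ → ℚ} (hg : (support g).Finite) :
    ∃ p ∈ compatM c, ∀ k, c.hat p k = g k := by
  classical
  choose κ hκ using c.exists_ray_lt
  have huniq : ∀ x k, c.ray k < x ∧ x ≤ c.ray (k + 1) → κ x = k := by
    intro x k h
    have h1 := hκ x
    have h2 : κ x < k + 1 := c.ray_strictMono.lt_iff_lt.1 (h1.1.trans_le h.2)
    have h3 : k < κ x + 1 := c.ray_strictMono.lt_iff_lt.1 (h.1.trans_le h1.2)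
    omega
  refine ⟨fun x => if c.Outer x then g (κ x) else 0, ⟨?_, ?_⟩, ?_⟩
  · refine (hg.biUnion (t := fun k => Set.Icc (c.ray k) (c.ray (k + 1)))
      (fun k _ => Set.finite_Icc _ _)).subset fun x hx => ?_
    rw [Set.mem_iUnion₂]
    refine ⟨κ x, ?_, (hκ x).1.le, (hκ x).2⟩
    rw [mem_support] at hx ⊢
    exact fun h => hx (by simp [h])
  · intro x hx
    simp only [outer_step_iff]
    rw [huniq _ _ (between_step hx (hκ x))]
  · intro k
    have h1 : κ (c.ray k + 1) = k := huniq _ _ ⟨by omega, by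
      have := c.ray_strictMono (show k < k + 1 by omega); omega⟩
    rw [hat, if_pos (c.outer_ray_succ (c.partner_ray k)), h1]

theorem exists_compat_cap_hat (c : CupDiagram) {g : ℤ → ℚ} (hg : (support g).Finite) :
    ∃ p ∈ compatM c.cap, ∀ k, c.hat p k = g k := by
  obtain ⟨p, hp, h⟩ := c.exists_compat_hat (support_shift_finite hg 1)
  refine ⟨fun x => p (x - 1), ?_, fun k => ?_⟩
  · rw [mem_compatM_cap]; simpa using hp
  · have := hp.2.ray_left k
    have h2 := h (k - 1)
    rw [hat] at h2 ⊢
    rw [add_sub_cancel_right, this, h2, sub_add_cancel]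

end CupDiagram

/-- The topmost function solves the system of `c` and `m`, so it vanishes. The function on the
middle level then has zero outer values, which makes it closed for `c.cap`. -/
theorem strips_inj_of_left {l d c m : CupDiagram} (h1 : StackInj l d c) (h2 : PairInj c m) :
    (strips l d c m).Inj := by
  rw [strips_inj_iff]
  intro p q t hp1 hp2 hq1 hq2 ht1 ht2 h3 h4
  obtain rfl := h2.eq_zero ht1 ht2
  have hq : q ∈ closedM c.cap := closed_cap_of_hat_zero hq2 fun k => by rw [h4]; rfl
  have := h1 p q hp1 hp2 hq1 hq h3
  tauto

theorem strips_inj_of_right {l c e m : CupDiagram} (h1 : PairInj l c) (h2 : StackInj c e m) :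
    (strips l c e m).Inj := by
  rw [strips_inj_iff]
  intro p q t hp1 hp2 hq1 hq2 ht1 ht2 h3 h4
  obtain ⟨rfl, rfl⟩ := h2 q t hq1 hq2 ht1 ht2 h4
  have hp : p ∈ closedM c.cap := closed_cap_of_hat_zero hp2 fun k => by rw [h3]; rfl
  have := h1.eq_zero hp1 hp
  tauto

/-- A solution for the lower factor extends by zero to the top level. -/
theorem stackInj_left {l d c m : CupDiagram} (h : (strips l d c m).Inj) : StackInj l d c := by
  rw [strips_inj_iff] at h
  intro p q h1 h2 h3 h4 h5
  have := h p q 0 h1 h2 h3 (closedM_le _ h4) (Submodule.zero_mem _) (Submodule.zero_mem _) h5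
    (fun k => hat_zero_of_closed_cap h4 k)
  tauto

/-- A solution for the upper factor must be extended downwards. Prescribe its outer values on
`c.cap` and split off a closed part, which does not change them; solvability for `l` and `c` makes
this possible. -/
theorem stackInj_right {l c e m : CupDiagram} (hn : l.numCups = c.numCups) (h0 : PairInj l c)
    (h : (strips l c e m).Inj) : StackInj c e m := by
  rw [strips_inj_iff] at h
  intro q t h1 h2 h3 h4 h5
  obtain ⟨f, hf, hfq⟩ := exists_compat_cap_hat c (hat_finite (c := c) h1.1)
  have hf1 : f ∈ compatM l ⊔ closedM c.cap := by
    rw [sup_eq_finM (by rw [numCups_cap, hn]) h0]; exact hf.1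
  obtain ⟨p, hp, s, hs, rfl⟩ := Submodule.mem_sup.1 hf1
  have hp2 : p ∈ compatM c.cap := by
    have := (compatM c.cap).sub_mem hf (closedM_le _ hs)
    simpa using this
  have := h p q t hp hp2 h1 h2 h3 h4 (fun k => by
    have e1 := hfq k
    have e2 := hat_zero_of_closed_cap hs k
    simp only [hat, Pi.add_apply] at e1 e2 ⊢
    linarith) h5
  tauto

theorem pairInj_left {l c m : CupDiagram} (h : StackInj l c m) : PairInj l c :=
  stackInj_empty.1 (stackInj_left (strips_empty_left_inj.2 h))

theorem pairInj_right {l c m : CupDiagram} (hn : l.numCups = c.numCups) (h : StackInj l c m) :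
    PairInj c m :=
  stackInj_empty.1 (stackInj_right hn (pairInj_left h) (stackInj_iff.1 h))

/-! ### Associativity as a statement on uniqueness -/

/-- All diagrams in the computation of the product are good. -/
def ProdInj (l c m : CupDiagram) : Prop := ∀ d, d.IsSub c → StackInj l d m

theorem ProdInj.pair {l c m : CupDiagram} (h : ProdInj l c m) : PairInj l m :=
  stackInj_empty.1 (h _ (empty_isSub _))

theorem ProdInj.pair_left {l c m : CupDiagram} (h : ProdInj l c m) : PairInj l c :=
  pairInj_left (h _ (isSub_refl _))

theorem ProdInj.pair_right {l c m : CupDiagram} (hn : l.numCups = c.numCups)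
    (h : ProdInj l c m) : PairInj c m := pairInj_right hn (h _ (isSub_refl _))

/-- Associativity. -/
theorem prodInj_assoc {l c c' m : CupDiagram} (hlc : l.numCups = c.numCups)
    (hcc : c.numCups = c'.numCups) (hcm : c'.numCups = m.numCups) :
    (ProdInj l c c' ∧ ProdInj l c' m) ↔ (ProdInj c c' m ∧ ProdInj l c m) := by
  constructor
  · rintro ⟨h1, h2⟩
    -- One edge of the grid, with `d` empty, is the product of the result with the third factor; the
    -- edge with all of `c'` present is the first product stacked below the third factor.
    have hG := strips_grid (c := c) (c' := c') (hlc.trans (hcc.trans hcm)) h2 (fun d hd =>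
      strips_inj_of_left (h1 d hd) (h2.pair_right (hlc.trans hcc)))
    exact ⟨fun e he => stackInj_right hlc h1.pair_left (hG c (isSub_refl _) e he).1.1,
      fun d hd => stackInj_iff.2 (hG d hd _ (empty_isSub _)).1.1⟩
  · rintro ⟨h1, h2⟩
    -- Now the edges are those with `e` empty and with all of `c` present.
    have hG := strips_grid' (c := c) (c' := c') (hlc.trans (hcc.trans hcm)) h2 (fun e he =>
      strips_inj_of_right h2.pair_left (h1 e he))
    exact ⟨fun d hd => stackInj_left (hG d hd _ (isSub_refl _)).1.1,
      fun e he => strips_empty_left_inj.1 (hG _ (empty_isSub _) e he).1.1⟩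

/-! ### Components -/

/-- Under the group generated by two involutions, the second of which has no fixed points, an orbit
contains at most two fixed points of the first. -/
theorem two_ends {V : Type*} (S M : Equiv.Perm V) (hS : S * S = 1) (hM : M * M = 1)
    (hne : ∀ v, M v ≠ v) {u : V} (hu : S u = u) :
    ∃ O : V → Prop, O u ∧ (∀ v, O (S v) ↔ O v) ∧ (∀ v, O (M v) ↔ O v) ∧
      ∀ v w, O v → O w → S v = v → S w = w → v ≠ u → w ≠ u → v = w := by
  -- On the points `T ^ k u` the involutions act as the reflections `k ↦ -k` and `k ↦ -(k + 1)`, so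
  -- they make up the orbit of `u`.
  set T := S * M with hT
  have hSi : S⁻¹ = S := inv_eq_of_mul_eq_one_left hS
  have hMi : M⁻¹ = M := inv_eq_of_mul_eq_one_left hM
  have hST : ∀ k : ℤ, S ((T ^ k) u) = (T ^ (-k)) u := by
    intro k
    have h1 : S * T * S⁻¹ = T⁻¹ := by rw [hT, ← mul_assoc, hS, one_mul, mul_inv_rev, hMi]
    have h2 : S * T ^ k * S⁻¹ = T ^ (-k) := by rw [← conj_zpow, h1, inv_zpow, zpow_neg]
    have h3 := congrArg (fun e : Equiv.Perm V => e u) h2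
    simp only [Equiv.Perm.mul_apply] at h3
    rw [hSi, hu] at h3
    exact h3
  have hMT : ∀ k : ℤ, M ((T ^ k) u) = (T ^ (-(k + 1))) u := by
    intro k
    rw [← hST, zpow_add, zpow_one, (Commute.zpow_self T k).eq, hT, mul_assoc, Equiv.Perm.mul_apply,
      ← Equiv.Perm.mul_apply, ← Equiv.Perm.mul_apply, hS]
    rfl
  have hcomp : ∀ a b : ℤ, (T ^ a) u = (T ^ b) u ↔ (T ^ (a - b)) u = u := by
    intro a b
    rw [show a - b = -b + a by ring, zpow_add, Equiv.Perm.mul_apply, zpow_neg,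
      Equiv.Perm.inv_eq_iff_eq]
  let P : AddSubgroup ℤ :=
    { carrier := {k | (T ^ k) u = u}
      add_mem' := by
        intro a b ha hb
        simp only [Set.mem_ofPred_eq] at ha hb ⊢
        rw [zpow_add, Equiv.Perm.mul_apply, hb, ha]
      zero_mem' := by simp
      neg_mem' := by
        intro a ha
        simp only [Set.mem_ofPred_eq] at ha ⊢
        rw [zpow_neg, Equiv.Perm.inv_eq_iff_eq, ha] }
  have hP : ∀ k, k ∈ P ↔ (T ^ k) u = u := fun k => Iff.rfl
  -- An odd period `2k + 1` would make `T ^ k u` a fixed point of `M`.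
  have hodd : ∀ k : ℤ, 2 * k + 1 ∉ P := by
    intro k hk
    rw [hP] at hk
    apply hne ((T ^ k) u)
    rw [hMT, eq_comm, hcomp]
    convert hk using 3
    ring
  obtain ⟨g, hg⟩ := Int.subgroup_cyclic P
  have hg' : ∀ k, k ∈ P ↔ g ∣ k := fun k => by
    rw [hg, AddSubgroup.mem_closure_singleton]
    simp only [smul_eq_mul, dvd_def]
    constructor
    · rintro ⟨a, rfl⟩; exact ⟨a, mul_comm _ _⟩
    · rintro ⟨a, rfl⟩; exact ⟨a, mul_comm _ _⟩
  refine ⟨fun v => ∃ k : ℤ, v = (T ^ k) u, ⟨0, by simp⟩, ?_, ?_, ?_⟩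
  · have : ∀ v, (∃ k : ℤ, v = (T ^ k) u) → ∃ k : ℤ, S v = (T ^ k) u := by
      rintro v ⟨k, rfl⟩; exact ⟨-k, hST k⟩
    refine fun v => ⟨fun h => ?_, this v⟩
    have := this _ h
    rwa [← Equiv.Perm.mul_apply, hS] at this
  · have : ∀ v, (∃ k : ℤ, v = (T ^ k) u) → ∃ k : ℤ, M v = (T ^ k) u := by
      rintro v ⟨k, rfl⟩; exact ⟨_, hMT k⟩
    refine fun v => ⟨fun h => ?_, this v⟩
    have := this _ h
    rwa [← Equiv.Perm.mul_apply, hM] at this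
  · rintro v w ⟨a, rfl⟩ ⟨b, rfl⟩ hv hw hvu hwu
    rw [hST, eq_comm, hcomp] at hv hw
    rw [hcomp, ← hP, hg']
    have ha : g ∣ 2 * a := by rw [← hg', hP]; convert hv using 3; ring
    have hb : g ∣ 2 * b := by rw [← hg', hP]; convert hw using 3; ring
    have ha' : ¬ g ∣ a := by rw [← hg', hP]; exact hvu
    have hb' : ¬ g ∣ b := by rw [← hg', hP]; exact hwu
    obtain ⟨x, hx⟩ := ha
    obtain ⟨y, hy⟩ := hb
    -- A further fixed point of `S` sits at half of an odd multiple of the period `g`; two such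
    -- positions differ by a multiple of `g`.
    have hodd' : ∀ a x, 2 * a = g * x → ¬ g ∣ a → ¬ Even x := by
      rintro a x h h1 ⟨z, rfl⟩
      exact h1 ⟨z, by linarith⟩
    have hx2 := hodd' a x hx ha'
    have hy2 := hodd' b y hy hb'
    rw [Int.not_even_iff_odd] at hx2 hy2
    obtain ⟨z, hz⟩ := hx2.sub_odd hy2
    refine ⟨z, ?_⟩
    have : 2 * (a - b) = g * (z + z) := by rw [← hz]; linarith
    linarith

namespace CupDiagram

theorem endpoints_cap (c : CupDiagram) : c.cap.endpoints = c.endpoints.image (fun x => x + 1) := by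
  ext x
  simp only [mem_endpoints, Finset.mem_image, cap]
  constructor
  · intro h; exact ⟨x - 1, by omega, by ring⟩
  · rintro ⟨b, hb, rfl⟩; simpa using hb

theorem straight_cap (c : CupDiagram) (x : ℤ) : c.cap.straight x = c.straight (x - 1) + 1 := by
  unfold straight
  rw [endpoints_cap, Finset.filter_image, Finset.card_image_of_injective _
    (fun a b h => by simpa using h)]
  simp only [sub_lt_iff_lt_add]
  ring

theorem partner_cap_eq (c : CupDiagram) {x : ℤ} :
    c.cap.partner x = x ↔ c.partner (x - 1) = x - 1 := by
  change c.partner (x - 1) + 1 = x ↔ _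
  omega

theorem cap_ray_succ (c : CupDiagram) (k : ℤ) : c.cap.partner (c.ray k + 1) = c.ray k + 1 := by
  rw [partner_cap_eq, add_sub_cancel_right, partner_ray]

end CupDiagram

/-- The function `G` on the vertices of a stacked diagram is invariant under arcs and lines. -/
structure Respects {α : Type*} (l d m : CupDiagram) (G : ℤ ⊕ ℤ → α) : Prop where
  bot : ∀ x, l.partner x ≠ x → G (Sum.inl (l.partner x)) = G (Sum.inl x)
  lower : ∀ x, d.cap.partner x ≠ x → G (Sum.inl (d.cap.partner x)) = G (Sum.inl x)
  upper : ∀ x, d.partner x ≠ x → G (Sum.inr (d.partner x)) = G (Sum.inr x)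
  top : ∀ x, m.cap.partner x ≠ x → G (Sum.inr (m.cap.partner x)) = G (Sum.inr x)
  line : ∀ k, G (Sum.inl (d.ray k + 1)) = G (Sum.inr (d.ray (k + 1)))

theorem Respects.eq {α : Type*} {l d m : CupDiagram} {G : ℤ ⊕ ℤ → α} (h : Respects l d m G)
    {v w : ℤ ⊕ ℤ} (hvw : Joined l d m v w) : G v = G w := by
  induction hvw with
  | rel v w hr =>
    rcases v with x | x <;> rcases w with y | y
    · rcases hr with rfl | rfl
      · by_cases hx : l.partner x = x
        · rw [hx]
        · exact (h.bot x hx).symm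
      · by_cases hx : d.cap.partner x = x
        · rw [hx]
        · exact (h.lower x hx).symm
    · obtain ⟨h1, h2, h3⟩ := hr
      rw [mem_endpoints, not_not] at h1 h2
      rw [partner_cap_eq] at h1
      rw [straight_cap] at h3
      have e1 := d.ray_straight h1
      have e2 := d.ray_straight h2
      have := h.line (d.straight (x - 1))
      rwa [h3, e1, e2, sub_add_cancel] at this
    · exact hr.elim
    · rcases hr with rfl | rfl
      · by_cases hx : d.partner x = x
        · rw [hx]
        · exact (h.upper x hx).symm
      · by_cases hx : m.cap.partner x = x
        · rw [hx]
        · exact (h.top x hx).symm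
  | refl => rfl
  | symm _ _ _ ih => exact ih.symm
  | trans _ _ _ _ _ ih1 ih2 => exact ih1.trans ih2

section
variable {l d m : CupDiagram}

theorem Joined.refl (v : ℤ ⊕ ℤ) : Joined l d m v v := Relation.EqvGen.refl v
theorem Joined.symm {v w : ℤ ⊕ ℤ} (h : Joined l d m v w) : Joined l d m w v :=
  Relation.EqvGen.symm _ _ h
theorem Joined.trans {u v w : ℤ ⊕ ℤ} (h : Joined l d m u v) (h' : Joined l d m v w) :
    Joined l d m u w := Relation.EqvGen.trans _ _ _ h h'

theorem joined_line (k : ℤ) : Joined l d m (Sum.inl (d.ray k + 1)) (Sum.inr (d.ray (k + 1))) := by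
  refine Relation.EqvGen.rel _ _ ⟨?_, ?_, ?_⟩
  · rw [mem_endpoints, not_not, cap_ray_succ]
  · rw [mem_endpoints, not_not, partner_ray]
  · rw [straight_cap, add_sub_cancel_right, straight_ray, straight_ray]

theorem joined_respects (v : ℤ ⊕ ℤ) : Respects l d m (fun w => Joined l d m v w) := by
  have key : ∀ w w', Joined l d m w w' → (Joined l d m v w = Joined l d m v w') :=
    fun w w' h => propext ⟨fun h' => h'.trans h, fun h' => h'.trans h.symm⟩
  refine ⟨fun x _ => ?_, fun x _ => ?_, fun x _ => ?_, fun x _ => ?_, fun k => ?_⟩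
  · exact (key (Sum.inl x) (Sum.inl (l.partner x)) (Relation.EqvGen.rel _ _ (Or.inl rfl))).symm
  · exact (key (Sum.inl x) (Sum.inl (d.cap.partner x))
      (Relation.EqvGen.rel _ _ (Or.inr rfl))).symm
  · exact (key (Sum.inr x) (Sum.inr (d.partner x)) (Relation.EqvGen.rel _ _ (Or.inl rfl))).symm
  · exact (key (Sum.inr x) (Sum.inr (m.cap.partner x))
      (Relation.EqvGen.rel _ _ (Or.inr rfl))).symm
  · exact key _ _ (joined_line k)

end

theorem outer_involutive (l m : CupDiagram) : Involutive (Sum.map l.partner m.cap.partner) := by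
  rintro (x | x) <;> simp [Sum.map]

/-- The arcs of `l` and of the cap diagram of `m`. -/
def outerPerm (l m : CupDiagram) : Equiv.Perm (ℤ ⊕ ℤ) := (outer_involutive l m).toPerm

/-- The arcs and lines of the middle section. -/
def midFun (d : CupDiagram) : ℤ ⊕ ℤ → ℤ ⊕ ℤ
  | Sum.inl x => if d.cap.partner x = x then Sum.inr (d.ray (d.straight (x - 1) + 1))
      else Sum.inl (d.cap.partner x)
  | Sum.inr x => if d.partner x = x then Sum.inl (d.ray (d.straight x - 1) + 1)
      else Sum.inr (d.partner x)

theorem midFun_involutive (d : CupDiagram) : Involutive (midFun d) := by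
  rintro (x | x)
  · by_cases h : d.cap.partner x = x
    · have h1 := d.partner_cap_eq.1 h
      simp [midFun, h, d.ray_straight h1]
    · have h1 := d.cap.partner_ne_partner h
      simp only [partner_partner] at h1
      simp [midFun, h, h1]
  · by_cases h : d.partner x = x
    · simp [midFun, h, d.ray_straight h, cap_ray_succ]
    · have h1 := d.partner_ne_partner h
      simp only [partner_partner] at h1
      simp [midFun, h, h1]

theorem midFun_ne (d : CupDiagram) (v : ℤ ⊕ ℤ) : midFun d v ≠ v := by
  rcases v with x | x
  · by_cases h : d.cap.partner x = x <;> simp [midFun, h]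
  · by_cases h : d.partner x = x <;> simp [midFun, h]

/-- A component has at most two ends. -/
theorem joined_two_ends {l d m : CupDiagram} {u v w : ℤ ⊕ ℤ} (hu : outerPerm l m u = u)
    (hv : outerPerm l m v = v) (hw : outerPerm l m w = w) (huv : Joined l d m u v)
    (huw : Joined l d m u w) (h1 : v ≠ u) (h2 : w ≠ u) : v = w := by
  obtain ⟨O, h0, hS, hM, h⟩ := two_ends (outerPerm l m) (midFun_involutive d).toPerm
    (by ext1 v; exact outer_involutive l m v)
    (by ext1 v; exact midFun_involutive d v) (midFun_ne d) hu
  have hr : Respects l d m O := by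
    refine ⟨fun x hx => propext (hS (Sum.inl x)), fun x hx => ?_, fun x hx => ?_,
      fun x hx => propext (hS (Sum.inr x)), fun k => ?_⟩
    · have := hM (Sum.inl x)
      simp only [Involutive.coe_toPerm, midFun, if_neg hx] at this
      exact propext this
    · have := hM (Sum.inr x)
      simp only [Involutive.coe_toPerm, midFun, if_neg hx] at this
      exact propext this
    · have := hM (Sum.inl (d.ray k + 1))
      simp only [Involutive.coe_toPerm, midFun, cap_ray_succ, add_sub_cancel_right, straight_ray,
        if_true] at this
      exact (propext this).symm
  exact h v w (hr.eq huv ▸ h0) (hr.eq huw ▸ h0) hv hw h1 h2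

variable {l d m : CupDiagram}

/-- Outside the finite strip the component is a vertical line, meeting each of the two levels once.
-/
theorem far_component {x : ℤ} (h1 : l.partner x = x) (h2 : d.partner x = x)
    (h3 : d.partner (x - 1) = x - 1) (h4 : m.cap.partner x = x) {w : ℤ ⊕ ℤ}
    (hw : Joined l d m (Sum.inl x) w) : w = Sum.inl x ∨ w = Sum.inr x := by
  have key : ∀ (c : CupDiagram) y, c.partner x = x → c.partner y ≠ y →
      (c.partner y = x) = (y = x) := by
    intro c y hc hy
    have e1 : y ≠ x := by rintro rfl; exact hy hc
    have e2 : c.partner y ≠ x := fun h => hy ((c.partner_injective (h.trans hc.symm)) ▸ hc)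
    simp [e1, e2]
  have hr : Respects l d m (fun w => w = Sum.inl x ∨ w = Sum.inr x) := by
    refine ⟨fun y hy => ?_, fun y hy => ?_, fun y hy => ?_, fun y hy => ?_, fun k => ?_⟩
    · simpa using key l y h1 hy
    · simpa using key d.cap y (d.partner_cap_eq.2 h3) hy
    · simpa using key d y h2 hy
    · simpa using key m.cap y h4 hy
    · simp only [Sum.inl.injEq, reduceCtorEq, or_false, Sum.inr.injEq, false_or, eq_iff_iff]
      have e1 : d.ray (d.straight (x - 1)) = x - 1 := d.ray_straight h3
      have e2 := d.ray_succ_eq e1 h2 (by omega) (fun y a b => by omega)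
      constructor
      · intro h
        have : k = d.straight (x - 1) := d.ray_injective (by rw [e1]; omega)
        rw [this, e2]
      · intro h
        have : k + 1 = d.straight (x - 1) + 1 := d.ray_injective (by rw [e2, h])
        rw [show k = d.straight (x - 1) by omega, e1]
        omega
  have := hr.eq hw
  simpa using this.symm

/-- A component that reaches the far region is a single vertical line; any other one stays in the
finite strip. Finiteness is what permits summation over components. -/
theorem finite_component (v : ℤ ⊕ ℤ) : {w | Joined l d m v w}.Finite := by
  set far : ℤ → Prop := fun x => l.partner x = x ∧ d.partner x = x ∧ d.partner (x - 1) = x - 1 ∧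
    m.cap.partner x = x with hfar
  have hfin : {x | ¬ far x}.Finite := by
    refine (((l.finite_cups.union d.finite_cups).union d.cap.finite_cups).union
      m.cap.finite_cups).subset fun x hx => ?_
    simp only [Set.mem_union, Set.mem_ofPred_eq]
    by_contra h
    push Not at h
    exact hx ⟨h.1.1.1, h.1.1.2, d.partner_cap_eq.1 h.1.2, h.2⟩
  have hline : ∀ x, far x → Joined l d m (Sum.inl x) (Sum.inr x) := by
    intro x hx
    have e1 : d.ray (d.straight (x - 1)) = x - 1 := d.ray_straight hx.2.2.1
    have e2 := d.ray_succ_eq e1 hx.2.1 (by omega) (fun y a b => by omega)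
    have := joined_line (l := l) (d := d) (m := m) (d.straight (x - 1))
    rwa [e1, e2, sub_add_cancel] at this
  by_cases h : ∃ x, far x ∧ Joined l d m v (Sum.inl x)
  · obtain ⟨x, hx, hv⟩ := h
    refine (Set.toFinite {Sum.inl x, Sum.inr x}).subset fun w hw => ?_
    have := far_component hx.1 hx.2.1 hx.2.2.1 hx.2.2.2 (hv.symm.trans hw)
    simpa using this
  · refine ((hfin.image Sum.inl).union (hfin.image Sum.inr)).subset fun w hw => ?_
    rcases w with x | x
    · left
      exact ⟨x, fun hx => h ⟨x, hx, hw⟩, rfl⟩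
    · right
      exact ⟨x, fun hx => h ⟨x, hx, Joined.trans hw (hline x hx).symm⟩, rfl⟩

/-- The sets of vertices of a component at the two levels. -/
def lowSet (l d m : CupDiagram) (v : ℤ ⊕ ℤ) : Finset ℤ :=
  ((finite_component (l := l) (d := d) (m := m) v).preimage
    (f := Sum.inl) Sum.inl_injective.injOn).toFinset
def upSet (l d m : CupDiagram) (v : ℤ ⊕ ℤ) : Finset ℤ :=
  ((finite_component (l := l) (d := d) (m := m) v).preimage
    (f := Sum.inr) Sum.inr_injective.injOn).toFinset

theorem mem_lowSet {v : ℤ ⊕ ℤ} {x : ℤ} : x ∈ lowSet l d m v ↔ Joined l d m v (Sum.inl x) := by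
  simp [lowSet]
theorem mem_upSet {v : ℤ ⊕ ℤ} {x : ℤ} : x ∈ upSet l d m v ↔ Joined l d m v (Sum.inr x) := by
  simp [upSet]

theorem closed_of_cups {c : CupDiagram} {A : Finset ℤ}
    (h : ∀ x, c.partner x ≠ x → (c.partner x ∈ A ↔ x ∈ A)) : ∀ x ∈ A, c.partner x ∈ A := by
  intro x hx
  by_cases h' : c.partner x = x
  · rwa [h']
  · exact (h x h').2 hx

theorem lowSet_bot (v : ℤ ⊕ ℤ) : ∀ x ∈ lowSet l d m v, l.partner x ∈ lowSet l d m v :=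
  closed_of_cups fun x hx => by
    rw [mem_lowSet, mem_lowSet]; exact iff_of_eq ((joined_respects v).bot x hx)
theorem lowSet_cap (v : ℤ ⊕ ℤ) : ∀ x ∈ lowSet l d m v, d.cap.partner x ∈ lowSet l d m v :=
  closed_of_cups fun x hx => by
    rw [mem_lowSet, mem_lowSet]; exact iff_of_eq ((joined_respects v).lower x hx)
theorem upSet_cup (v : ℤ ⊕ ℤ) : ∀ x ∈ upSet l d m v, d.partner x ∈ upSet l d m v :=
  closed_of_cups fun x hx => by
    rw [mem_upSet, mem_upSet]; exact iff_of_eq ((joined_respects v).upper x hx)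
theorem upSet_top (v : ℤ ⊕ ℤ) : ∀ x ∈ upSet l d m v, m.cap.partner x ∈ upSet l d m v :=
  closed_of_cups fun x hx => by
    rw [mem_upSet, mem_upSet]; exact iff_of_eq ((joined_respects v).top x hx)
theorem set_line (v : ℤ ⊕ ℤ) (k : ℤ) :
    d.ray k + 1 ∈ lowSet l d m v ↔ d.ray (k + 1) ∈ upSet l d m v := by
  rw [mem_lowSet, mem_upSet]; exact iff_of_eq ((joined_respects v).line k)

/-! ### Sums over components -/

/-- The sign of an integer. -/
def sgn (x : ℤ) : ℚ := if Even x then 1 else -1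

theorem sgn_ne_zero (x : ℤ) : sgn x ≠ 0 := by unfold sgn; split_ifs <;> norm_num
theorem sgn_mul_self (x : ℤ) : sgn x * sgn x = 1 := by unfold sgn; split_ifs <;> norm_num
theorem sgn_add_one (x : ℤ) : sgn (x + 1) = - sgn x := by
  unfold sgn; simp only [Int.even_add_one]; split_ifs <;> norm_num
theorem sgn_partner {c : CupDiagram} {x : ℤ} (h : c.partner x ≠ x) :
    sgn (c.partner x) = - sgn x := by
  have := c.even_partner h
  by_cases h1 : Even (c.partner x) <;> by_cases h2 : Even x <;> simp [sgn, h1, h2] at this ⊢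
theorem sgn_ray (c : CupDiagram) (k : ℤ) : sgn (c.ray k) = sgn k := by
  unfold sgn; simp only [c.even_ray]

theorem sum_eq_rays {c : CupDiagram} {F : ℤ → ℚ} (hF : ∀ x, c.partner x ≠ x → F (c.partner x) = - F x)
    {A : Finset ℤ} (hA : ∀ x ∈ A, c.partner x ∈ A) :
    ∑ x ∈ A, F x = ∑ x ∈ A.filter (fun x => c.partner x = x), F x := by
  rw [← Finset.sum_filter_add_sum_filter_not A (fun x => c.partner x = x), add_eq_left]
  refine c.sum_closed_eq_zero hF _ ?_ ?_
  · intro x hx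
    rw [Finset.mem_filter] at hx ⊢
    exact ⟨hA x hx.1, c.partner_ne_partner hx.2⟩
  · intro x hx h
    exact absurd h (Finset.mem_filter.1 hx).2

/-- Comparison of sums over the two levels of a component. -/
theorem sum_low_sub_sum_up (v : ℤ ⊕ ℤ) {F G : ℤ → ℚ}
    (hF : ∀ x, d.cap.partner x ≠ x → F (d.cap.partner x) = - F x)
    (hG : ∀ x, d.partner x ≠ x → G (d.partner x) = - G x) :
    ∑ x ∈ lowSet l d m v, F x - ∑ x ∈ upSet l d m v, G x =
      ∑ x ∈ (lowSet l d m v).filter (fun x => d.cap.partner x = x),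
        (F x - G (d.ray (d.straight (x - 1) + 1))) := by
  rw [sum_eq_rays hF (lowSet_cap v), sum_eq_rays hG (upSet_cup v), Finset.sum_sub_distrib]
  congr 1
  symm
  refine Finset.sum_bij' (fun x _ => d.ray (d.straight (x - 1) + 1))
    (fun y _ => d.ray (d.straight y - 1) + 1) ?_ ?_ ?_ ?_ (fun _ _ => rfl)
  · intro x hx
    rw [Finset.mem_filter] at hx ⊢
    have h1 := d.partner_cap_eq.1 hx.2
    refine ⟨?_, d.partner_ray _⟩
    rw [← set_line, d.ray_straight h1, sub_add_cancel]
    exact hx.1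
  · intro y hy
    rw [Finset.mem_filter] at hy ⊢
    refine ⟨?_, d.cap_ray_succ _⟩
    rw [set_line, sub_add_cancel, d.ray_straight hy.2]
    exact hy.1
  · intro x hx
    have h1 := d.partner_cap_eq.1 (Finset.mem_filter.1 hx).2
    simp only [straight_ray, add_sub_cancel_right, d.ray_straight h1, sub_add_cancel]
  · intro y hy
    simp only [add_sub_cancel_right, straight_ray, sub_add_cancel,
      d.ray_straight (Finset.mem_filter.1 hy).2]

/-- The integral of the signed indicator function of `A`. -/
def cum (A : Finset ℤ) (k : ℤ) : ℚ := ∑ x ∈ A.filter (fun x => x < k), sgn x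

theorem cum_add_one (A : Finset ℤ) (k : ℤ) :
    cum A (k + 1) = cum A k + if k ∈ A then sgn k else 0 := by
  have : A.filter (fun x => x < k + 1) = A.filter (fun x => x < k) ∪ A.filter (fun x => x = k) := by
    ext x; simp only [Finset.mem_filter, Finset.mem_union, ← and_or_left]
    refine and_congr_right fun _ => by omega
  rw [cum, this, Finset.sum_union, ← cum, Finset.filter_eq']
  · congr 1
    split_ifs <;> simp
  · rw [Finset.disjoint_filter]; intro x _ h; omega

theorem cum_of_le {A : Finset ℤ} {k : ℤ} (h : ∀ x ∈ A, k ≤ x) : cum A k = 0 := by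
  unfold cum
  rw [Finset.filter_false_of_mem]
  · simp
  · intro x hx; have := h x hx; omega

theorem cum_of_lt {A : Finset ℤ} {k : ℤ} (h : ∀ x ∈ A, x < k) : cum A k = ∑ x ∈ A, sgn x := by
  unfold cum
  rw [Finset.filter_true_of_mem h]

theorem exists_abs_bound (A : Finset ℤ) : ∃ N : ℤ, 0 ≤ N ∧ ∀ x ∈ A, |x| ≤ N := by
  obtain ⟨N, hN⟩ := (A.image (fun x => |x|)).exists_le
  exact ⟨max N 0, le_max_right _ _, fun x hx =>
    (hN _ (Finset.mem_image_of_mem _ hx)).trans (le_max_left _ _)⟩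

theorem cum_finite {A : Finset ℤ} (h : ∑ x ∈ A, sgn x = 0) : (support (cum A)).Finite := by
  obtain ⟨N, hN, hA⟩ := exists_abs_bound A
  refine (Set.finite_Icc (-N) N).subset fun k hk => ?_
  by_contra hk2
  rw [Set.mem_Icc, not_and_or] at hk2
  apply hk
  rcases hk2 with h1 | h1
  · exact cum_of_le fun x hx => by have := abs_le.1 (hA x hx); omega
  · rw [cum_of_lt, h]
    intro x hx; have := abs_le.1 (hA x hx); omega

/-- The two ends of a cup have opposite signs, so the points of `A` from one end of a cup to the
other contribute nothing. -/
theorem cum_compat {c : CupDiagram} {A : Finset ℤ} (hA : ∀ x ∈ A, c.partner x ∈ A) :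
    c.Compat (cum A) := by
  refine compat_of_outside fun b hb => ?_
  rw [mem_rightEnds] at hb
  have : A.filter (fun x => x < b + 1) = A.filter (fun x => x < c.partner b) ∪
      A.filter (fun x => c.partner b ≤ x ∧ x < b + 1) := by
    ext x; simp only [Finset.mem_filter, Finset.mem_union, ← and_or_left]
    refine and_congr_right fun _ => by omega
  rw [cum, this, Finset.sum_union, ← cum, add_eq_left]
  · refine c.sum_closed_eq_zero (fun x hx => sgn_partner hx) _ ?_ ?_
    · intro x hx
      rw [Finset.mem_filter] at hx ⊢
      refine ⟨hA x hx.1, ?_⟩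
      by_cases h1 : x = b
      · subst h1; omega
      · by_cases h2 : x = c.partner b
        · rw [h2, c.invol]; omega
        · have := c.nested' (b := b) (k := x) (by omega) (by omega); omega
    · intro x hx h
      rw [Finset.mem_filter] at hx
      exfalso
      by_cases h1 : x = b
      · subst h1; omega
      · by_cases h2 : x = c.partner b
        · rw [h2, c.invol] at h; omega
        · have := c.nested' (b := b) (k := x) (by omega) (by omega); omega
  · rw [Finset.disjoint_filter]; intro x _ h; omega

theorem cum_closed {c : CupDiagram} {A : Finset ℤ} (hA : ∀ x ∈ A, c.partner x ∈ A)
    (h : ∀ x ∈ A, c.partner x ≠ x) : c.Closed (cum A) := by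
  intro x
  by_cases hx : c.partner x = x
  · rw [hx, cum_add_one, if_neg (fun h1 => h x h1 hx), add_zero]
  · exact cum_compat hA x hx

theorem cum_ne_zero {A : Finset ℤ} {x : ℤ} (hx : x ∈ A) : cum A ≠ 0 := by
  intro h
  have := cum_add_one A x
  rw [h, if_pos hx] at this
  simp only [Pi.zero_apply, zero_add] at this
  exact sgn_ne_zero x this.symm

/-- A function on `ℤ` whose values agree with those of their predecessors is constant. -/
theorem const_of_succ_eq {f : ℤ → ℚ} (h : ∀ k, f k = f (k - 1)) (k k' : ℤ) : f k = f k' := by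
  have : ∀ k, f k = f 0 := fun k => by
    induction k with
    | zero => rfl
    | succ n ih => rw [h, add_sub_cancel_right, ih]
    | pred n ih => rw [← h, ih]
  rw [this, this k']

/-- The integrals over the two levels of a component match. -/
theorem cum_hat_eq (v : ℤ ⊕ ℤ) (k : ℤ) :
    d.hat (cum (lowSet l d m v)) k = d.hat (cum (upSet l d m v)) k := by
  -- Passing a line changes both integrals equally, because its two ends have the same sign and both
  -- or neither belong to the component. Far to the left both integrals vanish.
  have h1 : ∀ k, d.hat (cum (lowSet l d m v)) k - d.hat (cum (upSet l d m v)) k =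
      d.hat (cum (lowSet l d m v)) (k - 1) - d.hat (cum (upSet l d m v)) (k - 1) := by
    intro k
    have e1 := (cum_compat (lowSet_cap (l := l) (d := d) (m := m) v)).ray_left_cap (k - 1)
    have e2 := (cum_compat (upSet_cup (l := l) (d := d) (m := m) v)).ray_left k
    have e3 := cum_add_one (lowSet l d m v) (d.ray (k - 1) + 1)
    have e4 := cum_add_one (upSet l d m v) (d.ray k)
    have e5 := set_line (l := l) (d := d) (m := m) v (k - 1)
    rw [sub_add_cancel] at e1 e5
    simp only [e5] at e3
    have e6 : sgn (d.ray (k - 1) + 1) = sgn (d.ray k) := by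
      rw [sgn_add_one, sgn_ray, sgn_ray, ← sgn_add_one, sub_add_cancel]
    rw [e6, add_assoc, show (1 : ℤ) + 1 = 2 by norm_num, e1] at e3
    rw [e2] at e4
    simp only [hat]
    rw [e3, e4]; ring
  obtain ⟨N, hN, hA⟩ := exists_abs_bound (lowSet l d m v ∪ upSet l d m v)
  have hsmall : d.ray (-N - 1) ≤ -N - 1 := by
    have := d.le_straight (d.ray (-N - 1)); rwa [straight_ray] at this
  have h2 := const_of_succ_eq h1 k (-N - 1)
  have e1 : d.hat (cum (lowSet l d m v)) (-N - 1) = 0 := cum_of_le fun x hx => by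
    have := abs_le.1 (hA x (Finset.mem_union_left _ hx)); omega
  have e2 : d.hat (cum (upSet l d m v)) (-N - 1) = 0 := cum_of_le fun x hx => by
    have := abs_le.1 (hA x (Finset.mem_union_right _ hx)); omega
  rw [e1, e2, sub_zero] at h2
  exact sub_eq_zero.1 h2

/-- Caps and cups of the middle section cancel, and the two ends of a line have equal parity. -/
theorem sum_sgn_eq (v : ℤ ⊕ ℤ) : ∑ x ∈ lowSet l d m v, sgn x = ∑ x ∈ upSet l d m v, sgn x := by
  rw [← sub_eq_zero, sum_low_sub_sum_up v (fun x hx => sgn_partner hx) (fun x hx => sgn_partner hx)]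
  refine Finset.sum_eq_zero fun x hx => ?_
  have h := d.partner_cap_eq.1 (Finset.mem_filter.1 hx).2
  have e1 : sgn (d.straight (x - 1)) = sgn (x - 1) := by rw [← sgn_ray d, d.ray_straight h]
  have e2 := sgn_add_one (x - 1)
  rw [sub_add_cancel] at e2
  rw [sgn_ray, sgn_add_one, e1, e2, sub_self]

/-! ### Uniqueness and propagating lines -/

/-- Uniqueness for the opposite equations. -/
def StackInjOp (l d m : CupDiagram) : Prop :=
  ∀ p q, p ∈ closedM l → p ∈ compatM d.cap → q ∈ compatM d → q ∈ compatM m.cap →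
    (∀ k, d.hat p k = d.hat q k) → p = 0 ∧ q = 0

theorem stackInjOp_of_good (h : (strips l d CupDiagram.empty m).Good) : StackInjOp l d m := by
  intro p q h1 h2 h3 h4 h5
  have := h.2.1 (join3 p q q) (mem_tri.2 ⟨⟨h1, h2⟩, ⟨h3, by
    rw [compatM_cap_empty]; exact h3.1⟩, by rw [compatM_empty]; exact h3.1, h4⟩) (by
      rintro (_ | _) k
      · exact (strips_jump_false l d CupDiagram.empty m _ k).trans (by simp [h5])
      · exact (strips_jump_true l d CupDiagram.empty m _ k).trans (by simp))
  exact ⟨congrArg (lev 0) this, congrArg (lev 1) this⟩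

theorem sets_nonempty (v : ℤ ⊕ ℤ) : (∃ x, x ∈ lowSet l d m v) ∨ ∃ x, x ∈ upSet l d m v := by
  rcases v with x | x
  · exact Or.inl ⟨x, mem_lowSet.2 (Joined.refl _)⟩
  · exact Or.inr ⟨x, mem_upSet.2 (Joined.refl _)⟩

/-- A component with no end at the top has total sign zero, so the integrals of its signed
indicators have finite support and form a nonzero solution. -/
theorem exists_top (h : StackInj l d m) (v : ℤ ⊕ ℤ) :
    ∃ x, m.cap.partner x = x ∧ Joined l d m v (Sum.inr x) := by
  by_contra hno
  push Not at hno
  have h1 : ∀ x ∈ upSet l d m v, m.cap.partner x ≠ x := fun x hx h => hno x h (mem_upSet.1 hx)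
  have h2 : ∑ x ∈ upSet l d m v, sgn x = 0 := by
    rw [sum_eq_rays (fun x hx => sgn_partner hx) (upSet_top v), Finset.filter_false_of_mem h1]
    simp
  have h3 := cum_finite h2
  rw [← sum_sgn_eq] at h2
  have h4 := cum_finite h2
  obtain ⟨e1, e2⟩ := h _ _ ⟨h4, cum_compat (lowSet_bot v)⟩ ⟨h4, cum_compat (lowSet_cap v)⟩
    ⟨h3, cum_compat (upSet_cup v)⟩ ⟨h3, cum_closed (upSet_top v) h1⟩ (cum_hat_eq v)
  rcases sets_nonempty (l := l) (d := d) (m := m) v with ⟨x, hx⟩ | ⟨x, hx⟩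
  · exact cum_ne_zero hx e1
  · exact cum_ne_zero hx e2

/-- The argument of `exists_top` for the opposite system. -/
theorem exists_bot (h : StackInjOp l d m) (v : ℤ ⊕ ℤ) :
    ∃ x, l.partner x = x ∧ Joined l d m v (Sum.inl x) := by
  by_contra hno
  push Not at hno
  have h1 : ∀ x ∈ lowSet l d m v, l.partner x ≠ x := fun x hx h => hno x h (mem_lowSet.1 hx)
  have h2 : ∑ x ∈ lowSet l d m v, sgn x = 0 := by
    rw [sum_eq_rays (fun x hx => sgn_partner hx) (lowSet_bot v), Finset.filter_false_of_mem h1]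
    simp
  have h3 := cum_finite h2
  rw [sum_sgn_eq] at h2
  have h4 := cum_finite h2
  obtain ⟨e1, e2⟩ := h _ _ ⟨h3, cum_closed (lowSet_bot v) h1⟩ ⟨h3, cum_compat (lowSet_cap v)⟩
    ⟨h4, cum_compat (upSet_cup v)⟩ ⟨h4, cum_compat (upSet_top v)⟩ (cum_hat_eq v)
  rcases sets_nonempty (l := l) (d := d) (m := m) v with ⟨x, hx⟩ | ⟨x, hx⟩
  · exact cum_ne_zero hx e1
  · exact cum_ne_zero hx e2

theorem outerPerm_inl {x : ℤ} (h : l.partner x = x) :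
    outerPerm l m (Sum.inl x) = Sum.inl x := congrArg Sum.inl h
theorem outerPerm_inr {x : ℤ} (h : m.cap.partner x = x) :
    outerPerm l m (Sum.inr x) = Sum.inr x := congrArg Sum.inr h

/-- The component has an end at the top, and at most two ends in all. -/
theorem bot_unique (h : StackInj l d m) {v : ℤ ⊕ ℤ} {x y : ℤ} (hx : l.partner x = x)
    (hy : l.partner y = y) (h1 : Joined l d m v (Sum.inl x)) (h2 : Joined l d m v (Sum.inl y)) :
    x = y := by
  obtain ⟨t, ht, h3⟩ := exists_top h v
  have := joined_two_ends (outerPerm_inr ht) (outerPerm_inl hx) (outerPerm_inl hy)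
    (h3.symm.trans h1) (h3.symm.trans h2) (by simp) (by simp)
  exact Sum.inl_injective this

theorem top_unique (h : StackInjOp l d m) {v : ℤ ⊕ ℤ} {x y : ℤ} (hx : m.cap.partner x = x)
    (hy : m.cap.partner y = y) (h1 : Joined l d m v (Sum.inr x)) (h2 : Joined l d m v (Sum.inr y)) :
    x = y := by
  obtain ⟨t, ht, h3⟩ := exists_bot h v
  have := joined_two_ends (outerPerm_inl ht) (outerPerm_inr hx) (outerPerm_inr hy)
    (h3.symm.trans h1) (h3.symm.trans h2) (by simp) (by simp)
  exact Sum.inr_injective this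

theorem not_hasNonPropagating (h : StackInj l d m) (h' : StackInjOp l d m) :
    ¬ HasNonPropagating l d m := by
  rintro ⟨x, y, ⟨h1, h2, h3, h4⟩ | ⟨h1, h2, h3, h4⟩⟩
  · exact h1.ne (bot_unique h h2 h3 (Joined.refl _) h4)
  · exact h1.ne (top_unique h' h2 h3 (Joined.refl _) h4)

theorem orientable_of_inj (h : StackInj l d m) (h' : StackInjOp l d m) : Orientable l d m := by
  have hno := not_hasNonPropagating h h'
  refine ⟨fun v => ?_, fun x y hxy => (hno ⟨x, y, Or.inl hxy⟩).elim,
    fun x y hxy => (hno ⟨x, y, Or.inr hxy⟩).elim⟩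
  obtain ⟨x, hx⟩ := exists_bot h' v
  exact ⟨x, Or.inl hx⟩

variable {l d m : CupDiagram}

/-! ### Flux -/

theorem diff_partner {c : CupDiagram} {p : ℤ → ℚ} (hp : c.Compat p) {x : ℤ}
    (hx : c.partner x ≠ x) :
    p (c.partner x + 1) - p (c.partner x) = -(p (x + 1) - p x) := by
  have h1 := hp x hx
  have h2 := hp (c.partner x) (c.partner_ne_partner hx)
  rw [c.invol] at h2
  rw [h1, h2]; ring

/-- The line joining `d.ray k + 1` to `d.ray (k + 1)` has the outer gaps `k` and `k + 1` on its two
sides, on both levels. -/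
theorem diff_line {p q : ℤ → ℚ} (hp : d.cap.Compat p) (hq : d.Compat q) (k : ℤ) :
    (p (d.ray k + 1 + 1) - p (d.ray k + 1)) - (q (d.ray (k + 1) + 1) - q (d.ray (k + 1))) =
      (d.hat p (k + 1) - d.hat q (k + 1)) - (d.hat p k - d.hat q k) := by
  have e1 := hp.ray_left_cap k
  have e2 := hq.ray_left (k + 1)
  rw [add_sub_cancel_right] at e2
  simp only [hat, add_assoc] at e1 e2 ⊢
  rw [show (1 : ℤ) + 1 = 2 by norm_num, e1, e2]; ring

/-- The flux through the ends of a component is the sum of the contributions of the lines. -/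
theorem flux (v : ℤ ⊕ ℤ) {p q : ℤ → ℚ} (h1 : l.Compat p) (h2 : d.cap.Compat p) (h3 : d.Compat q)
    (h4 : m.cap.Compat q) :
    ∑ x ∈ (lowSet l d m v).filter (fun x => l.partner x = x), (p (x + 1) - p x) -
      ∑ x ∈ (upSet l d m v).filter (fun x => m.cap.partner x = x), (q (x + 1) - q x) =
    ∑ x ∈ (lowSet l d m v).filter (fun x => d.cap.partner x = x),
      ((d.hat p (d.straight (x - 1) + 1) - d.hat q (d.straight (x - 1) + 1)) -
        (d.hat p (d.straight (x - 1)) - d.hat q (d.straight (x - 1)))) := by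
  rw [← sum_eq_rays (fun x hx => diff_partner h1 hx) (lowSet_bot v),
    ← sum_eq_rays (fun x hx => diff_partner h4 hx) (upSet_top v),
    sum_low_sub_sum_up v (fun x hx => diff_partner h2 hx) (fun x hx => diff_partner h3 hx)]
  refine Finset.sum_congr rfl fun x hx => ?_
  have h := d.partner_cap_eq.1 (Finset.mem_filter.1 hx).2
  rw [← diff_line h2 h3, d.ray_straight h, sub_add_cancel]

/-- The signed differences of a pair of functions. -/
def sdiff (p q : ℤ → ℚ) : ℤ ⊕ ℤ → ℚ
  | Sum.inl x => sgn x * (p (x + 1) - p x)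
  | Sum.inr x => sgn x * (q (x + 1) - q x)

theorem sdiff_partner {c : CupDiagram} {p : ℤ → ℚ} (hp : c.Compat p) {x : ℤ}
    (hx : c.partner x ≠ x) : sgn (c.partner x) * (p (c.partner x + 1) - p (c.partner x)) =
      sgn x * (p (x + 1) - p x) := by
  rw [diff_partner hp hx, sgn_partner hx]; ring

theorem sdiff_line {p q : ℤ → ℚ} (hp : d.cap.Compat p) (hq : d.Compat q) {k : ℤ}
    (hk : d.hat p (k + 1) - d.hat q (k + 1) = d.hat p k - d.hat q k) :
    sdiff p q (Sum.inl (d.ray k + 1)) = sdiff p q (Sum.inr (d.ray (k + 1))) := by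
  have h := diff_line hp hq k
  rw [hk, sub_self, sub_eq_zero] at h
  rw [sdiff, sdiff, h, sgn_add_one, sgn_ray, sgn_ray, sgn_add_one]

theorem sdiff_respects {p q : ℤ → ℚ} (h1 : l.Compat p) (h2 : d.cap.Compat p) (h3 : d.Compat q)
    (h4 : m.cap.Compat q) (h5 : ∀ k, d.hat p k = d.hat q k) :
    Respects l d m (sdiff p q) :=
  ⟨fun _ hx => sdiff_partner h1 hx, fun _ hx => sdiff_partner h2 hx,
    fun _ hx => sdiff_partner h3 hx, fun _ hx => sdiff_partner h4 hx,
    fun k => sdiff_line h2 h3 (by rw [h5, h5, sub_self, sub_self])⟩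

/-- On a component without exceptional lines, the signed difference is constant. -/
theorem sdiff_eq_of_joined {p q : ℤ → ℚ} (h1 : l.Compat p) (h2 : d.cap.Compat p) (h3 : d.Compat q)
    (h4 : m.cap.Compat q) {v w : ℤ ⊕ ℤ} (h5 : ∀ k, Joined l d m v (Sum.inl (d.ray k + 1)) →
      d.hat p (k + 1) - d.hat q (k + 1) = d.hat p k - d.hat q k) (hvw : Joined l d m v w) :
    sdiff p q v = sdiff p q w := by
  classical
  have hJ := joined_respects (l := l) (d := d) (m := m) v
  -- Outside the component of `v` the function is cut off to zero, so that lines there need not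
  -- satisfy the hypothesis.
  have hr : Respects l d m (fun w => if Joined l d m v w then sdiff p q w else 0) := by
    refine ⟨fun x hx => ?_, fun x hx => ?_, fun x hx => ?_, fun x hx => ?_, fun k => ?_⟩
    · simp only [hJ.bot x hx]; rw [sdiff, sdiff, sdiff_partner h1 hx]
    · simp only [hJ.lower x hx]; rw [sdiff, sdiff, sdiff_partner h2 hx]
    · simp only [hJ.upper x hx]; rw [sdiff, sdiff, sdiff_partner h3 hx]
    · simp only [hJ.top x hx]; rw [sdiff, sdiff, sdiff_partner h4 hx]
    · have e := hJ.line k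
      by_cases h : Joined l d m v (Sum.inl (d.ray k + 1))
      · simp only [← e, h, if_true, sdiff_line h2 h3 (h5 k h)]
      · simp only [← e, h, if_false]
  have := hr.eq hvw
  simpa [hvw, Joined.refl] using this

theorem sdiff_inl_eq_zero {p q : ℤ → ℚ} {x : ℤ} : sdiff p q (Sum.inl x) = 0 ↔ p (x + 1) = p x := by
  rw [sdiff, mul_eq_zero, or_iff_right (sgn_ne_zero x), sub_eq_zero]
theorem sdiff_inr_eq_zero {p q : ℤ → ℚ} {x : ℤ} : sdiff p q (Sum.inr x) = 0 ↔ q (x + 1) = q x := by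
  rw [sdiff, mul_eq_zero, or_iff_right (sgn_ne_zero x), sub_eq_zero]

theorem eq_zero_of_add_one_eq {p : ℤ → ℚ} (hf : (support p).Finite) (h : ∀ x, p (x + 1) = p x) :
    p = 0 := by
  funext k
  refine eq_zero_of_succ_eq (fun k => ?_) hf k
  rw [← h (k - 1), sub_add_cancel]

theorem eq_zero_of_sdiff {p q : ℤ → ℚ} (hp : (support p).Finite) (hq : (support q).Finite)
    (h : ∀ v, sdiff p q v = 0) : p = 0 ∧ q = 0 :=
  ⟨eq_zero_of_add_one_eq hp fun x => sdiff_inl_eq_zero.1 (h (Sum.inl x)),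
    eq_zero_of_add_one_eq hq fun x => sdiff_inr_eq_zero.1 (h (Sum.inr x))⟩

theorem closed_ray {c : CupDiagram} {p : ℤ → ℚ} (h : c.Closed p) {x : ℤ} (hx : c.partner x = x) :
    p (x + 1) = p x := by
  have := h x
  rwa [hx] at this

/-- A diagram without circles and non-propagating lines has unique solutions. -/
theorem stackInj_of_orientable (ho : Orientable l d m) (hn : ¬ HasNonPropagating l d m) :
    StackInj l d m := by
  intro p q h1 h2 h3 h4 h5
  refine eq_zero_of_sdiff h1.1 h3.1 fun v => ?_
  have hr := sdiff_respects h1.2 h2.2 h3.2 h4.2.compat h5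
  obtain ⟨x, ⟨hx, hv⟩ | ⟨hx, hv⟩⟩ := ho.1 v
  · rw [hr.eq hv, sdiff_inl_eq_zero]
    -- The component has a single end at the bottom. There is no flux through the top, where `q` is
    -- closed, so none passes through this end.
    have hf := flux v h1.2 h2.2 h3.2 h4.2.compat (m := m)
    have e1 : (lowSet l d m v).filter (fun x => l.partner x = x) = {x} := by
      ext y
      rw [Finset.mem_filter, mem_lowSet, Finset.mem_singleton]
      constructor
      · rintro ⟨h6, h7⟩
        by_contra hne
        rcases lt_or_gt_of_ne hne with h8 | h8
        · exact hn ⟨y, x, Or.inl ⟨h8, h7, hx, h6.symm.trans hv⟩⟩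
        · exact hn ⟨x, y, Or.inl ⟨h8, hx, h7, hv.symm.trans h6⟩⟩
      · rintro rfl; exact ⟨hv, hx⟩
    rw [e1, Finset.sum_singleton, Finset.sum_eq_zero, Finset.sum_eq_zero, sub_zero, sub_eq_zero] at hf
    · exact hf
    · intro y _; rw [h5, h5, sub_self, sub_self, sub_self]
    · intro y hy; rw [closed_ray h4.2 (Finset.mem_filter.1 hy).2, sub_self]
  · rw [hr.eq hv, sdiff_inr_eq_zero, closed_ray h4.2 hx]

/-! ### Propagating lines preserve the order -/

/-- Only the ray `r` makes the integral change between outer gaps, so on these it is a step at the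
number of `r`. -/
theorem hat_cum {c : CupDiagram} {A : Finset ℤ} (hA : ∀ x ∈ A, c.partner x ∈ A) {r : ℤ}
    (hr : c.partner r = r) (h : ∀ x, c.partner x = x → (x ∈ A ↔ x = r)) (k : ℤ) :
    sgn r * c.hat (cum A) k = if c.straight r ≤ k then 1 else 0 := by
  have h1 : ∀ k, sgn r * c.hat (cum A) k - (if c.straight r ≤ k then 1 else 0) =
      sgn r * c.hat (cum A) (k - 1) - (if c.straight r ≤ k - 1 then 1 else 0) := by
    intro k
    have e1 := cum_add_one A (c.ray k)
    rw [(cum_compat hA).ray_left] at e1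
    simp only [hat]
    rw [e1]
    by_cases hk : c.ray k = r
    · have e2 : c.straight r = k := by rw [← hk, straight_ray]
      rw [if_pos ((h _ (c.partner_ray k)).2 hk), hk, mul_add, sgn_mul_self, e2, if_pos le_rfl,
        if_neg (by omega)]
      ring
    · have e2 : c.straight r ≠ k := fun e => hk (by rw [← e, c.ray_straight hr])
      rw [if_neg (fun h' => hk ((h _ (c.partner_ray k)).1 h')), add_zero]
      congr 1
      have : c.straight r ≤ k ↔ c.straight r ≤ k - 1 := by omega
      simp only [this]
  obtain ⟨N, hN, hB⟩ := exists_abs_bound A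
  have h2 := const_of_succ_eq h1 k (min (-N - 1) (c.straight r - 1))
  have hsmall := c.le_straight (c.ray (min (-N - 1) (c.straight r - 1)))
  rw [straight_ray] at hsmall
  have e1 : c.hat (cum A) (min (-N - 1) (c.straight r - 1)) = 0 := cum_of_le fun x hx => by
    have := abs_le.1 (hB x hx); omega
  have e2 : ¬ c.straight r ≤ min (-N - 1) (c.straight r - 1) := by omega
  rw [e1, mul_zero, if_neg e2, sub_zero] at h2
  exact sub_eq_zero.1 h2

/-- The first factor vanishes far to the left and the second one far to the right. -/
theorem cum_product_finite {A A' : Finset ℤ} {r r' : ℤ} (h : ∑ x ∈ A, sgn x = sgn r) :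
    (support (fun k => sgn r' * cum A' k * (1 - sgn r * cum A k))).Finite := by
  obtain ⟨N, hN, hB⟩ := exists_abs_bound A
  obtain ⟨N', hN', hB'⟩ := exists_abs_bound A'
  refine (Set.finite_Icc (-N') N).subset fun k hk => ?_
  by_contra hk2
  rw [Set.mem_Icc, not_and_or] at hk2
  apply hk
  rcases hk2 with h1 | h1
  · have : cum A' k = 0 := cum_of_le fun x hx => by have := abs_le.1 (hB' x hx); omega
    simp [this]
  · have : cum A k = sgn r := by
      rw [cum_of_lt, h]
      intro x hx; have := abs_le.1 (hB x hx); omega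
    simp [this, sgn_mul_self]

theorem compat_product {c : CupDiagram} {A A' : Finset ℤ} (hA : ∀ x ∈ A, c.partner x ∈ A)
    (hA' : ∀ x ∈ A', c.partner x ∈ A') (a b : ℚ) :
    c.Compat (fun k => a * cum A' k * (1 - b * cum A k)) := fun x hx => by
  simp only [cum_compat hA x hx, cum_compat hA' x hx]

theorem sum_of_single_ray {c : CupDiagram} {A : Finset ℤ} (hA : ∀ x ∈ A, c.partner x ∈ A) {r : ℤ}
    (hr : c.partner r = r) (h : ∀ x, c.partner x = x → (x ∈ A ↔ x = r)) :
    ∑ x ∈ A, sgn x = sgn r := by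
  rw [sum_eq_rays (fun x hx => sgn_partner hx) hA]
  have : A.filter (fun x => c.partner x = x) = {r} := by
    ext y
    rw [Finset.mem_filter, Finset.mem_singleton]
    constructor
    · rintro ⟨h1, h2⟩; exact (h y h2).1 h1
    · rintro rfl; exact ⟨(h y hr).2 rfl, hr⟩
  rw [this, Finset.sum_singleton]

theorem mem_lowSet_ray (hI : StackInj l d m) {v : ℤ ⊕ ℤ} {r : ℤ} (hr : l.partner r = r)
    (hv : Joined l d m v (Sum.inl r)) (x : ℤ) (hx : l.partner x = x) :
    x ∈ lowSet l d m v ↔ x = r := by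
  rw [mem_lowSet]
  exact ⟨fun h => bot_unique hI hx hr h hv, fun h => h ▸ hv⟩

theorem mem_upSet_ray (hI : StackInjOp l d m) {v : ℤ ⊕ ℤ} {r : ℤ} (hr : m.cap.partner r = r)
    (hv : Joined l d m v (Sum.inr r)) (x : ℤ) (hx : m.cap.partner x = x) :
    x ∈ upSet l d m v ↔ x = r := by
  rw [mem_upSet]
  exact ⟨fun h => top_unique hI hx hr h hv, fun h => h ▸ hv⟩

/-- Multiply the step function of the second line by the complement of that of the first. If the
lines exchanged their order, this product would vanish on the outer gaps at the bottom but not at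
the top, giving a nonzero solution of the opposite system. -/
theorem propagating_mono (hI : StackInj l d m) (hI' : StackInjOp l d m) {r r' t t' : ℤ}
    (hr : l.partner r = r) (hr' : l.partner r' = r') (ht : m.cap.partner t = t)
    (ht' : m.cap.partner t' = t') (h : Joined l d m (Sum.inl r) (Sum.inr t))
    (h' : Joined l d m (Sum.inl r') (Sum.inr t')) (hlt : r < r') : t < t' := by
  by_contra hcon
  have hne : t' ≠ t := by
    rintro rfl
    exact hlt.ne (bot_unique hI hr hr' h.symm h'.symm)
  have hlt' : t' < t := by omega
  have a1 := mem_lowSet_ray hI hr (Joined.refl (l := l) (d := d) (m := m) (Sum.inl r))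
  have a2 := mem_lowSet_ray hI hr' (Joined.refl (l := l) (d := d) (m := m) (Sum.inl r'))
  have b1 := mem_upSet_ray hI' ht h
  have b2 := mem_upSet_ray hI' ht' h'
  have s1 := sum_of_single_ray (lowSet_bot _) hr a1
  have s1' := sum_of_single_ray (upSet_top _) ht b1
  have s2 := sum_of_single_ray (lowSet_bot _) hr' a2
  have s2' := sum_of_single_ray (upSet_top _) ht' b2
  have es : sgn t = sgn r := by rw [← s1, ← s1', sum_sgn_eq]
  have es' : sgn t' = sgn r' := by rw [← s2, ← s2', sum_sgn_eq]
  set A := lowSet l d m (Sum.inl r)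
  set A' := lowSet l d m (Sum.inl r')
  set B := upSet l d m (Sum.inl r)
  set B' := upSet l d m (Sum.inl r')
  have hs := l.straight_lt hr' hlt
  have hs' := m.cap.straight_lt ht hlt'
  obtain ⟨-, e⟩ := hI' (fun k => sgn r' * cum A' k * (1 - sgn r * cum A k))
    (fun k => sgn r' * cum B' k * (1 - sgn r * cum B k))
    (closed_of_hat_zero ⟨cum_product_finite s1, compat_product (lowSet_bot _) (lowSet_bot _) _ _⟩
      (fun k => by
        have c1 := hat_cum (lowSet_bot _) hr a1 k
        have c2 := hat_cum (lowSet_bot _) hr' a2 k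
        simp only [hat] at c1 c2 ⊢
        rw [c1, c2]
        split_ifs
        · norm_num
        · omega
        · norm_num
        · norm_num))
    ⟨cum_product_finite s1, compat_product (lowSet_cap _) (lowSet_cap _) _ _⟩
    ⟨cum_product_finite (s1'.trans es), compat_product (upSet_cup _) (upSet_cup _) _ _⟩
    ⟨cum_product_finite (s1'.trans es), compat_product (upSet_top _) (upSet_top _) _ _⟩
    (fun k => by
      have c1 := cum_hat_eq (l := l) (d := d) (m := m) (Sum.inl r) k
      have c2 := cum_hat_eq (l := l) (d := d) (m := m) (Sum.inl r') k
      simp only [hat] at c1 c2 ⊢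
      rw [c1, c2])
  have c1 := hat_cum (upSet_top _) ht b1 (m.cap.straight t')
  have c2 := hat_cum (upSet_top _) ht' b2 (m.cap.straight t')
  have e' := congrFun e (m.cap.ray (m.cap.straight t') + 1)
  simp only [hat, Pi.zero_apply] at c1 c2 e'
  rw [es, if_neg (by omega)] at c1
  rw [es', if_pos le_rfl] at c2
  change sgn r' * cum B' _ * (1 - sgn r * cum B _) = 0 at e'
  rw [c1, c2] at e'
  norm_num at e'

/-- Descending from the fixed point `N`, a strictly increasing surjection cannot skip the next
integer. -/
theorem strictMono_eq_id {Φ : ℤ → ℤ} (h1 : StrictMono Φ) (h2 : Surjective Φ) {N : ℤ}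
    (h3 : Φ N = N) (k : ℤ) (hN : N ≤ k → Φ k = k) : Φ k = k := by
  by_cases hk : N ≤ k
  · exact hN hk
  · obtain ⟨i, rfl⟩ : ∃ i : ℕ, k = N - i := ⟨(N - k).toNat, by omega⟩
    clear hN hk
    induction i with
    | zero => simpa using h3
    | succ i ih =>
      have h4 : Φ (N - ((i + 1 : ℕ) : ℤ)) < Φ (N - i) := h1 (by push_cast; omega)
      rw [ih] at h4
      by_contra hne
      obtain ⟨x, hx⟩ := h2 (N - ((i + 1 : ℕ) : ℤ))
      have h5 : N - ((i + 1 : ℕ) : ℤ) < x := h1.lt_iff_lt.1 (by push_cast at *; omega)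
      have h6 : x < N - i := h1.lt_iff_lt.1 (by rw [ih, hx]; push_cast; omega)
      push_cast at h5
      omega

theorem joined_far {x : ℤ} (h2 : d.partner x = x) (h3 : d.partner (x - 1) = x - 1) :
    Joined l d m (Sum.inl x) (Sum.inr x) := by
  have e1 : d.ray (d.straight (x - 1)) = x - 1 := d.ray_straight h3
  have e2 := d.ray_succ_eq e1 h2 (by omega) (fun y a b => by omega)
  have := joined_line (l := l) (d := d) (m := m) (d.straight (x - 1))
  rwa [e1, e2, sub_add_cancel] at this

/-- Propagating lines preserve the enumeration of the rays. -/
theorem straight_eq_of_joined (hI : StackInj l d m) (hI' : StackInjOp l d m) {x t : ℤ}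
    (hx : l.partner x = x) (ht : m.cap.partner t = t) (h : Joined l d m (Sum.inl x) (Sum.inr t)) :
    l.straight x = m.cap.straight t := by
  choose τ hτ1 hτ2 using fun k => exists_top hI (Sum.inl (l.ray k))
  have huniq : ∀ x t, l.partner x = x → m.cap.partner t = t →
      Joined l d m (Sum.inl x) (Sum.inr t) → m.cap.straight (τ (l.straight x)) = m.cap.straight t := by
    intro x t hx ht h
    have h1 := hτ2 (l.straight x)
    rw [l.ray_straight hx] at h1
    rw [top_unique hI' (hτ1 _) ht h1 h]
  have hmono : StrictMono fun k => m.cap.straight (τ k) := by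
    intro k k' hk
    exact m.cap.straight_lt (hτ1 k') (propagating_mono hI hI' (l.partner_ray k) (l.partner_ray k')
      (hτ1 k) (hτ1 k') (hτ2 k) (hτ2 k') (l.ray_strictMono hk))
  have hsurj : Surjective fun k => m.cap.straight (τ k) := by
    intro k
    obtain ⟨x, hx1, hx2⟩ := exists_bot hI' (Sum.inr (m.cap.ray k))
    refine ⟨l.straight x, ?_⟩
    have := huniq x (m.cap.ray k) hx1 (m.cap.partner_ray k) hx2.symm
    simpa using this
  obtain ⟨N1, -, b1⟩ := l.exists_bound
  obtain ⟨N2, -, b2⟩ := d.exists_bound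
  obtain ⟨N3, -, b3⟩ := m.cap.exists_bound
  have hlarge : ∀ x, max N1 (max N2 N3) + 2 ≤ x → m.cap.straight (τ x) = x := by
    intro x hx
    have f1 : ∀ y, x ≤ y → l.partner y = y := fun y hy => by
      by_contra h; have := abs_le.1 (b1 y h); omega
    have f2 : ∀ y, x - 1 ≤ y → d.partner y = y := fun y hy => by
      by_contra h; have := abs_le.1 (b2 y h); omega
    have f3 : ∀ y, x ≤ y → m.cap.partner y = y := fun y hy => by
      by_contra h; have := abs_le.1 (b3 y h); omega
    have g1 : l.straight x = x := l.straight_of_large fun p hp => f1 p hp.le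
    have g2 : m.cap.straight x = x := m.cap.straight_of_large fun p hp => f3 p hp.le
    have := huniq x x (f1 x le_rfl) (f3 x le_rfl) (joined_far (f2 x (by omega)) (f2 _ le_rfl))
    rwa [g1, g2] at this
  have := strictMono_eq_id hmono hsurj (hlarge _ le_rfl) (l.straight x) (hlarge _)
  rw [huniq x t hx ht h] at this
  exact this.symm

variable {l d d' m : CupDiagram}

/-! ### Step functions -/

theorem step_function {g : ℤ → ℚ} (hf : (support g).Finite) {u w : ℤ}
    (h : ∀ k, g k - g (k - 1) = (if u = k then 1 else 0) - (if w = k then 1 else 0)) (k : ℤ) :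
    g k = (if u ≤ k then 1 else 0) - (if w ≤ k then 1 else 0) := by
  have h1 : ∀ k, g k - ((if u ≤ k then 1 else 0) - (if w ≤ k then 1 else 0)) =
      g (k - 1) - ((if u ≤ k - 1 then 1 else 0) - (if w ≤ k - 1 then 1 else 0)) := by
    intro k
    have h2 := h k
    have e : ∀ u : ℤ, (if u ≤ k then (1 : ℚ) else 0) =
        (if u ≤ k - 1 then 1 else 0) + (if u = k then 1 else 0) := by
      intro u
      split_ifs <;> first | omega | norm_num
    rw [e u, e w]
    linarith
  obtain ⟨N, -, hN⟩ := exists_abs_bound hf.toFinset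
  set z := min (-N - 1) (min u w - 1) with hz
  have h2 := const_of_succ_eq h1 k z
  have e1 : g z = 0 := by
    by_contra h3
    have := abs_le.1 (hN z (by simpa using h3)); omega
  have e2 : ¬ u ≤ z := by omega
  have e3 : ¬ w ≤ z := by omega
  rw [e1, if_neg e2, if_neg e3] at h2
  linarith

/-- The step function is nonzero on the whole interval between its jumps, which may contain integers
of one parity only. -/
theorem step_adjacent {g : ℤ → ℚ} (hf : (support g).Finite) {u w κ : ℤ}
    (h : ∀ k, g k - g (k - 1) = (if u = k then 1 else 0) - (if w = k then 1 else 0))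
    (hne : u ≠ w) (hp : ∀ k, g k ≠ 0 → (Even k ↔ Even κ)) : u = w + 1 ∨ w = u + 1 := by
  have hs := step_function hf h
  by_contra hcon
  push Not at hcon
  have key : ∀ k, ¬ (g k ≠ 0 ∧ g (k + 1) ≠ 0) := by
    rintro k ⟨h1, h2⟩
    have h3 := hp k h1
    have h4 := hp _ h2
    rw [Int.even_add_one] at h4
    tauto
  rcases lt_or_gt_of_ne hne with h1 | h1
  · refine key u ⟨?_, ?_⟩ <;> rw [hs, if_pos (by omega), if_neg (by omega)] <;> norm_num
  · refine key w ⟨?_, ?_⟩ <;> rw [hs, if_neg (by omega), if_pos (by omega)] <;> norm_num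

/-! ### Functions with one jump -/

/-- A pair of functions on the regions with a jump at position `κ` of the middle section. -/
structure PeakPair (B T : Submodule ℚ (ℤ → ℚ)) (d : CupDiagram) (κ : ℤ) (p q : ℤ → ℚ) : Prop where
  bot : p ∈ B
  lower : p ∈ compatM d.cap
  upper : q ∈ compatM d
  top : q ∈ T
  jump : ∀ k, d.hat p k - d.hat q k = if k = κ then 1 else 0
  parity : ∀ x, p x ≠ 0 → (¬ Even x ↔ Even κ)
  parity' : ∀ x, q x ≠ 0 → (¬ Even x ↔ Even κ)
  base : d.hat q κ = 0 ∨ d.hat q κ = -1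
  values : ∀ x, p x = d.hat q κ ∨ p x = d.hat q κ + 1

theorem peakPair_of {S : Strips (Fin 3 × ℤ)} (hS : S.Inj) {B T : Submodule ℚ (ℤ → ℚ)}
    (hX : S.X = tri B T d CupDiagram.empty)
    (hlo : ∀ k, S.lo false k = (0, d.ray k + 1)) (hup : ∀ k, S.up false k = (1, d.ray k + 1))
    (hlo' : ∀ k, S.lo true k = (1, k + 1)) (hup' : ∀ k, S.up true k = (2, k + 1))
    (hpar : ∀ γ, S.par γ ↔ ¬ Even γ.2)
    {x : Fin 3 × ℤ → ℚ} {κ : ℤ} (hx : S.Peak x false κ) :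
    PeakPair B T d κ (lev 0 x) (lev 1 x) := by
  have h1 := hx.1
  rw [hX, mem_tri] at h1
  have e : lev 1 x = lev 2 x := by
    funext k
    have := hx.2 true (k - 1)
    simp only [Strips.jump, hlo', hup', sub_add_cancel, Bool.true_eq_false, false_and,
      if_false] at this
    exact sub_eq_zero.1 this
  refine ⟨h1.1.1, h1.1.2, h1.2.1.1, e ▸ h1.2.2.2, fun k => ?_, fun y hy => ?_, fun y hy => ?_, ?_,
    fun y => ?_⟩
  · have := hx.2 false k
    simpa [Strips.jump, hlo, hup, hat] using this
  · by_contra h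
    exact hy (hx.indicator hS (γ := (0, y)) (by rwa [hpar]))
  · by_contra h
    exact hy (hx.indicator hS (γ := (1, y)) (by rwa [hpar]))
  · have := hx.base hS
    rwa [hup] at this
  · have := hx.values hS (0, y)
    rwa [hup] at this

theorem peakPair_X (hS : (strips l d CupDiagram.empty m).Good) {x : Fin 3 × ℤ → ℚ} {κ : ℤ}
    (hx : (strips l d CupDiagram.empty m).Peak x false κ) :
    PeakPair (compatM l) (closedM m.cap) d κ (lev 0 x) (lev 1 x) :=
  peakPair_of hS.1.1 rfl (fun _ => rfl) (fun _ => rfl) (fun k => by simp [strips, ray_empty])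
    (fun k => by simp [strips, ray_empty]) (fun _ => Iff.rfl) hx

theorem peakPair_Y (hS : (strips l d CupDiagram.empty m).Good) {x : Fin 3 × ℤ → ℚ} {κ : ℤ}
    (hx : (strips l d CupDiagram.empty m).swap.Peak x false κ) :
    PeakPair (closedM l) (compatM m.cap) d κ (lev 0 x) (lev 1 x) :=
  peakPair_of hS.2.1 rfl (fun _ => rfl) (fun _ => rfl)
    (fun k => by simp [strips, Strips.swap, ray_empty])
    (fun k => by simp [strips, Strips.swap, ray_empty]) (fun _ => Iff.rfl) hx

open Classical in
-- Only the lines numbered `κ - 1` and `κ`, on the two sides of the jump, contribute.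
theorem sum_jumps {v : ℤ ⊕ ℤ} {κ : ℤ} {J : ℤ → ℚ} (hJ : ∀ k, J k = if k = κ then 1 else 0) :
    ∑ x ∈ (lowSet l d m v).filter (fun x => d.cap.partner x = x),
      (J (d.straight (x - 1) + 1) - J (d.straight (x - 1))) =
    (if Joined l d m v (Sum.inl (d.ray (κ - 1) + 1)) then 1 else 0) -
      (if Joined l d m v (Sum.inl (d.ray κ + 1)) then 1 else 0) := by
  have key : ∀ k, ∑ x ∈ (lowSet l d m v).filter (fun x => d.cap.partner x = x),
      (if d.straight (x - 1) = k then (1 : ℚ) else 0) =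
      if Joined l d m v (Sum.inl (d.ray k + 1)) then 1 else 0 := by
    intro k
    have : ∀ x ∈ (lowSet l d m v).filter (fun x => d.cap.partner x = x),
        (if d.straight (x - 1) = k then (1 : ℚ) else 0) = if x = d.ray k + 1 then 1 else 0 := by
      intro x hx
      have h := d.partner_cap_eq.1 (Finset.mem_filter.1 hx).2
      have : d.straight (x - 1) = k ↔ x = d.ray k + 1 := by
        constructor
        · rintro rfl; rw [d.ray_straight h]; ring
        · rintro rfl; rw [add_sub_cancel_right, straight_ray]
      simp only [this]
    rw [Finset.sum_congr rfl this, Finset.sum_ite_eq']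
    simp only [Finset.mem_filter, mem_lowSet, cap_ray_succ, and_true]
  rw [Finset.sum_sub_distrib]
  simp only [hJ, ← key, eq_sub_iff_add_eq]

theorem filter_low_ray (hI : StackInj l d m) {v : ℤ ⊕ ℤ} {r : ℤ} (hr : l.partner r = r)
    (hv : Joined l d m v (Sum.inl r)) :
    (lowSet l d m v).filter (fun x => l.partner x = x) = {r} := by
  ext y
  rw [Finset.mem_filter, Finset.mem_singleton]
  constructor
  · rintro ⟨h1, h2⟩; exact (mem_lowSet_ray hI hr hv y h2).1 h1
  · rintro rfl; exact ⟨(mem_lowSet_ray hI hr hv y hr).2 rfl, hr⟩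

theorem filter_up_ray (hI : StackInjOp l d m) {v : ℤ ⊕ ℤ} {r : ℤ} (hr : m.cap.partner r = r)
    (hv : Joined l d m v (Sum.inr r)) :
    (upSet l d m v).filter (fun x => m.cap.partner x = x) = {r} := by
  ext y
  rw [Finset.mem_filter, Finset.mem_singleton]
  constructor
  · rintro ⟨h1, h2⟩; exact (mem_upSet_ray hI hr hv y h2).1 h1
  · rintro rfl; exact ⟨(mem_upSet_ray hI hr hv y hr).2 rfl, hr⟩

theorem sum_closed_rays {c : CupDiagram} {q : ℤ → ℚ} (hq : c.Closed q) (A : Finset ℤ) :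
    ∑ x ∈ A.filter (fun x => c.partner x = x), (q (x + 1) - q x) = 0 :=
  Finset.sum_eq_zero fun y hy => by rw [closed_ray hq (Finset.mem_filter.1 hy).2, sub_self]

section
variable {κ : ℤ} {p q : ℤ → ℚ}

/-- A peak sends flux 1 along the line left of its jump and flux -1 along the line right of it. None
leaves at the top, where the function is closed, so all of it appears at the bottom ends. -/
theorem PeakPair.diff_bot (hI : StackInj l d m)
    (P : PeakPair (compatM l) (closedM m.cap) d κ p q) {r₁ r₂ : ℤ} (h1 : l.partner r₁ = r₁)
    (h2 : l.partner r₂ = r₂) (j1 : Joined l d m (Sum.inl r₁) (Sum.inl (d.ray (κ - 1) + 1)))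
    (j2 : Joined l d m (Sum.inl r₂) (Sum.inl (d.ray κ + 1))) {r : ℤ} (hr : l.partner r = r) :
    p (r + 1) - p r = (if r₁ = r then 1 else 0) - (if r₂ = r then 1 else 0) := by
  have hf := flux (Sum.inl r) P.bot.2 P.lower.2 P.upper.2 P.top.2.compat
  rw [sum_closed_rays P.top.2, filter_low_ray hI hr (Joined.refl _), Finset.sum_singleton,
    sub_zero, sum_jumps P.jump] at hf
  have e : ∀ {r' : ℤ} {w}, l.partner r' = r' → Joined l d m (Sum.inl r') w →
      (Joined l d m (Sum.inl r) w ↔ r' = r) := by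
    intro r' w h j
    constructor
    · intro h3; exact bot_unique hI h hr j.symm h3.symm
    · rintro rfl; exact j
  rw [hf]
  simp only [e h1 j1, e h2 j2]

theorem PeakPair.diff_top (hI : StackInjOp l d m)
    (P : PeakPair (closedM l) (compatM m.cap) d κ p q) {r₁ r₂ : ℤ} (h1 : m.cap.partner r₁ = r₁)
    (h2 : m.cap.partner r₂ = r₂) (j1 : Joined l d m (Sum.inr r₁) (Sum.inl (d.ray (κ - 1) + 1)))
    (j2 : Joined l d m (Sum.inr r₂) (Sum.inl (d.ray κ + 1))) {r : ℤ} (hr : m.cap.partner r = r) :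
    q (r + 1) - q r = (if r₂ = r then 1 else 0) - (if r₁ = r then 1 else 0) := by
  have hf := flux (Sum.inr r) P.bot.2.compat P.lower.2 P.upper.2 P.top.2
  rw [sum_closed_rays P.bot.2, filter_up_ray hI hr (Joined.refl _), Finset.sum_singleton,
    zero_sub, sum_jumps P.jump] at hf
  have e : ∀ {r' : ℤ} {w}, m.cap.partner r' = r' → Joined l d m (Sum.inr r') w →
      (Joined l d m (Sum.inr r) w ↔ r' = r) := by
    intro r' w h j
    constructor
    · intro h3; exact top_unique hI h hr j.symm h3.symm
    · rintro rfl; exact j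
  rw [neg_eq_iff_eq_neg, neg_sub] at hf
  rw [hf]
  simp only [e h1 j1, e h2 j2]

theorem hat_diff {c : CupDiagram} {f : ℤ → ℚ} (hf : c.Compat f) {u w : ℤ}
    (hu : c.partner u = u) (hw : c.partner w = w)
    (h : ∀ r, c.partner r = r → f (r + 1) - f r = (if u = r then 1 else 0) - (if w = r then 1 else 0))
    (k : ℤ) : c.hat f k - c.hat f (k - 1) =
      (if c.straight u = k then 1 else 0) - (if c.straight w = k then 1 else 0) := by
  have h1 := h (c.ray k) (c.partner_ray k)
  rw [hf.ray_left] at h1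
  simp only [hat]
  rw [h1]
  have e : ∀ u, c.partner u = u → (u = c.ray k ↔ c.straight u = k) := by
    intro u hu
    constructor
    · rintro rfl; rw [straight_ray]
    · rintro rfl; rw [c.ray_straight hu]
  simp only [e u hu, e w hw]

/-- The ends of two lines are adjacent, on either side of the centre, if the jump can be removed. -/
theorem PeakPair.bottom (hI : StackInj l d m)
    (P : PeakPair (compatM l) (closedM m.cap) d κ p q) {r₁ r₂ : ℤ} (h1 : l.partner r₁ = r₁)
    (h2 : l.partner r₂ = r₂) (j1 : Joined l d m (Sum.inl r₁) (Sum.inl (d.ray (κ - 1) + 1)))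
    (j2 : Joined l d m (Sum.inl r₂) (Sum.inl (d.ray κ + 1)))
    (hp' : d'.cap.Compat p) (hq' : d'.Compat q) (hh : ∀ k, d'.hat p k = d'.hat q k)
    (ho : Orientable l d' m) :
    (l.straight r₁ = l.numCups - 2 ∧ l.straight r₂ = l.numCups - 1 ∧ d.hat q κ = 0) ∨
      (l.straight r₁ = l.numCups - 1 ∧ l.straight r₂ = l.numCups - 2 ∧ d.hat q κ = -1) := by
  have hD := fun r hr => P.diff_bot hI h1 h2 j1 j2 (r := r) hr
  have hres := sdiff_respects P.bot.2 hp' hq' P.top.2.compat hh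
  -- If both lines had the same end, no flux would reach the bottom; as the diagram of `d'` has no
  -- circles, its solution would be zero, contrary to the jump.
  have hne : r₁ ≠ r₂ := by
    rintro rfl
    have hz : p = 0 ∧ q = 0 := by
      refine eq_zero_of_sdiff P.bot.1 P.upper.1 fun v => ?_
      obtain ⟨x, ⟨hx, hv⟩ | ⟨hx, hv⟩⟩ := ho.1 v
      · have := hD x hx
        rw [sub_self, sub_eq_zero] at this
        rw [hres.eq hv, sdiff_inl_eq_zero, this]
      · rw [hres.eq hv, sdiff_inr_eq_zero, closed_ray P.top.2 hx]
    have := P.jump κ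
    simp [hz.1, hz.2, hat] at this
  -- In the diagram of `d'` the functions have no jump, so the flux entering at `r₁` must leave the
  -- same component at `r₂`.
  have hjoin : Joined l d' m (Sum.inl r₁) (Sum.inl r₂) := by
    have hf := flux (Sum.inl r₁) P.bot.2 hp' hq' P.top.2.compat
    rw [sum_closed_rays P.top.2, sub_zero, Finset.sum_congr rfl (fun x hx =>
      hD x (Finset.mem_filter.1 hx).2), Finset.sum_sub_distrib, Finset.sum_ite_eq,
      Finset.sum_ite_eq, if_pos (by simp [mem_lowSet, h1, Joined.refl])] at hf
    by_contra h
    rw [if_neg (by simp [mem_lowSet, h]), Finset.sum_eq_zero] at hf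
    · norm_num at hf
    · intro x _; rw [hh, hh, sub_self, sub_self, sub_self]
  have hg := hat_diff P.bot.2 h1 h2 hD
  have hfin := hat_finite (c := l) P.bot.1
  have hsne : l.straight r₁ ≠ l.straight r₂ := fun h => hne (by
    rw [← l.ray_straight h1, h, l.ray_straight h2])
  have hadj := step_adjacent hfin hg hsne (κ := κ) (fun k hk => by
    have := P.parity _ hk
    rwa [even_ray_succ] at this)
  have hs := step_function hfin hg
  have hmono : ∀ r r', l.partner r = r → l.partner r' = r' → l.straight r < l.straight r' → r < r' := by
    intro r r' h h' hlt
    by_contra hc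
    rcases lt_or_eq_of_le (not_lt.1 hc) with h3 | h3
    · have := l.straight_lt h h3; omega
    · rw [h3] at hlt; omega
  -- Consecutive numbers lie on different sides of the bottom centre only if they are `numCups - 2`
  -- and `numCups - 1`.
  rcases hadj with h | h
  · right
    have hb := ho.2.1 r₂ r₁ ⟨hmono _ _ h2 h1 (by omega), h2, h1, hjoin.symm⟩
    have hv := hs (l.straight r₂)
    rw [if_neg (by omega), if_pos le_rfl] at hv
    have hv' : p (l.ray (l.straight r₂) + 1) = -1 := by rw [← zero_sub]; exact hv
    refine ⟨?_, ?_, ?_⟩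
    · unfold bottomPos at hb; split_ifs at hb <;> omega
    · unfold bottomPos at hb; split_ifs at hb <;> omega
    · rcases P.base with h3 | h3
      · rcases P.values (l.ray (l.straight r₂) + 1) with h4 | h4 <;> rw [hv', h3] at h4 <;>
          norm_num at h4
      · exact h3
  · left
    have hb := ho.2.1 r₁ r₂ ⟨hmono _ _ h1 h2 (by omega), h1, h2, hjoin⟩
    have hv := hs (l.straight r₁)
    rw [if_pos le_rfl, if_neg (by omega)] at hv
    have hv' : p (l.ray (l.straight r₁) + 1) = 1 := by rw [← sub_zero (1 : ℚ)]; exact hv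
    refine ⟨?_, ?_, ?_⟩
    · unfold bottomPos at hb; split_ifs at hb <;> omega
    · unfold bottomPos at hb; split_ifs at hb <;> omega
    · rcases P.base with h3 | h3
      · exact h3
      · rcases P.values (l.ray (l.straight r₁) + 1) with h4 | h4 <;> rw [hv', h3] at h4 <;>
          norm_num at h4

/-- The mirror image of `PeakPair.bottom`. The top centre is shifted by one, so the pair of numbers
is now `numCups - 1` and `numCups`. -/
theorem PeakPair.upper_end (hI : StackInjOp l d m)
    (P : PeakPair (closedM l) (compatM m.cap) d κ p q) {r₁ r₂ : ℤ} (h1 : m.cap.partner r₁ = r₁)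
    (h2 : m.cap.partner r₂ = r₂) (j1 : Joined l d m (Sum.inr r₁) (Sum.inl (d.ray (κ - 1) + 1)))
    (j2 : Joined l d m (Sum.inr r₂) (Sum.inl (d.ray κ + 1)))
    (hp' : d'.cap.Compat p) (hq' : d'.Compat q) (hh : ∀ k, d'.hat p k = d'.hat q k)
    (ho : Orientable l d' m) :
    (m.cap.straight r₁ = m.cap.numCups ∧ m.cap.straight r₂ = m.cap.numCups - 1) ∨
      (m.cap.straight r₁ = m.cap.numCups - 1 ∧ m.cap.straight r₂ = m.cap.numCups) := by
  have hD := fun r hr => P.diff_top hI h1 h2 j1 j2 (r := r) hr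
  have hres := sdiff_respects P.bot.2.compat hp' hq' P.top.2 hh
  have hne : r₁ ≠ r₂ := by
    rintro rfl
    have hz : p = 0 ∧ q = 0 := by
      refine eq_zero_of_sdiff P.bot.1 P.upper.1 fun v => ?_
      obtain ⟨x, ⟨hx, hv⟩ | ⟨hx, hv⟩⟩ := ho.1 v
      · rw [hres.eq hv, sdiff_inl_eq_zero, closed_ray P.bot.2 hx]
      · have := hD x hx
        rw [sub_self, sub_eq_zero] at this
        rw [hres.eq hv, sdiff_inr_eq_zero, this]
    have := P.jump κ
    simp [hz.1, hz.2, hat] at this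
  have hjoin : Joined l d' m (Sum.inr r₁) (Sum.inr r₂) := by
    have hf := flux (Sum.inr r₁) P.bot.2.compat hp' hq' P.top.2
    rw [sum_closed_rays P.bot.2, zero_sub, Finset.sum_congr rfl (fun x hx =>
      hD x (Finset.mem_filter.1 hx).2), Finset.sum_sub_distrib, Finset.sum_ite_eq,
      Finset.sum_ite_eq, if_pos (c := r₁ ∈ _) (by simp [mem_upSet, h1, Joined.refl])] at hf
    by_contra h
    rw [if_neg (by simp [mem_upSet, h]), Finset.sum_eq_zero] at hf
    · norm_num at hf
    · intro x _; rw [hh, hh, sub_self, sub_self, sub_self]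
  have hg := hat_diff P.top.2 h2 h1 hD
  have hfin := hat_finite (c := m.cap) P.top.1
  have hsne : m.cap.straight r₂ ≠ m.cap.straight r₁ := fun h => hne (by
    rw [← m.cap.ray_straight h1, ← h, m.cap.ray_straight h2])
  have hadj := step_adjacent hfin hg hsne (κ := κ) (fun k hk => by
    have := P.parity' _ hk
    rwa [even_ray_succ] at this)
  have hmono : ∀ r r', m.cap.partner r = r → m.cap.partner r' = r' →
      m.cap.straight r < m.cap.straight r' → r < r' := by
    intro r r' h h' hlt
    by_contra hc
    rcases lt_or_eq_of_le (not_lt.1 hc) with h3 | h3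
    · have := m.cap.straight_lt h h3; omega
    · rw [h3] at hlt; omega
  rcases hadj with h | h
  · right
    have hb := ho.2.2 r₁ r₂ ⟨hmono _ _ h1 h2 (by omega), h1, h2, hjoin⟩
    unfold topPos at hb
    split_ifs at hb <;> omega
  · left
    have hb := ho.2.2 r₂ r₁ ⟨hmono _ _ h2 h1 (by omega), h2, h1, hjoin.symm⟩
    unfold topPos at hb
    split_ifs at hb <;> omega

end

/-- A good diagram stays good after a reverse surgery if the result is orientable. -/
theorem good_of_orientable {j : ℤ} (hn : l.numCups = m.numCups)
    (hG : (strips l d CupDiagram.empty m).Good) (hj : AddCup d d' j) (ho : Orientable l d' m) :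
    (strips l d' CupDiagram.empty m).Good := by
  refine (insertion_left hj l CupDiagram.empty m).good hG ?_
  rw [(insertion_left hj l CupDiagram.empty m).inj_iff]
  have hI : StackInj l d m := stackInj_iff.2 hG.1.1
  have hI' : StackInjOp l d m := stackInjOp_of_good hG
  choose P hP using hG.1.2
  choose P' hP' using hG.2.2
  rw [Strips.injStep_iff hG.1.1 (x := fun τ => P false (Strips.idx j τ)) (fun τ => hP _ _)]
  -- Suppose a diagonal entry is zero. Then the peak `x` satisfies both inserted equations, and by
  -- duality so does the peak `y` of the opposite system at the neighbouring position.
  intro τ h0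
  set x := P false (Strips.idx j τ) with hx
  set y := P' false (Strips.idx j !τ) with hy
  have Hx : (strips l d CupDiagram.empty m).Peak x false (Strips.idx j τ) := hP _ _
  have Hy : (strips l d CupDiagram.empty m).swap.Peak y false (Strips.idx j !τ) := hP' _ _
  have hx1 : (strips l d CupDiagram.empty m).func false j (!τ) x = 0 :=
    Hx.func_parity hG.1.1 (by have := Strips.not_even_idx j !τ; rwa [Bool.not_not] at this)
  have hy0 : (strips l d CupDiagram.empty m).swap.func false j (!τ) y = 0 := by
    rw [← Hx.func_dual_self Hy, h0]
  have hy1 : (strips l d CupDiagram.empty m).swap.func false j τ y = 0 :=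
    Hy.func_parity hG.2.1 (Strips.not_even_idx j τ)
  have Px := peakPair_X hG Hx
  have Py := peakPair_Y hG Hy
  have fx : ∀ τ, (strips l d CupDiagram.empty m).func false j τ x = 0 := by
    intro τ'
    cases τ <;> cases τ' <;> assumption
  have fy : ∀ τ, (strips l d CupDiagram.empty m).swap.func false j τ y = 0 := by
    intro τ'
    cases τ <;> cases τ' <;> assumption
  -- After the insertion the positions `j` and `j + 1` disappear, and with them the jump, so such a
  -- pair solves all equations for `d'`.
  have ext : ∀ {B T κ p q}, PeakPair B T d κ p q → (κ = j ∨ κ = j + 1) →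
      d.hat p j - d.hat p (j + 2) = 0 → d.hat q (j - 1) - d.hat q (j + 1) = 0 →
      d'.cap.Compat p ∧ d'.Compat q ∧ ∀ k, d'.hat p k = d'.hat q k := by
    intro B T κ p q Q hκ h1 h2
    refine ⟨hj.compat_cap_iff.2 ⟨Q.lower.2, sub_eq_zero.1 h1⟩,
      hj.compat_iff.2 ⟨Q.upper.2, sub_eq_zero.1 h2⟩, fun k => ?_⟩
    have := Q.jump (Strips.skip j k)
    have hsk := Strips.skip_ne j k
    rw [if_neg (by omega), sub_eq_zero] at this
    simp only [hat, hj.ray_eq] at this ⊢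
    exact this
  have hidx : ∀ τ, Strips.idx j τ = j ∨ Strips.idx j τ = j + 1 := by
    rintro (_ | _)
    · exact Or.inl rfl
    · exact Or.inr rfl
  obtain ⟨x1, x2, x3⟩ := ext Px (hidx _) (fx false) (fx true)
  obtain ⟨y1, y2, y3⟩ := ext Py (hidx _) (fy false) (fy true)
  choose r hr1 hr2 using fun k => exists_bot hI' (Sum.inl (d.ray k + 1))
  choose t ht1 ht2 using fun k => exists_top hI (Sum.inl (d.ray k + 1))
  have hst : ∀ k, l.straight (r k) = m.cap.straight (t k) := fun k =>
    straight_eq_of_joined hI hI' (hr1 k) (ht1 k) ((hr2 k).symm.trans (ht2 k))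
  have hb := Px.bottom hI (hr1 _) (hr1 _) (hr2 _).symm (hr2 _).symm x1 x2 x3 ho
  have ht := Py.upper_end hI' (ht1 _) (ht1 _) (ht2 _).symm (ht2 _).symm y1 y2 y3 ho
  -- Lines keep their numbers from bottom to top. The lines next to the jump of `x` have numbers `n
  -- - 2, n - 1`, those next to the jump of `y` have `n - 1, n`; so the common line is number `n -
  -- 1`.
  rw [numCups_cap, ← hn, ← hst, ← hst] at ht
  -- Along any line not next to the jump of `x`, the signed difference of `x` is constant, and it
  -- vanishes at the bottom.
  have hconst : ∀ k, l.straight (r k) ≠ l.straight (r (Strips.idx j τ - 1)) →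
      l.straight (r k) ≠ l.straight (r (Strips.idx j τ)) →
      lev 0 x (d.ray k + 1 + 1) = lev 0 x (d.ray k + 1) := by
    intro k h1 h2
    rw [← sdiff_inl_eq_zero (q := lev 1 x), sdiff_eq_of_joined Px.bot.2 Px.lower.2 Px.upper.2
      Px.top.2.compat _ (hr2 k), sdiff_inl_eq_zero]
    · have := Px.diff_bot hI (hr1 _) (hr1 _) (hr2 _).symm (hr2 _).symm (hr1 k)
      rw [if_neg (fun h => h1 (by rw [h])), if_neg (fun h => h2 (by rw [h])), sub_self,
        sub_eq_zero] at this
      exact this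
    · intro k' hk'
      have e : r k' = r k := bot_unique hI (hr1 _) (hr1 _) (hr2 k') (hk'.symm.trans (hr2 k))
      rw [Px.jump, Px.jump, if_neg, if_neg]
      · rintro rfl; rw [e] at h2; exact h2 rfl
      · intro h
        rw [← h, add_sub_cancel_right, e] at h1; exact h1 rfl
  have hzero : ∀ k, ¬ (Even k ↔ Even (Strips.idx j τ)) → d.hat (lev 0 x) k = 0 := by
    intro k hk
    by_contra h
    have := Px.parity _ h
    rw [even_ray_succ] at this
    exact hk this
  have hline : ∀ k, lev 0 x (d.ray k + 1 + 1) = d.hat (lev 0 x) (k + 1) := by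
    intro k
    rw [add_assoc]
    exact Px.lower.2.ray_left_cap k
  -- The line next to the jump of `y` only is crossed without change, and on one of its sides `x`
  -- vanishes by parity. With the inserted equation this contradicts the base value 0 or -1 that
  -- `PeakPair.bottom` fixes.
  cases τ
  · simp only [Strips.idx, Bool.not_false, if_true, Bool.false_eq_true, if_false,
      add_sub_cancel_right] at hb ht hconst hzero
    have h1 := hconst (j + 1) (by omega) (by omega)
    rw [hline] at h1
    have h2 : d.hat (lev 0 x) (j + 1) = 0 := hzero _ (by rw [Int.even_add_one]; tauto)
    have h3 : d.hat (lev 0 x) j - d.hat (lev 0 x) (j + 2) = 0 := fx false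
    have h4 := Px.jump j
    simp only [Strips.idx, Bool.false_eq_true, if_false, if_true] at h4
    have h5 : d.hat (lev 0 x) (j + 1 + 1) = d.hat (lev 0 x) (j + 1) := h1
    rw [add_assoc, show (1 : ℤ) + 1 = 2 by norm_num, h2] at h5
    rcases hb with ⟨-, -, h6⟩ | ⟨h6, h7, -⟩
    · linarith
    · omega
  · simp only [Strips.idx, Bool.not_true, if_true, Bool.false_eq_true, if_false,
      add_sub_cancel_right] at hb ht hconst hzero
    have h1 := hconst (j - 1) (by omega) (by omega)
    rw [hline, sub_add_cancel] at h1
    have h2 : d.hat (lev 0 x) j = 0 := hzero _ (by rw [Int.even_add_one]; tauto)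
    have h3 : d.hat (lev 1 x) (j - 1) - d.hat (lev 1 x) (j + 1) = 0 := fx true
    have h4 := Px.jump (j - 1)
    simp only [Strips.idx, if_true] at h4
    rw [if_neg (by omega)] at h4
    have h5 : d.hat (lev 0 x) j = d.hat (lev 0 x) (j - 1) := h1
    rcases hb with ⟨h6, h7, -⟩ | ⟨-, -, h6⟩
    · omega
    · linarith

/-- If all diagrams in the computation of a product are orientable, and the result has only
propagating lines, then so have all these diagrams. -/
theorem prodInj_of_orientable {c : CupDiagram} (hn : l.numCups = m.numCups) (h0 : PairInj l m)
    (ho : ∀ d : CupDiagram, d.IsSub c → Orientable l d m) : ProdInj l c m := by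
  intro d hd
  have : (strips l d CupDiagram.empty m).Good :=
    sub_induction (P := fun d => (strips l d CupDiagram.empty m).Good) (strips_empty_good hn h0)
      (fun _ d' _ hj hs hG => good_of_orientable hn hG hj (ho d' hs)) hd
  exact stackInj_iff.2 this.1.1

theorem ProdInj.good {c : CupDiagram} (hn : l.numCups = m.numCups) (h : ProdInj l c m)
    (hd : d.IsSub c) : (strips l d CupDiagram.empty m).Good :=
  sub_induction (P := fun d => (strips l d CupDiagram.empty m).Good) (strips_empty_good hn h.pair)
    (fun _ d' _ hj hs hG =>
      (insertion_left hj l CupDiagram.empty m).good hG (stackInj_iff.1 (h d' hs))) hd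

theorem ProdInj.orientable {c : CupDiagram} (hn : l.numCups = m.numCups) (h : ProdInj l c m)
    (hd : d.IsSub c) : Orientable l d m :=
  orientable_of_inj (h d hd) (stackInjOp_of_good (h.good hn hd))

/-- A circle diagram has unique solutions if and only if it is orientable with only propagating
lines. -/
theorem pairInj_iff (hn : l.numCups = m.numCups) : PairInj l m ↔
    Orientable l CupDiagram.empty m ∧ ¬ HasNonPropagating l CupDiagram.empty m := by
  constructor
  · intro h
    have hG := strips_empty_good hn h
    have h1 := stackInj_empty.2 h
    exact ⟨orientable_of_inj h1 (stackInjOp_of_good hG),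
      not_hasNonPropagating h1 (stackInjOp_of_good hG)⟩
  · rintro ⟨h1, h2⟩
    exact stackInj_empty.1 (stackInj_of_orientable h1 h2)

/-! ### Contraction of two neighbouring strands -/

/-- The gaps that remain when the strands `x` and `x + 1` are removed. -/
def gapIn (x k : ℤ) : ℤ := if k ≤ x then k else k + 2
/-- The strands that remain when the strands `x` and `x + 1` are removed. -/
def strandIn (x k : ℤ) : ℤ := if k < x then k else k + 2
/-- The position of a gap after the strands `x` and `x + 1` are removed. -/
def gapOut (x k : ℤ) : ℤ := if k ≤ x then k else if k ≤ x + 2 then x else k - 2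

theorem gapIn_injective (x : ℤ) : Injective (gapIn x) := by
  intro a b h; unfold gapIn at h; split_ifs at h <;> omega
theorem strandIn_injective (x : ℤ) : Injective (strandIn x) := by
  intro a b h; unfold strandIn at h; split_ifs at h <;> omega

theorem exists_strandIn {x y : ℤ} (h1 : y ≠ x) (h2 : y ≠ x + 1) : ∃ k, strandIn x k = y := by
  by_cases h : y < x
  · exact ⟨y, if_pos h⟩
  · exact ⟨y - 2, by rw [strandIn, if_neg (by omega)]; ring⟩

theorem strandIn_ne (x k : ℤ) : strandIn x k ≠ x ∧ strandIn x k ≠ x + 1 := by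
  unfold strandIn; split_ifs <;> omega

theorem gapIn_succ (x k : ℤ) : gapIn x (k + 1) = strandIn x k + 1 := by
  unfold gapIn strandIn; split_ifs <;> omega

/-- Contraction of functions on the gaps. -/
def contr (x : ℤ) : (ℤ → ℚ) →ₗ[ℚ] (ℤ → ℚ) := LinearMap.funLeft ℚ ℚ (gapIn x)

theorem contr_apply (x : ℤ) (v : ℤ → ℚ) (k : ℤ) : contr x v k = v (gapIn x k) := rfl

theorem contr_succ (x : ℤ) (v : ℤ → ℚ) (k : ℤ) : contr x v (k + 1) = v (strandIn x k + 1) := by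
  rw [contr_apply, gapIn_succ]

theorem contr_strand {x : ℤ} {v : ℤ → ℚ} (h : v x = v (x + 2)) (k : ℤ) :
    contr x v k = v (strandIn x k) := by
  rw [contr_apply]
  rcases lt_trichotomy k x with h1 | h1 | h1
  · rw [gapIn, strandIn, if_pos h1.le, if_pos h1]
  · rw [gapIn, strandIn, h1, if_pos le_rfl, if_neg (by omega), h]
  · rw [gapIn, strandIn, if_neg (by omega), if_neg (by omega)]

theorem contr_gapOut {x : ℤ} {v : ℤ → ℚ} (h : v x = v (x + 2)) {k : ℤ} (hk : k ≠ x + 1) :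
    contr x v (gapOut x k) = v k := by
  rw [contr_apply]
  unfold gapOut
  split_ifs with h1 h2
  · rw [gapIn, if_pos h1]
  · rw [gapIn, if_pos le_rfl, h, show k = x + 2 by omega]
  · rw [gapIn, if_neg (by omega), sub_add_cancel]

theorem contr_finM {x : ℤ} {v : ℤ → ℚ} (h : v ∈ finM) : contr x v ∈ finM :=
  Set.Finite.preimage (gapIn_injective x).injOn h

/-- The lift of a function to the gaps before a contraction. -/
def lift (x : ℤ) (v : ℤ → ℚ) : ℤ → ℚ := fun k => v (gapOut x k)

theorem contr_lift (x : ℤ) (v : ℤ → ℚ) : contr x (lift x v) = v := by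
  funext k
  rw [contr_apply, lift]
  congr 1
  unfold gapIn gapOut; split_ifs <;> omega

theorem lift_eq (x : ℤ) (v : ℤ → ℚ) : lift x v x = lift x v (x + 2) := by
  simp [lift, gapOut]

theorem lift_finM {x : ℤ} {v : ℤ → ℚ} (h : v ∈ finM) : lift x v ∈ finM := by
  refine ((h.image (gapIn x)).union (Set.toFinite {x + 1, x + 2})).subset fun k hk => ?_
  by_cases h1 : k = x + 1 ∨ k = x + 2
  · right; simpa using h1
  · left
    refine ⟨gapOut x k, hk, ?_⟩
    unfold gapIn gapOut; split_ifs <;> omega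

/-- With equal values at `x` and `x + 2`, the summands of `Om` at the strands `x` and `x + 1`
cancel. -/
theorem om_contr {x : ℤ} {f g : ℤ → ℚ} (hf : f ∈ finM) (h1 : f x = f (x + 2))
    (h2 : g x = g (x + 2)) : Om f g = Om (contr x f) (contr x g) := by
  unfold Om
  rw [finsum_eq_comp (strandIn_injective x) (s := {x, x + 1}) _ (om_support_finite hf)]
  · refine finsum_congr fun k => ?_
    rw [contr_succ, contr_succ, contr_strand h1, contr_strand h2]
  · rw [Finset.sum_pair (by omega), add_assoc, show (1 : ℤ) + 1 = 2 by norm_num, ← h1, ← h2]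
    ring
  · intro y
    simp only [Set.mem_range, Finset.mem_insert, Finset.mem_singleton, not_or]
    constructor
    · rintro ⟨k, rfl⟩; exact strandIn_ne x k
    · rintro ⟨h3, h4⟩; exact exists_strandIn h3 h4

/-- `C'` arises from `C` by removing a cup which joins the strands `x` and `x + 1`. -/
structure SmallCup (C C' : CupDiagram) (x : ℤ) : Prop where
  cup : C.partner x = x + 1
  other : ∀ k, C.partner (strandIn x k) = strandIn x (C'.partner k)

namespace SmallCup
variable {C C' : CupDiagram} {x : ℤ}

theorem cup' (h : SmallCup C C' x) : C.partner (x + 1) = x := by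
  rw [← h.cup, C.invol]

theorem cap (h : SmallCup C C' x) : SmallCup C.cap C'.cap (x + 1) where
  cup := by simp [CupDiagram.cap, h.cup]
  other k := by
    have e : ∀ k, strandIn (x + 1) k - 1 = strandIn x (k - 1) := by
      intro k; unfold strandIn; split_ifs <;> omega
    have e' : ∀ k, strandIn (x + 1) (k + 1) = strandIn x k + 1 := by
      intro k; unfold strandIn; split_ifs <;> omega
    simp only [CupDiagram.cap]
    rw [e, h.other, e']

theorem ray_iff (h : SmallCup C C' x) (k : ℤ) :
    C.partner (strandIn x k) = strandIn x k ↔ C'.partner k = k := by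
  rw [h.other]; exact (strandIn_injective x).eq_iff

theorem compat_iff (h : SmallCup C C' x) {v : ℤ → ℚ} :
    C.Compat v ↔ v x = v (x + 2) ∧ C'.Compat (contr x v) := by
  constructor
  · intro hv
    have h1 := hv x (by rw [h.cup]; omega)
    rw [h.cup, add_assoc] at h1
    refine ⟨h1.symm, fun k hk => ?_⟩
    rw [contr_succ, contr_strand h1.symm, ← h.other]
    exact hv _ (fun e => hk ((h.ray_iff k).1 e))
  · rintro ⟨h1, h2⟩ y hy
    by_cases hy1 : y = x
    · rw [hy1, h.cup, add_assoc]; exact h1.symm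
    · by_cases hy2 : y = x + 1
      · rw [hy2, h.cup']
      · obtain ⟨k, rfl⟩ := exists_strandIn hy1 hy2
        have := h2 k (fun e => hy ((h.ray_iff k).2 e))
        rwa [contr_succ, contr_strand h1, ← h.other] at this

theorem closed_iff (h : SmallCup C C' x) {v : ℤ → ℚ} :
    C.Closed v ↔ v x = v (x + 2) ∧ C'.Closed (contr x v) := by
  constructor
  · intro hv
    have h1 := (h.compat_iff.1 hv.compat).1
    refine ⟨h1, fun k => ?_⟩
    rw [contr_succ, contr_strand h1, ← h.other]
    exact hv _
  · rintro ⟨h1, h2⟩ y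
    by_cases hy1 : y = x
    · rw [hy1, h.cup, add_assoc]; exact h1.symm
    · by_cases hy2 : y = x + 1
      · rw [hy2, h.cup']
      · obtain ⟨k, rfl⟩ := exists_strandIn hy1 hy2
        have := h2 k
        rwa [contr_succ, contr_strand h1, ← h.other] at this

theorem card_lt (h : SmallCup C C' x) : C'.endpoints.card < C.endpoints.card := by
  rw [← Finset.card_map ⟨strandIn x, strandIn_injective x⟩]
  refine Finset.card_lt_card ⟨fun y hy => ?_, fun hs => ?_⟩
  · obtain ⟨k, hk, rfl⟩ := Finset.mem_map.1 hy
    rw [mem_endpoints] at hk ⊢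
    exact fun e => hk ((h.ray_iff k).1 e)
  · have := hs (C.mem_endpoints.2 (show C.partner x ≠ x by rw [h.cup]; omega))
    obtain ⟨k, -, hk⟩ := Finset.mem_map.1 this
    exact (strandIn_ne x k).1 hk

end SmallCup

theorem exists_smallCup_of {C : CupDiagram} {x : ℤ} (hx : C.partner x = x + 1) :
    ∃ C', SmallCup C C' x := by
  have hx' : C.partner (x + 1) = x := by rw [← hx, C.invol]
  have hex : ∀ k, ∃ k', strandIn x k' = C.partner (strandIn x k) := by
    intro k
    have h1 := strandIn_ne x k
    refine exists_strandIn (fun e => h1.2 ?_) (fun e => h1.1 ?_)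
    · exact C.partner_injective (e.trans hx'.symm)
    · exact C.partner_injective (e.trans hx.symm)
  choose f hf using hex
  have hlt : ∀ a b, strandIn x a < strandIn x b ↔ a < b := by
    intro a b; unfold strandIn; split_ifs <;> omega
  refine ⟨⟨f, fun k => strandIn_injective x ?_, ?_, ?_⟩, hx, fun k => (hf k).symm⟩
  · rw [hf, hf, C.invol]
  · refine (C.finite_cups.preimage (strandIn_injective x).injOn).subset fun k hk => ?_
    simp only [Set.mem_ofPred_eq, Set.mem_preimage] at hk ⊢
    rw [← hf]
    exact fun e => hk (strandIn_injective x e)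
  · intro i k h1 h2
    rw [← hlt, hf] at h2
    rw [← hlt] at h1
    have := C.nested h1 h2
    rw [← hf, ← hf i, hlt, hlt] at this
    exact ⟨fun e => this.1 (by rw [e]), this.2⟩

theorem exists_smallCup {C : CupDiagram} (h : C ≠ CupDiagram.empty) : ∃ C' x, SmallCup C C' x := by
  have hne : ∃ x, x < C.partner x := by
    by_contra hcon
    push Not at hcon
    apply h
    ext x
    have h1 := hcon x
    have h2 := hcon (C.partner x)
    rw [C.invol] at h2
    exact le_antisymm h1 h2
  -- Descend to an innermost cup: if the ends of a cup are not adjacent, the cup at the next point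
  -- is shorter.
  obtain ⟨x, hx⟩ : ∃ x, C.partner x = x + 1 := by
    obtain ⟨x, hx⟩ := hne
    obtain ⟨N, hN⟩ : ∃ N : ℕ, C.partner x = x + 1 + N := ⟨(C.partner x - (x + 1)).toNat, by omega⟩
    induction N using Nat.strong_induction_on generalizing x with
    | _ N ih =>
      by_cases h0 : N = 0
      · exact ⟨x, by omega⟩
      · have h1 := C.nested (a := x) (k := x + 1) (by omega) (by omega)
        have h2 : x + 1 < C.partner (x + 1) := by
          have := h1.1
          omega
        exact ih (C.partner (x + 1) - (x + 1 + 1)).toNat (by omega) (x + 1) h2 (by omega)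
  exact ⟨_, x, (exists_smallCup_of hx).choose_spec⟩

/-! ### Coisotropic spaces with states -/

/-- A space of finitely supported functions that contains its orthogonal space. -/
def Cois (V : Submodule ℚ (ℤ → ℚ)) : Prop :=
  V ≤ finM ∧ ∀ w ∈ finM, (∀ v ∈ V, Om w v = 0) → w ∈ V

/-- On `V`, evaluation at a point of `ν` agrees with evaluation at a point outside `ν`. -/
def Sep (V : Submodule ℚ (ℤ → ℚ)) (ν : Finset ℤ) : Prop :=
  ∀ i ∈ ν, ∃ k, k ∉ ν ∧ ∀ v ∈ V, v i = v k

theorem Sep.mono {V : Submodule ℚ (ℤ → ℚ)} {ν ν' : Finset ℤ} (h : Sep V ν) (hs : ν' ⊆ ν) :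
    Sep V ν' := fun i hi =>
  let ⟨k, hk, hv⟩ := h i (hs hi)
  ⟨k, fun h => hk (hs h), hv⟩

/-- Functions with equal values at `x` and `x + 2`. -/
def eqM (x : ℤ) : Submodule ℚ (ℤ → ℚ) where
  carrier := {v | v x = v (x + 2)}
  add_mem' {p q} hp hq := by
    simp only [Set.mem_ofPred_eq] at hp hq ⊢
    simp [hp, hq]
  zero_mem' := rfl
  smul_mem' a p hp := by
    simp only [Set.mem_ofPred_eq] at hp ⊢
    simp [hp]

/-- The reduction of a space at `x`. -/
def reduceM (x : ℤ) (V : Submodule ℚ (ℤ → ℚ)) : Submodule ℚ (ℤ → ℚ) := (V ⊓ eqM x).map (contr x)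
/-- The expansion of a space at `x`. -/
def expandM (x : ℤ) (V : Submodule ℚ (ℤ → ℚ)) : Submodule ℚ (ℤ → ℚ) :=
  V.comap (contr x) ⊓ eqM x ⊓ finM

theorem mem_reduceM {x : ℤ} {V : Submodule ℚ (ℤ → ℚ)} {v : ℤ → ℚ} :
    v ∈ reduceM x V ↔ ∃ w ∈ V, w x = w (x + 2) ∧ contr x w = v := by
  simp only [reduceM, Submodule.mem_map, Submodule.mem_inf]
  exact ⟨fun ⟨w, h⟩ => ⟨w, h.1.1, h.1.2, h.2⟩, fun ⟨w, h1, h2, h3⟩ => ⟨w, ⟨h1, h2⟩, h3⟩⟩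

theorem mem_expandM {x : ℤ} {V : Submodule ℚ (ℤ → ℚ)} {v : ℤ → ℚ} :
    v ∈ expandM x V ↔ contr x v ∈ V ∧ v x = v (x + 2) ∧ v ∈ finM := by
  simp only [expandM, Submodule.mem_inf, Submodule.mem_comap, and_assoc]
  rfl

/-- The dots that remain after a reduction at `x`. -/
def reduceDots (x : ℤ) (ν : Finset ℤ) : Finset ℤ := (ν.erase (x + 1)).image (gapOut x)

theorem mem_reduceDots {x k : ℤ} {ν : Finset ℤ} :
    k ∈ reduceDots x ν ↔ ∃ j ∈ ν, j ≠ x + 1 ∧ gapOut x j = k := by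
  simp only [reduceDots, Finset.mem_image, Finset.mem_erase]
  exact ⟨fun ⟨j, h, h'⟩ => ⟨j, h.2, h.1, h'⟩, fun ⟨j, h1, h2, h3⟩ => ⟨j, ⟨h2, h1⟩, h3⟩⟩

theorem single_finM (x : ℤ) : (Pi.single x 1 : ℤ → ℚ) ∈ finM := support_single_finite x 1

theorem om_single_mid (x : ℤ) (g : ℤ → ℚ) :
    Om (Pi.single (x + 1) 1) g = g (x + 2) - g x := by
  rw [om_single_left, add_sub_cancel_right, add_assoc]; rfl

theorem Cois.single_mem {V : Submodule ℚ (ℤ → ℚ)} (h : Cois V) {x : ℤ}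
    (hx : ∀ v ∈ V, v x = v (x + 2)) : Pi.single (x + 1) 1 ∈ V :=
  h.2 _ (single_finM _) fun v hv => by rw [om_single_mid, hx v hv, sub_self]

/-- Symplectic reduction. The pairing with the lift of `w` vanishes on the part of `V` with equal
values at `x` and `x + 2`, so on `V` it is a multiple of the difference of these values, which is
the pairing with the unit function at `x + 1`. Correct the lift by that unit function, which the
contraction kills. -/
theorem Cois.reduce {V : Submodule ℚ (ℤ → ℚ)} (h : Cois V) (x : ℤ) : Cois (reduceM x V) := by
  refine ⟨fun v hv => ?_, fun w hw hw0 => ?_⟩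
  · obtain ⟨u, hu, -, rfl⟩ := mem_reduceM.1 hv
    exact contr_finM (h.1 hu)
  · have key : ∀ v ∈ V, v x = v (x + 2) → Om (lift x w) v = 0 := by
      intro v hv hv'
      rw [om_contr (lift_finM hw) (lift_eq x w) hv', contr_lift]
      exact hw0 _ (mem_reduceM.2 ⟨v, hv, hv', rfl⟩)
    obtain ⟨c, hc⟩ : ∃ c : ℚ, ∀ v ∈ V, Om (lift x w) v = c * (v (x + 2) - v x) := by
      by_cases hex : ∃ u ∈ V, u (x + 2) - u x ≠ 0
      · obtain ⟨u, hu, hu'⟩ := hex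
        refine ⟨Om (lift x w) u / (u (x + 2) - u x), fun v hv => ?_⟩
        set a := (v (x + 2) - v x) / (u (x + 2) - u x) with ha
        have h1 := key (v + (-a) • u) (V.add_mem hv (V.smul_mem _ hu)) (by
          have : a * (u (x + 2) - u x) = v (x + 2) - v x := div_mul_cancel₀ _ hu'
          simp only [Pi.add_apply, Pi.smul_apply, smul_eq_mul]
          linarith)
        rw [om_add_right (h.1 hv) (finM.smul_mem _ (h.1 hu)), om_smul_right] at h1
        rw [div_mul_eq_mul_div, mul_div_assoc, ← ha]
        linarith
      · push Not at hex
        refine ⟨0, fun v hv => ?_⟩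
        rw [key v hv (by have := hex v hv; linarith), zero_mul]
    have hmem : lift x w + (-c) • Pi.single (x + 1) 1 ∈ V := by
      refine h.2 _ (finM.add_mem (lift_finM hw) (finM.smul_mem _ (single_finM _))) fun v hv => ?_
      rw [om_add_left (lift_finM hw) (finM.smul_mem _ (single_finM _)), om_smul_left,
        om_single_mid, hc v hv]
      ring
    refine mem_reduceM.2 ⟨_, hmem, ?_, ?_⟩
    · have := lift_eq x w
      simp [this]
    · rw [map_add, contr_lift, map_smul]
      have : contr x (Pi.single (x + 1) 1) = 0 := by
        funext k
        rw [contr_apply, Pi.single_apply, if_neg]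
        · rfl
        · unfold gapIn; split_ifs <;> omega
      rw [this, smul_zero, add_zero]

/-- The unit function at `x + 1` belongs to the expansion, so orthogonality to it yields the
equation between `x` and `x + 2`; the rest is `om_contr`. -/
theorem Cois.expand {V : Submodule ℚ (ℤ → ℚ)} (h : Cois V) (x : ℤ) : Cois (expandM x V) := by
  refine ⟨fun v hv => (mem_expandM.1 hv).2.2, fun w hw hw0 => ?_⟩
  have h1 : w x = w (x + 2) := by
    have := hw0 (Pi.single (x + 1) 1) (mem_expandM.2 ⟨?_, ?_, single_finM _⟩)
    · rw [om_neg_swap, om_single_mid] at this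
      linarith
    · have : contr x (Pi.single (x + 1) 1) = 0 := by
        funext k
        rw [contr_apply, Pi.single_apply, if_neg]
        · rfl
        · unfold gapIn; split_ifs <;> omega
      rw [this]; exact V.zero_mem
    · simp
  refine mem_expandM.2 ⟨h.2 _ (contr_finM hw) fun v hv => ?_, h1, hw⟩
  rw [← contr_lift x v, ← om_contr hw h1 (lift_eq x v)]
  refine hw0 _ (mem_expandM.2 ⟨?_, lift_eq x v, lift_finM (h.1 hv)⟩)
  rwa [contr_lift]

/-- Identifying `x` with `x + 2` can spoil the partner `k` of a dot only if it merges with another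
dot `i`. Then the partner of `i` serves instead. It is not `k` itself: otherwise all of `V` agrees
at `x` and `x + 2`, and coisotropy puts the unit function at `x + 1` into `V`, contrary to the
partner of the dot `x + 1`. -/
theorem Sep.reduce {V : Submodule ℚ (ℤ → ℚ)} {ν : Finset ℤ} {x : ℤ} (hV : Cois V) (h : Sep V ν)
    (hx : x + 1 ∈ ν) : Sep (reduceM x V) (reduceDots x ν) := by
  intro j' hj'
  obtain ⟨j, hj, hj1, rfl⟩ := mem_reduceDots.1 hj'
  obtain ⟨k, hk, hkv⟩ := h j hj
  have hk1 : k ≠ x + 1 := by rintro rfl; exact hk hx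
  have main : ∀ k, k ≠ x + 1 → (∀ v ∈ V, v x = v (x + 2) → v j = v k) →
      gapOut x k ∉ reduceDots x ν →
      ∃ k, k ∉ reduceDots x ν ∧ ∀ v ∈ reduceM x V, v (gapOut x j) = v k := by
    intro k hk1 hkv hk2
    refine ⟨_, hk2, fun v hv => ?_⟩
    obtain ⟨w, hw, hw', rfl⟩ := mem_reduceM.1 hv
    rw [contr_gapOut hw' hj1, contr_gapOut hw' hk1, hkv w hw hw']
  by_cases hin : gapOut x k ∈ reduceDots x ν
  · obtain ⟨i, hi, hi1, hi2⟩ := mem_reduceDots.1 hin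
    have hik : i ≠ k := by rintro rfl; exact hk hi
    have hik' : (i = x ∧ k = x + 2) ∨ (i = x + 2 ∧ k = x) := by
      unfold gapOut at hi2; split_ifs at hi2 <;> omega
    obtain ⟨k₂, hk₂, hk₂v⟩ := h i hi
    have hk₂1 : k₂ ≠ x + 1 := by rintro rfl; exact hk₂ hx
    have hk₂i : k₂ ≠ i := by rintro rfl; exact hk₂ hi
    by_cases hkk : k₂ = k
    · exfalso
      have h1 : ∀ v ∈ V, v x = v (x + 2) := by
        intro v hv
        have := hk₂v v hv
        rw [hkk] at this
        rcases hik' with ⟨h1, h2⟩ | ⟨h1, h2⟩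
        · rwa [h1, h2] at this
        · rw [h1, h2] at this; exact this.symm
      have h2 := hV.single_mem h1
      obtain ⟨k₃, hk₃, hk₃v⟩ := h (x + 1) hx
      have h3 := hk₃v _ h2
      have h4 : k₃ ≠ x + 1 := by rintro rfl; exact hk₃ hx
      simp [h4] at h3
    · refine main k₂ hk₂1 (fun v hv hv' => ?_) ?_
      · rw [hkv v hv, ← hk₂v v hv]
        rcases hik' with ⟨h1, h2⟩ | ⟨h1, h2⟩
        · rw [h1, h2, hv']
        · rw [h1, h2, hv']
      · intro hin2
        obtain ⟨i', hi', hi'1, hi'2⟩ := mem_reduceDots.1 hin2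
        have : i' ≠ k₂ := by rintro rfl; exact hk₂ hi'
        unfold gapOut at hi'2; split_ifs at hi'2 <;> omega
  · exact main k hk1 (fun v hv _ => hkv v hv) hin

/-- The dots determine the closed functions. -/
def Dets (C : CupDiagram) (ν : Finset ℤ) : Prop :=
  ∀ t ∈ closedM C, (∀ k ∈ ν, t k = 0) → t = 0

theorem SmallCup.mem_closedM {C C' : CupDiagram} {x : ℤ} (h : SmallCup C C' x) {v : ℤ → ℚ}
    (hv : v ∈ finM) : v ∈ closedM C ↔ v x = v (x + 2) ∧ contr x v ∈ closedM C' := by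
  rw [KhovanovP.mem_closedM, KhovanovP.mem_closedM, h.closed_iff]
  have h1 : (support v).Finite := hv
  have h2 : (support (contr x v)).Finite := contr_finM hv
  tauto

theorem SmallCup.mem_compatM {C C' : CupDiagram} {x : ℤ} (h : SmallCup C C' x) {v : ℤ → ℚ}
    (hv : v ∈ finM) : v ∈ compatM C ↔ v x = v (x + 2) ∧ contr x v ∈ compatM C' := by
  rw [KhovanovP.mem_compatM, KhovanovP.mem_compatM, h.compat_iff]
  have h1 : (support v).Finite := hv
  have h2 : (support (contr x v)).Finite := contr_finM hv
  tauto

theorem SmallCup.single_mem {C C' : CupDiagram} {x : ℤ} (h : SmallCup C C' x) :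
    Pi.single (x + 1) 1 ∈ closedM C := by
  rw [h.mem_closedM (single_finM _)]
  refine ⟨by simp, ?_⟩
  have : contr x (Pi.single (x + 1) 1) = 0 := by
    funext k
    rw [contr_apply, Pi.single_apply, if_neg]
    · rfl
    · unfold gapIn; split_ifs <;> omega
  rw [this]; exact Submodule.zero_mem _

/-- The unit function at the middle gap of a small cup is closed, so some dot must detect it. -/
theorem Dets.mid_mem {C C' : CupDiagram} {x : ℤ} (h : SmallCup C C' x) {ν : Finset ℤ}
    (hD : Dets C ν) : x + 1 ∈ ν := by
  by_contra hx
  have := hD _ h.single_mem (fun k hk => by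
    rw [Pi.single_apply, if_neg]; rintro rfl; exact hx hk)
  have := congrFun this (x + 1)
  simp at this

theorem Dets.reduce {C C' : CupDiagram} {x : ℤ} (h : SmallCup C C' x) {ν : Finset ℤ}
    (hD : Dets C ν) : Dets C' (reduceDots x ν) := by
  intro t ht h0
  -- The lift is normalised to vanish at the middle gap, so the removed dot imposes no condition.
  obtain ⟨u, hu⟩ : ∃ u, u = lift x t + (-(t x)) • Pi.single (x + 1) 1 := ⟨_, rfl⟩
  have hc : contr x (Pi.single (x + 1) 1) = 0 := by
    funext k
    rw [contr_apply, Pi.single_apply, if_neg]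
    · rfl
    · unfold gapIn; split_ifs <;> omega
  have hcu : contr x u = t := by
    rw [hu, map_add, contr_lift, map_smul, hc, smul_zero, add_zero]
  have hue : u x = u (x + 2) := by
    have := lift_eq x t
    rw [hu]; simp [this]
  have hum : u (x + 1) = 0 := by
    rw [hu]; simp [lift, gapOut]
  have huf : u ∈ finM := by
    rw [hu]; exact finM.add_mem (lift_finM ht.1) (finM.smul_mem _ (single_finM _))
  have hz := hD u ((h.mem_closedM huf).2 ⟨hue, by rwa [hcu]⟩) (fun k hk => by
    by_cases hk1 : k = x + 1
    · rw [hk1, hum]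
    · rw [← contr_gapOut hue hk1, hcu]
      exact h0 _ (mem_reduceDots.2 ⟨k, hk, hk1, rfl⟩))
  rw [← hcu, hz, map_zero]

/-- A space with a state meets the closed functions of a matching diagram trivially. -/
theorem eq_zero_of_state {C : CupDiagram} {V : Submodule ℚ (ℤ → ℚ)} {ν : Finset ℤ} (hV : Cois V)
    (hS : Sep V ν) (hD : Dets C ν) {t : ℤ → ℚ} (h1 : t ∈ V) (h2 : t ∈ closedM C) : t = 0 := by
  obtain ⟨N, hN⟩ : ∃ N, C.endpoints.card = N := ⟨_, rfl⟩
  induction N using Nat.strong_induction_on generalizing C V ν t with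
  | _ N ih =>
    by_cases hC : C = CupDiagram.empty
    · subst hC
      exact eq_zero_of_add_one_eq h2.1 fun x => h2.2 x
    · obtain ⟨C', x, h⟩ := exists_smallCup hC
      have h3 := (h.mem_closedM h2.1).1 h2
      have hx := hD.mid_mem h
      have h4 := ih _ (hN ▸ h.card_lt) (hV.reduce x) (hS.reduce hV hx)
        (hD.reduce h) (mem_reduceM.2 ⟨t, h1, h3.1, rfl⟩) h3.2 rfl
      have h5 : ∀ k, k ≠ x + 1 → t k = 0 := by
        intro k hk
        rw [← contr_gapOut h3.1 hk, h4]; rfl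
      funext k
      by_cases hk : k = x + 1
      · obtain ⟨k', hk', hv⟩ := hS _ hx
        rw [hk, hv t h1, h5]
        · rfl
        · rintro rfl; exact hk' hx
      · exact h5 k hk

/-! ### Passing a middle section -/

/-- The functions above a middle section which extend functions in `V` below it. -/
def passM (V : Submodule ℚ (ℤ → ℚ)) (d : CupDiagram) : Submodule ℚ (ℤ → ℚ) where
  carrier := {q | q ∈ compatM d ∧ ∃ p ∈ V, p ∈ compatM d.cap ∧
    ∀ r, d.partner r = r → p (r + 1) = q (r + 1)}
  add_mem' := by
    rintro q q' ⟨h1, p, h2, h3, h4⟩ ⟨h1', p', h2', h3', h4'⟩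
    exact ⟨Submodule.add_mem _ h1 h1', p + p', V.add_mem h2 h2', Submodule.add_mem _ h3 h3',
      fun r hr => by simp [h4 r hr, h4' r hr]⟩
  zero_mem' := ⟨Submodule.zero_mem _, 0, V.zero_mem, Submodule.zero_mem _, fun _ _ => rfl⟩
  smul_mem' := by
    rintro a q ⟨h1, p, h2, h3, h4⟩
    exact ⟨Submodule.smul_mem _ _ h1, a • p, V.smul_mem _ h2, Submodule.smul_mem _ _ h3,
      fun r hr => by simp [h4 r hr]⟩

theorem mem_passM {V : Submodule ℚ (ℤ → ℚ)} {d : CupDiagram} {q : ℤ → ℚ} :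
    q ∈ passM V d ↔ q ∈ compatM d ∧ ∃ p ∈ V, p ∈ compatM d.cap ∧
      ∀ r, d.partner r = r → p (r + 1) = q (r + 1) := Iff.rfl

theorem passM_empty {V : Submodule ℚ (ℤ → ℚ)} (hV : V ≤ finM) : passM V CupDiagram.empty = V := by
  ext q
  rw [mem_passM, compatM_empty, compatM_cap_empty]
  constructor
  · rintro ⟨-, p, hp, -, h⟩
    have : p = q := funext fun k => by
      have := h (k - 1) rfl
      rwa [sub_add_cancel] at this
    rwa [← this]
  · exact fun h => ⟨hV h, q, h, hV h, fun _ _ => rfl⟩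

/-- The cap of `d.cap` that belongs to the small cup at `a` sits one step to the right. So passing
it is a reduction at `a + 1`, and the cup then expands at `a`. -/
theorem passM_smallCup {V : Submodule ℚ (ℤ → ℚ)} (hV : V ≤ finM) {d d' : CupDiagram} {a : ℤ}
    (h : SmallCup d d' a) : passM V d = expandM a (passM (reduceM (a + 1) V) d') := by
  have key : ∀ (p q : ℤ → ℚ) (_ : p (a + 1) = p (a + 3)) (k : ℤ),
      contr (a + 1) p (k + 1) = p (strandIn a k + 1) := by
    intro p q hp k
    rw [contr_apply]
    unfold gapIn strandIn
    by_cases h1 : k < a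
    · rw [if_pos (by omega), if_pos h1]
    · by_cases h2 : k = a
      · rw [if_pos (by omega), if_neg h1, h2, hp]; congr 1; ring
      · rw [if_neg (by omega), if_neg h1]; congr 1; omega
  ext q
  rw [mem_expandM, mem_passM, mem_passM]
  constructor
  · rintro ⟨h1, p, hp, hp2, h3⟩
    have hp2' := (h.cap.mem_compatM (hV hp)).1 hp2
    rw [add_assoc] at hp2'
    have h1' := (h.mem_compatM h1.1).1 h1
    refine ⟨⟨h1'.2, _, mem_reduceM.2 ⟨p, hp, by rw [add_assoc]; exact hp2'.1, rfl⟩, hp2'.2,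
      fun r hr => ?_⟩, h1'.1, h1.1⟩
    rw [key p q hp2'.1, contr_succ]
    exact h3 _ ((h.ray_iff r).2 hr)
  · rintro ⟨⟨h1, p', hp', hp2, h3⟩, h4, h5⟩
    obtain ⟨p, hp, hpe, rfl⟩ := mem_reduceM.1 hp'
    refine ⟨(h.mem_compatM h5).2 ⟨h4, h1⟩, p, hp, (h.cap.mem_compatM (hV hp)).2 ⟨hpe, hp2⟩,
      fun r hr => ?_⟩
    rw [add_assoc] at hpe
    obtain ⟨k, rfl⟩ := exists_strandIn (x := a) (y := r)
      (by rintro rfl; rw [h.cup] at hr; omega) (by rintro rfl; rw [h.cup'] at hr; omega)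
    have := h3 k ((h.ray_iff k).1 hr)
    rwa [key p q hpe, contr_succ] at this

/-- The two shifts compensate each other away from the small cup, so the other dots keep their
positions. The dot at `a + 2`, if present, is new; its value agrees with that at `a`, so `a` or the
partner of the dot at `a` is a partner for it. -/
theorem Sep.expand {W : Submodule ℚ (ℤ → ℚ)} {ν : Finset ℤ} {a : ℤ} (ha : a + 1 ∉ ν)
    (h : Sep W (reduceDots (a + 1) ν)) : Sep (expandM a W) ν := by
  have main : ∀ j ∈ ν, j ≠ a + 1 → j ≠ a + 2 →
      ∃ k, k ∉ ν ∧ ∀ v ∈ expandM a W, v j = v k := by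
    intro j hj hj1 hj2
    have hgj : gapOut (a + 1) j = gapOut a j := by
      unfold gapOut; split_ifs <;> omega
    obtain ⟨k, hk, hkv⟩ := h (gapOut a j)
      (mem_reduceDots.2 ⟨j, hj, by omega, hgj⟩)
    refine ⟨gapIn a k, fun hin => ?_, fun v hv => ?_⟩
    · by_cases hk0 : gapIn a k = a + 2
      · unfold gapIn at hk0; split_ifs at hk0 <;> omega
      · have h1 : gapIn a k ≠ a + 1 := by unfold gapIn; split_ifs <;> omega
        refine hk (mem_reduceDots.2 ⟨gapIn a k, hin, by omega, ?_⟩)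
        unfold gapOut gapIn at *; split_ifs at * <;> omega
    · rw [mem_expandM] at hv
      have := hkv _ hv.1
      rwa [contr_gapOut hv.2.1 hj1, contr_apply] at this
  intro j hj
  have hj1 : j ≠ a + 1 := by rintro rfl; exact ha hj
  by_cases hj2 : j = a + 2
  · by_cases ha' : a ∈ ν
    · obtain ⟨k, hk, hkv⟩ := main a ha' (by omega) (by omega)
      exact ⟨k, hk, fun v hv => by rw [hj2, ← (mem_expandM.1 hv).2.1, hkv v hv]⟩
    · exact ⟨a, ha', fun v hv => by rw [hj2, (mem_expandM.1 hv).2.1]⟩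
  · exact main j hj hj1 hj2

/-- Remove the cups from inside out. The condition on `d` says that every cup has a dot just right
of its right end and none just right of its left end, which is what `Sep.reduce` and `Sep.expand`
need and what survives each step. -/
theorem pass_state {V : Submodule ℚ (ℤ → ℚ)} {ν : Finset ℤ} {d : CupDiagram} (hV : Cois V)
    (hS : Sep V ν) (hd : ∀ a, a < d.partner a → d.partner a + 1 ∈ ν ∧ a + 1 ∉ ν) :
    Cois (passM V d) ∧ Sep (passM V d) ν := by
  obtain ⟨N, hN⟩ : ∃ N, d.endpoints.card = N := ⟨_, rfl⟩
  induction N using Nat.strong_induction_on generalizing d V ν with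
  | _ N ih =>
    by_cases hC : d = CupDiagram.empty
    · subst hC
      rw [passM_empty hV.1]; exact ⟨hV, hS⟩
    · obtain ⟨d', a, h⟩ := exists_smallCup hC
      have ha := hd a (by rw [h.cup]; omega)
      rw [h.cup] at ha
      have hred := hS.reduce (x := a + 1) hV ha.1
      rw [passM_smallCup hV.1 h]
      have hd' : ∀ k, k < d'.partner k → d'.partner k + 1 ∈ reduceDots (a + 1) ν ∧
          k + 1 ∉ reduceDots (a + 1) ν := by
        intro k hk
        have hmono : strandIn a k < strandIn a (d'.partner k) := by
          unfold strandIn; split_ifs <;> omega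
        rw [← h.other] at hmono
        have h3 := hd _ hmono
        rw [h.other] at h3
        constructor
        · refine mem_reduceDots.2 ⟨_, h3.1, ?_, ?_⟩
          · have := strandIn_ne a (d'.partner k); omega
          · unfold gapOut strandIn; split_ifs <;> omega
        · intro hin
          obtain ⟨j, hj, hj1, hj2⟩ := mem_reduceDots.1 hin
          have hj' : j ≠ a + 1 := by rintro rfl; exact ha.2 hj
          have : j = strandIn a k + 1 := by
            unfold gapOut at hj2; unfold strandIn
            split_ifs at hj2 ⊢ <;> omega
          rw [this] at hj
          exact h3.2 hj
      have h12 := ih _ (hN ▸ h.card_lt) (hV.reduce (a + 1)) hred hd' rfl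
      exact ⟨h12.1.expand a, h12.2.expand ha.2⟩

/-! ### The states of a circle diagram -/

/-- Start with all of `finM` and expand once for each cup. -/
theorem cois_compatM (l : CupDiagram) : Cois (compatM l) := by
  obtain ⟨N, hN⟩ : ∃ N, l.endpoints.card = N := ⟨_, rfl⟩
  induction N using Nat.strong_induction_on generalizing l with
  | _ N ih =>
    by_cases hl : l = CupDiagram.empty
    · subst hl
      rw [compatM_empty]; exact ⟨le_rfl, fun w hw _ => hw⟩
    · obtain ⟨l', x, h⟩ := exists_smallCup hl
      have h1 : compatM l = expandM x (compatM l') := by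
        ext v
        rw [mem_expandM]
        constructor
        · intro hv
          have := (h.mem_compatM hv.1).1 hv
          exact ⟨this.2, this.1, hv.1⟩
        · rintro ⟨h1, h2, h3⟩
          exact (h.mem_compatM h3).2 ⟨h2, h1⟩
      rw [h1]
      exact (ih _ (hN ▸ h.card_lt) l' rfl).expand x

/-- A dot at one end of a cup has the same value as the gap at the other end. If that gap carries a
dot too, this dot belongs to an adjacent cup with the same choice of end, and one continues in this
direction until a gap without a dot is reached. -/
theorem sep_compatM {ν : Finset ℤ} {l : CupDiagram} (h : IsNabla ν l) : Sep (compatM l) ν := by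
  obtain ⟨f, hf, hinj, rfl⟩ := h
  have hacr : ∀ b ∈ l.rightEnds, ∀ v ∈ compatM l, v (b + 1) = v (l.partner b) := by
    intro b hb v hv
    have hb := l.mem_rightEnds.1 hb
    have := hv.2 (l.partner b) (by rw [l.invol]; omega)
    rwa [l.invol] at this
  have right : ∀ N : ℕ, ∀ b ∈ l.rightEnds, (l.rightEnds.filter (b < ·)).card = N →
      f b = l.partner b →
      ∃ k, k ∉ l.rightEnds.image f ∧ ∀ v ∈ compatM l, v (l.partner b) = v k := by
    intro N
    induction N using Nat.strong_induction_on with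
    | _ N ih =>
      intro b hb hN hfb
      by_cases hin : b + 1 ∈ l.rightEnds.image f
      · obtain ⟨b', hb', hb'f⟩ := Finset.mem_image.1 hin
        have hlt := l.mem_rightEnds.1 hb
        have hlt' := l.mem_rightEnds.1 hb'
        have hne : b' ≠ b := by rintro rfl; omega
        have h1 : f b' = l.partner b' := (hf b' hb').resolve_right (by omega)
        obtain ⟨k, hk, hkv⟩ := ih _ (by
          rw [← hN]
          refine Finset.card_lt_card ⟨fun y hy => ?_, fun hs => ?_⟩
          · rw [Finset.mem_filter] at hy ⊢; exact ⟨hy.1, by omega⟩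
          · have := hs (Finset.mem_filter.2 ⟨hb', by omega⟩)
            rw [Finset.mem_filter] at this
            omega) b' hb' rfl h1
        exact ⟨k, hk, fun v hv => by rw [← hacr b hb v hv, ← hb'f, h1, hkv v hv]⟩
      · exact ⟨b + 1, hin, fun v hv => (hacr b hb v hv).symm⟩
  have left : ∀ N : ℕ, ∀ b ∈ l.rightEnds, (l.rightEnds.filter (· < b)).card = N →
      f b = b + 1 →
      ∃ k, k ∉ l.rightEnds.image f ∧ ∀ v ∈ compatM l, v (b + 1) = v k := by
    intro N
    induction N using Nat.strong_induction_on with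
    | _ N ih =>
      intro b hb hN hfb
      by_cases hin : l.partner b ∈ l.rightEnds.image f
      · obtain ⟨b', hb', hb'f⟩ := Finset.mem_image.1 hin
        have hlt := l.mem_rightEnds.1 hb
        have hlt' := l.mem_rightEnds.1 hb'
        have hne : b' ≠ b := by rintro rfl; omega
        have h1 : f b' = b' + 1 := (hf b' hb').resolve_left (fun e => hne (by
          rw [e] at hb'f; exact l.partner_injective hb'f))
        obtain ⟨k, hk, hkv⟩ := ih _ (by
          rw [← hN]
          refine Finset.card_lt_card ⟨fun y hy => ?_, fun hs => ?_⟩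
          · rw [Finset.mem_filter] at hy ⊢; exact ⟨hy.1, by omega⟩
          · have := hs (Finset.mem_filter.2 ⟨hb', by omega⟩)
            rw [Finset.mem_filter] at this
            omega) b' hb' rfl h1
        exact ⟨k, hk, fun v hv => by rw [hacr b hb v hv, ← hb'f, h1, hkv v hv]⟩
      · exact ⟨l.partner b, hin, fun v hv => hacr b hb v hv⟩
  intro i hi
  obtain ⟨b, hb, rfl⟩ := Finset.mem_image.1 hi
  rcases hf b hb with h1 | h1
  · rw [h1]; exact right _ b hb rfl h1
  · rw [h1]; exact left _ b hb rfl h1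

/-! ### Regions below caps and `Δ`-orientations -/

namespace CupDiagram
variable {c : CupDiagram}

/-- Move to the right over the nested cups, staying in the same region, until the right end of the
arc is reached. -/
theorem Closed.eq_of_inner {p : ℤ → ℚ} (hp : c.Closed p) {b x : ℤ} (hb : b ∈ c.rightEnds)
    (h : c.Inner b x) : p x = p b := by
  obtain ⟨N, hN⟩ : ∃ N : ℕ, b = x + N := ⟨(b - x).toNat, by have := h.1.2; omega⟩
  induction N using Nat.strong_induction_on generalizing x with
  | _ N ih =>
    by_cases hx : x = b
    · rw [hx]
    · have h1 := h.1.2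
      have h2 := c.nested' (b := b) (k := x) h.1.1 (by omega)
      have h3 : x < c.partner x := by
        by_contra h4
        have := h.2 x (c.mem_rightEnds.2 (by omega)) ⟨by omega, le_rfl⟩
        omega
      rw [← hp x]
      exact ih (b - (c.partner x + 1)).toNat (by omega) ((c.inner_step hb).2 h) (by omega)

theorem exists_inner {x : ℤ} (h : ¬ c.Outer x) : ∃ b ∈ c.rightEnds, c.Inner b x := by
  classical
  rw [outer_iff] at h
  push Not at h
  obtain ⟨b, hb, hbx⟩ := h
  obtain ⟨b₀, hb₀, hmin⟩ := Finset.exists_min_image (c.rightEnds.filter (fun b => Under c b x)) id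
    ⟨b, Finset.mem_filter.2 ⟨hb, hbx⟩⟩
  rw [Finset.mem_filter] at hb₀
  exact ⟨b₀, hb₀.1, hb₀.2, fun b' hb' h' => hmin b' (Finset.mem_filter.2 ⟨hb', h'⟩)⟩

theorem Inner.unique {b b' x : ℤ} (hb : b ∈ c.rightEnds) (hb' : b' ∈ c.rightEnds)
    (h : c.Inner b x) (h' : c.Inner b' x) : b = b' :=
  le_antisymm (h.2 _ hb' h'.1) (h'.2 _ hb h.1)

theorem inner_iff {b x : ℤ} :
    c.Inner b x ↔ Under c b x ∧ ∀ b' ∈ c.rightEnds, b' ≠ b → Under c b' x →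
      c.partner b' < c.partner b ∧ b < b' := by
  refine and_congr_right fun h => forall₂_congr fun b' hb' => ?_
  constructor
  · intro h1 hne hu
    have h2 := h1 hu
    have h3 := hu.1
    have h4 := h.2
    have := c.nested' (b := b') (k := b) (by omega) (by omega)
    omega
  · intro h1 hu
    by_cases hne : b' = b
    · omega
    · have := h1 hne hu; omega

end CupDiagram

theorem closedM_eq_zero {c : CupDiagram} {p : ℤ → ℚ} (hp : p ∈ closedM c)
    (h : ∀ b ∈ c.rightEnds, p b = 0) : p = 0 := by
  funext x
  by_cases hx : c.Outer x
  · exact hp.2.outer_zero hp.1 hx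
  · obtain ⟨b, hb, hbx⟩ := exists_inner hx
    rw [hp.2.eq_of_inner hb hbx, h b hb]; rfl

/-- The condition on the other caps says that the integer lies in the region just below its own cap;
since these regions are disjoint, distinctness is automatic. -/
theorem isDelta_iff {ν : Finset ℤ} {m : CupDiagram} : IsDelta ν m ↔
    ∃ f : ℤ → ℤ, (∀ b ∈ m.cap.rightEnds, m.cap.Inner b (f b)) ∧ m.cap.rightEnds.image f = ν := by
  constructor
  · rintro ⟨f, h1, -, h2⟩
    exact ⟨f, fun b hb => inner_iff.2 (h1 b hb), h2⟩
  · rintro ⟨f, h1, h2⟩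
    refine ⟨f, fun b hb => inner_iff.1 (h1 b hb), fun b hb b' hb' h => ?_, h2⟩
    exact Inner.unique hb hb' (h1 b hb) (h ▸ h1 b' hb')

theorem dets_of_isDelta {ν : Finset ℤ} {m : CupDiagram} (h : IsDelta ν m) : Dets m.cap ν := by
  obtain ⟨f, hf, rfl⟩ := isDelta_iff.1 h
  intro t ht h0
  refine closedM_eq_zero ht fun b hb => ?_
  rw [← ht.2.eq_of_inner hb (hf b hb)]
  exact h0 _ (Finset.mem_image_of_mem f hb)

theorem isDelta_dots (c : CupDiagram) : IsDelta (dots c) c :=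
  isDelta_iff.2 ⟨id, fun b hb => (c.cap.inner_self hb).2 rfl, by
    rw [Finset.image_id, rightEnds_cap]; rfl⟩

theorem isNabla_dots (c : CupDiagram) : IsNabla (dots c) c :=
  ⟨fun b => b + 1, fun b _ => Or.inr rfl, fun _ _ _ _ h => by simpa using h, rfl⟩

theorem pairInj_of_state {ν : Finset ℤ} {l m : CupDiagram} (h1 : IsNabla ν l)
    (h2 : IsDelta ν m) : PairInj l m :=
  pairInj_of fun _ hp hp' =>
    eq_zero_of_state (cois_compatM l) (sep_compatM h1) (dets_of_isDelta h2) hp hp'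

theorem pairInj_self (l : CupDiagram) : PairInj l l :=
  pairInj_of_state (isNabla_dots l) (isDelta_dots l)

theorem CupDiagram.IsSub.mem_rightEnds {d c : CupDiagram} (h : d.IsSub c) {b : ℤ} (hb : b ∈ d.rightEnds) :
    b ∈ c.rightEnds := by
  rw [CupDiagram.mem_rightEnds] at hb ⊢
  rcases h b with h1 | h1 <;> omega

theorem CupDiagram.IsSub.dots_subset {d c : CupDiagram} (h : d.IsSub c) : dots d ⊆ dots c :=
  Finset.image_subset_image fun _ hb => h.mem_rightEnds hb

theorem eq_zero_of_isSub {ν : Finset ℤ} {l d : CupDiagram} (h : IsNabla ν l) (hd : dots d ⊆ ν)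
    {p : ℤ → ℚ} (h1 : p ∈ compatM l) (h2 : p ∈ closedM d.cap) : p = 0 :=
  eq_zero_of_state (cois_compatM l) ((sep_compatM h).mono hd) (dets_of_isDelta (isDelta_dots d))
    h1 h2

/-- The product of the basis elements belonging to a common state. -/
theorem prodInj_of_state {l N m : CupDiagram} (h1 : IsNabla (dots N) l)
    (h2 : IsDelta (dots N) m) : ProdInj l N m := by
  intro d hd p q hp hp' hq hq' hpq
  -- A left endpoint of a cup of `N` is never a right endpoint, so the dots of `N` meet the
  -- condition of `pass_state` for each subdiagram.
  have hdots : ∀ a, a < d.partner a → d.partner a + 1 ∈ dots N ∧ a + 1 ∉ dots N := by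
    intro a ha
    have h3 : d.partner a = N.partner a := (hd a).resolve_left (by omega)
    constructor
    · refine Finset.mem_image_of_mem _ (N.mem_rightEnds.2 ?_)
      rw [h3, N.invol]; omega
    · intro h
      obtain ⟨b, hb, hba⟩ := Finset.mem_image.1 h
      rw [N.mem_rightEnds] at hb
      have : b = a := by omega
      subst this; omega
  have hst := pass_state (cois_compatM l) (sep_compatM h1) hdots
  have hq0 : q = 0 := eq_zero_of_state hst.1 hst.2 (dets_of_isDelta h2)
    (mem_passM.2 ⟨hq, p, hp, hp', fun r hr => by
      rw [exists_hat_eq hr p, exists_hat_eq hr q, hpq]⟩) hq'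
  subst hq0
  exact ⟨eq_zero_of_isSub h1 hd.dots_subset hp (closed_cap_of_hat_zero hp' hpq), rfl⟩

theorem CupDiagram.IsSub.partner_of_ray {d c : CupDiagram} (h : d.IsSub c) {x : ℤ} (hx : d.partner x = x) :
    d.partner (c.partner x) = c.partner x := by
  by_contra h1
  have h2 := (h (c.partner x)).resolve_left h1
  rw [c.invol] at h2
  have h3 : c.partner x = x := by
    have := congrArg d.partner h2
    rwa [d.invol, hx] at this
  rw [h3] at h1
  exact h1 hx

/-- Since `d` is part of `l`, the lower function is also compatible with `d` and agrees with the
upper one on both sides of each ray of `d`. Hence the upper function is compatible with all of `l`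
and solves the system of `l` and `m`. -/
theorem prodInj_left_unit {l m : CupDiagram} (h : PairInj l m) : ProdInj l l m := by
  intro d hd p q hp hp' hq hq' hpq
  have hpd : d.Compat p := fun x hx => by
    have h1 := (hd x).resolve_left hx
    rw [h1]; exact hp.2 x (by rwa [← h1])
  have h1 : ∀ x, d.partner x = x → p (x + 1) = q (x + 1) := fun x hx => by
    rw [exists_hat_eq hx p, exists_hat_eq hx q, hpq]
  have h2 : ∀ x, d.partner x = x → p x = q x := fun x hx => by
    rw [← d.ray_straight hx, hpd.ray_left, hq.2.ray_left]; exact hpq _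
  have hql : q ∈ compatM l := by
    refine ⟨hq.1, fun x hx => ?_⟩
    by_cases hxd : d.partner x = x
    · rw [← h1 _ (hd.partner_of_ray hxd), ← h2 x hxd]; exact hp.2 x hx
    · rw [← (hd x).resolve_left hxd]; exact hq.2 x hxd
  have hq0 := h.eq_zero hql hq'
  subst hq0
  exact ⟨eq_zero_of_isSub (isNabla_dots l) hd.dots_subset hp (closed_cap_of_hat_zero hp' hpq), rfl⟩

/-- Dually, the lower function is closed for all of `m.cap`, so it vanishes; the upper function then
solves the system of `m` with itself. -/
theorem prodInj_right_unit {l m : CupDiagram} (h : PairInj l m) : ProdInj l m m := by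
  intro d hd p q hp hp' hq hq' hpq
  have hqd : d.cap.Compat q := compat_cap.2 fun x hx => by
    have h1 := (hd x).resolve_left hx
    rw [h1]; exact (closed_cap.1 hq'.2) x
  have h1 : ∀ x, d.partner x = x → p (x + 1) = q (x + 1) := fun x hx => by
    rw [exists_hat_eq hx p, exists_hat_eq hx q, hpq]
  have h2 : ∀ x, d.partner x = x → p (x + 1 + 1) = q (x + 1 + 1) := fun x hx => by
    rw [← d.ray_straight hx, add_assoc, show (1 : ℤ) + 1 = 2 from rfl, hp'.2.ray_left_cap,
      hqd.ray_left_cap]; exact hpq _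
  have hpm : p ∈ closedM m.cap := by
    refine ⟨hp.1, closed_cap.2 fun x => ?_⟩
    by_cases hxd : d.partner x = x
    · show p (m.partner x + 1 + 1) = p (x + 1)
      rw [h2 _ (hd.partner_of_ray hxd), h1 x hxd]; exact (closed_cap.1 hq'.2) x
    · rw [← (hd x).resolve_left hxd]; exact (compat_cap.1 hp'.2) x hxd
  have hp0 := h.eq_zero hp hpm
  subst hp0
  have hqc := closed_of_hat_zero hq fun k => (hpq k).symm
  have hqm : q ∈ compatM m := by
    refine ⟨hq.1, fun x hx => ?_⟩
    by_cases hxd : d.partner x = x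
    · have h3 := h1 _ (hd.partner_of_ray hxd)
      have h4 := h1 x hxd
      have h5 := hqc.2 x
      rw [hxd] at h5
      rw [← h3, ← h5, ← h4]; rfl
    · rw [← (hd x).resolve_left hxd]; exact hq.2 x hxd
  exact ⟨rfl, (pairInj_self m).eq_zero hqm hq'⟩

/-! ### Existence and uniqueness of the state of a circle diagram -/

/-- A vector in the kernel combines the functions `reg` to a closed function without jumps across
the cups of `l`. -/
theorem det_across_ne_zero {l m : CupDiagram} (hn : l.numCups = m.numCups) (h : PairInj l m)
    (e : l.rightEnds ≃ m.cap.rightEnds) :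
    (Matrix.of fun b b' : l.rightEnds => across l (m.cap.reg (e b')) b).det ≠ 0 := by
  intro hdet
  obtain ⟨v, hv, hv0⟩ := Matrix.exists_mulVec_eq_zero_iff.2 hdet
  apply hv
  have hinj := (across_bijective (hn.trans m.numCups_cap.symm) h).1
  have h1 : ∑ r : m.cap.rightEnds, v (e.symm r) •
      (⟨m.cap.reg r, m.cap.reg_mem r.2⟩ : closedM m.cap) = 0 := by
    apply hinj
    rw [map_zero, map_sum]
    funext b
    have := congrFun hv0 b
    rw [← e.sum_comp]
    simp only [Matrix.mulVec, dotProduct, Matrix.of_apply, Pi.zero_apply] at this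
    simp only [map_smul, LinearMap.comp_apply, Submodule.subtype_apply, Finset.sum_apply,
      Pi.smul_apply, smul_eq_mul, Equiv.symm_apply_apply, Pi.zero_apply]
    rw [← this]
    exact Finset.sum_congr rfl fun b' _ => mul_comm _ _
  have h2 := Fintype.linearIndependent_iff.1 m.cap.reg_independent _ h1
  funext b
  have := h2 (e b)
  rwa [e.symm_apply_apply] at this

/-- A state: each cup chooses the gap at one of its ends, so that each region below a cap contains
one of the gaps. -/
theorem state_iff {l m : CupDiagram} {ν : Finset ℤ} (hn : l.numCups = m.numCups) :
    IsNabla ν l ∧ IsDelta ν m ↔ ∃ (f : l.rightEnds → ℤ) (σ : l.rightEnds ≃ m.cap.rightEnds),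
      (∀ b, f b = l.partner b ∨ f b = b + 1) ∧ (∀ b, m.cap.Inner (σ b) (f b)) ∧
      Finset.univ.image f = ν := by
  rw [isDelta_iff]
  constructor
  · rintro ⟨⟨f, hf, hinj, hfν⟩, g, hg, hgν⟩
    have hex : ∀ b : l.rightEnds, ∃ r : m.cap.rightEnds, g r = f b := by
      intro b
      have : f b ∈ m.cap.rightEnds.image g := by
        rw [hgν, ← hfν]; exact Finset.mem_image_of_mem f b.2
      obtain ⟨r, hr, h⟩ := Finset.mem_image.1 this
      exact ⟨⟨r, hr⟩, h⟩
    choose σ hσ using hex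
    have hσinj : Injective σ := by
      intro b b' h
      have := hσ b
      rw [h, hσ] at this
      exact Subtype.ext (hinj b'.2 b.2 this).symm
    have hcard : Fintype.card l.rightEnds = Fintype.card m.cap.rightEnds := by
      rw [Fintype.card_coe, Fintype.card_coe]
      exact hn.trans m.numCups_cap.symm
    refine ⟨fun b => f b, Equiv.ofBijective σ
      ((Fintype.bijective_iff_injective_and_card σ).2 ⟨hσinj, hcard⟩), fun b => hf b b.2,
      fun b => ?_, ?_⟩
    · show m.cap.Inner (σ b) (f b)
      rw [← hσ b]; exact hg _ (σ b).2
    · rw [← hfν]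
      ext x
      simp
  · rintro ⟨f, σ, hf, hσ, rfl⟩
    classical
    have hfinj : Injective f := by
      intro b b' h
      apply σ.injective
      exact Subtype.ext (Inner.unique (σ b).2 (σ b').2 (hσ b) (h ▸ hσ b'))
    refine ⟨⟨fun b => if h : b ∈ l.rightEnds then f ⟨b, h⟩ else 0, fun b hb => ?_, ?_, ?_⟩,
      fun r => if h : r ∈ m.cap.rightEnds then f (σ.symm ⟨r, h⟩) else 0, fun r hr => ?_, ?_⟩
    · simp only [dif_pos hb]; exact hf ⟨b, hb⟩
    · intro b hb b' hb' h
      rw [Finset.mem_coe] at hb hb'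
      simp only [dif_pos hb, dif_pos hb'] at h
      exact congrArg Subtype.val (hfinj h)
    · ext x
      simp only [Finset.mem_image, Finset.mem_univ, true_and]
      constructor
      · rintro ⟨b, hb, h⟩
        rw [dif_pos hb] at h
        exact ⟨_, h⟩
      · rintro ⟨b, h⟩
        exact ⟨b, b.2, by rw [dif_pos b.2]; exact h⟩
    · simp only [dif_pos hr]
      have := hσ (σ.symm ⟨r, hr⟩)
      rwa [σ.apply_symm_apply] at this
    · ext x
      simp only [Finset.mem_image, Finset.mem_univ, true_and]
      constructor
      · rintro ⟨r, hr, h⟩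
        rw [dif_pos hr] at h
        exact ⟨_, h⟩
      · rintro ⟨b, h⟩
        refine ⟨σ b, (σ b).2, ?_⟩
        rw [dif_pos (σ b).2, Subtype.coe_eta, σ.symm_apply_apply]; exact h

/-- Some term of the Leibniz expansion is nonzero. It matches each cup with a region that contains a
gap at one of its ends, which is a state. -/
theorem exists_state {l m : CupDiagram} (hn : l.numCups = m.numCups) (h : PairInj l m) :
    ∃ ν, IsNabla ν l ∧ IsDelta ν m := by
  classical
  have hcard : Fintype.card l.rightEnds = Fintype.card m.cap.rightEnds := by
    rw [Fintype.card_coe, Fintype.card_coe]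
    exact hn.trans m.numCups_cap.symm
  have e := Fintype.equivOfCardEq hcard
  have hdet := det_across_ne_zero hn h e
  rw [Matrix.det_apply] at hdet
  obtain ⟨π, -, hπ⟩ := Finset.exists_ne_zero_of_sum_ne_zero hdet
  have hπ' : ∀ b, across l (m.cap.reg (e (π.symm b))) b ≠ 0 := by
    intro b hb
    apply hπ
    rw [Finset.prod_eq_zero (Finset.mem_univ (π.symm b)), smul_zero]
    rw [Matrix.of_apply, π.apply_symm_apply, hb]
  refine ⟨_, (state_iff hn).2
    ⟨fun b => if m.cap.Inner (e (π.symm b)) (b + 1) then b + 1 else l.partner b,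
    π.symm.trans e, fun b => ?_, fun b => ?_, rfl⟩⟩
  · by_cases h1 : m.cap.Inner (e (π.symm b)) (b + 1)
    · right; exact if_pos h1
    · left; exact if_neg h1
  · simp only [Equiv.trans_apply]
    split_ifs with h1
    · exact h1
    · by_contra h2
      apply hπ' b
      rw [across_apply, reg, reg, if_neg h1, if_neg h2, sub_zero]

/-- Consider the cups where two states differ. Their rows have entries 1 and -1 in columns of the
same set and zeros elsewhere, so they form a block whose rows sum to zero, and the whole matrix
would be singular. -/
theorem state_unique {l m : CupDiagram} (hn : l.numCups = m.numCups) {ν ν' : Finset ℤ}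
    (h1 : IsNabla ν l) (h2 : IsDelta ν m) (h1' : IsNabla ν' l) (h2' : IsDelta ν' m) : ν = ν' := by
  classical
  have h := pairInj_of_state h1 h2
  obtain ⟨f, σ, hf, hσ, rfl⟩ := (state_iff hn).1 ⟨h1, h2⟩
  obtain ⟨f', σ', hf', hσ', rfl⟩ := (state_iff hn).1 ⟨h1', h2'⟩
  by_contra hne
  have hff : ∃ b, f b ≠ f' b := by
    by_contra hcon
    push Not at hcon
    exact hne (by rw [funext hcon])
  have hsame : ∀ b, f b = f' b → σ b = σ' b := fun b hb =>
    Subtype.ext (Inner.unique (σ b).2 (σ' b).2 (hσ b) (hb ▸ hσ' b))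
  obtain ⟨b₀, hb₀⟩ := hff
  let D := {b // f b ≠ f' b}
  have : Nonempty D := ⟨⟨b₀, hb₀⟩⟩
  have hreg : ∀ (b r : l.rightEnds), m.cap.reg (σ r) (f b) = if r = b then 1 else 0 := by
    intro b r
    by_cases hrb : r = b
    · rw [if_pos hrb, reg, if_pos (hrb ▸ hσ b)]
    · rw [if_neg hrb, reg, if_neg]
      exact fun hh => hrb (σ.injective (Subtype.ext (Inner.unique (σ r).2 (σ b).2 hh (hσ b))))
  have hreg' : ∀ (b r : l.rightEnds), m.cap.reg (σ r) (f' b) =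
      if r = σ.symm (σ' b) then 1 else 0 := by
    intro b r
    by_cases hrb : r = σ.symm (σ' b)
    · rw [if_pos hrb, reg, if_pos]
      rw [hrb, σ.apply_symm_apply]; exact hσ' b
    · rw [if_neg hrb, reg, if_neg]
      exact fun hh => hrb (by
        rw [Equiv.eq_symm_apply]
        exact Subtype.ext (Inner.unique (σ r).2 (σ' b).2 hh (hσ' b)))
  have hmem : ∀ b : D, f (σ.symm (σ' b)) ≠ f' (σ.symm (σ' b)) := by
    intro b hb
    have h3 := hsame _ hb
    rw [σ.apply_symm_apply] at h3
    have h4 := σ'.injective h3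
    rw [← h4] at hb
    exact b.2 hb
  have hrow : ∀ b : D, (∀ r, across l (m.cap.reg (σ r)) b =
      (if r = b then 1 else 0) - (if r = σ.symm (σ' b) then 1 else 0)) ∨
      (∀ r, across l (m.cap.reg (σ r)) b =
      (if r = σ.symm (σ' b) then 1 else 0) - (if r = b then 1 else 0)) := by
    intro b
    simp only [across_apply, ← hreg b.1, ← hreg' b.1]
    rcases hf b with h3 | h3 <;> rcases hf' b with h4 | h4
    · exact absurd (h3.trans h4.symm) b.2
    · right; intro r; rw [h3, h4]
    · left; intro r; rw [h3, h4]
    · exact absurd (h3.trans h4.symm) b.2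
  have hA : (Matrix.of fun b b' : D => across l (m.cap.reg (σ b')) b).det = 0 := by
    refine Matrix.exists_mulVec_eq_zero_iff.1 ⟨1, one_ne_zero, ?_⟩
    funext b
    simp only [Matrix.mulVec, dotProduct, Matrix.of_apply, Pi.one_apply, mul_one, Pi.zero_apply]
    have h3 : ∑ r : D, (if r.1 = b.1 then (1 : ℚ) else 0) = 1 := by
      rw [Finset.sum_eq_single b]
      · simp
      · intro r _ hr; exact if_neg fun hh => hr (Subtype.ext hh)
      · simp
    have h4 : ∑ r : D, (if r.1 = σ.symm (σ' b) then (1 : ℚ) else 0) = 1 := by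
      rw [Finset.sum_eq_single ⟨σ.symm (σ' b), hmem b⟩]
      · simp
      · intro r _ hr; exact if_neg fun hh => hr (Subtype.ext hh)
      · simp
    rcases hrow b with h5 | h5
    · simp only [h5, Finset.sum_sub_distrib, h3, h4, sub_self]
    · simp only [h5, Finset.sum_sub_distrib, h3, h4, sub_self]
  -- The rows of `D` vanish outside the columns of `D`, so a left kernel vector of the block extends
  -- by zero to the whole matrix.
  obtain ⟨y, hy, hy0⟩ := Matrix.exists_vecMul_eq_zero_iff.2 hA
  refine det_across_ne_zero hn h σ (Matrix.exists_vecMul_eq_zero_iff.1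
    ⟨fun b => if hb : f b ≠ f' b then y ⟨b, hb⟩ else 0, fun hz => hy ?_, ?_⟩)
  · funext b
    have := congrFun hz b.1
    simp only [dif_pos b.2] at this
    exact this
  · funext r
    simp only [Matrix.vecMul, dotProduct, Matrix.of_apply, Pi.zero_apply]
    have hsum : ∑ b : l.rightEnds, (if hb : f b ≠ f' b then y ⟨b, hb⟩ else 0) *
        across l (m.cap.reg (σ r)) b = ∑ b : D, y b * across l (m.cap.reg (σ r)) b := by
      symm
      refine Fintype.sum_of_injective Subtype.val Subtype.val_injective _ _ (fun b hb => ?_)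
        fun b => ?_
      · rw [dif_neg, zero_mul]
        exact fun hb' => hb ⟨⟨b, hb'⟩, rfl⟩
      · rw [dif_pos b.2]
    rw [hsum]
    by_cases hr : f r ≠ f' r
    · exact congrFun hy0 ⟨r, hr⟩
    · refine Finset.sum_eq_zero fun b _ => ?_
      have h3 : r ≠ b := fun e => hr (e ▸ b.2)
      have h4 : r ≠ σ.symm (σ' b) := fun e => hr (e ▸ hmem b)
      rcases hrow b with h5 | h5 <;> rw [h5, if_neg h3, if_neg h4] <;> simp

/-! ### Weights -/

theorem strandIn_lt (x : ℤ) {a b : ℤ} : strandIn x a < strandIn x b ↔ a < b := by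
  unfold strandIn; split_ifs <;> omega

theorem SmallCup.rightEnds {C C' : CupDiagram} {x : ℤ} (h : SmallCup C C' x) (k : ℤ) :
    strandIn x k ∈ C.rightEnds ↔ k ∈ C'.rightEnds := by
  rw [mem_rightEnds, mem_rightEnds, h.other, strandIn_lt]

theorem SmallCup.succ_mem {C C' : CupDiagram} {x : ℤ} (h : SmallCup C C' x) :
    x + 1 ∈ C.rightEnds := by
  rw [mem_rightEnds, h.cup']; omega

theorem SmallCup.not_mem {C C' : CupDiagram} {x : ℤ} (h : SmallCup C C' x) : x ∉ C.rightEnds := by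
  rw [mem_rightEnds, h.cup]; omega

/-- A small cup is visible in the set of right endpoints, as an element whose predecessor is
missing. It is therefore a small cup of both diagrams and can be removed from both. -/
theorem rightEnds_injective : Injective CupDiagram.rightEnds := by
  intro c c' hcc
  obtain ⟨N, hN⟩ : ∃ N, c.endpoints.card = N := ⟨_, rfl⟩
  induction N using Nat.strong_induction_on generalizing c c' with
  | _ N ih =>
    by_cases hc : c = CupDiagram.empty
    · subst hc
      by_contra hne
      obtain ⟨_, x, h⟩ := exists_smallCup (Ne.symm hne)
      have h1 := h.succ_mem
      rw [← hcc, mem_rightEnds] at h1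
      exact lt_irrefl _ h1
    · obtain ⟨d, x, h⟩ := exists_smallCup hc
      have h1 := h.succ_mem
      have h2 := h.not_mem
      rw [hcc, mem_rightEnds] at h1 h2
      have h3 : c'.partner (x + 1) = x := by
        by_contra h3
        have := c'.nested' (b := x + 1) (k := x) (by omega) (by omega)
        omega
      obtain ⟨d', h'⟩ := exists_smallCup_of (C := c') (x := x) (by rw [← h3, c'.invol, h3])
      have hd : d = d' := by
        refine ih _ (hN ▸ h.card_lt) ?_ rfl
        ext k
        rw [← h.rightEnds, ← h'.rightEnds, hcc]
      subst hd
      ext y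
      by_cases hy1 : y = x
      · rw [hy1, h.cup, h'.cup]
      · by_cases hy2 : y = x + 1
        · rw [hy2, h.cup', h'.cup']
        · obtain ⟨k, rfl⟩ := exists_strandIn hy1 hy2
          rw [h.other, h'.other]

/-- Insertion of a small cup. -/
theorem exists_insert (C' : CupDiagram) (x : ℤ) : ∃ C, SmallCup C C' x := by
  let out : ℤ → ℤ := fun y => if y < x then y else y - 2
  have hout : ∀ k, out (strandIn x k) = k := by
    intro k; simp only [out]; unfold strandIn; split_ifs <;> omega
  let f : ℤ → ℤ := fun y =>
    if y = x then x + 1 else if y = x + 1 then x else strandIn x (C'.partner (out y))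
  have hf1 : f x = x + 1 := by simp [f]
  have hf2 : f (x + 1) = x := by simp [f]
  have hf3 : ∀ k, f (strandIn x k) = strandIn x (C'.partner k) := by
    intro k
    have := strandIn_ne x k
    simp only [f]
    rw [if_neg this.1, if_neg this.2, hout]
  have hcase : ∀ y, y = x ∨ y = x + 1 ∨ ∃ k, strandIn x k = y := by
    intro y
    by_cases h1 : y = x
    · exact Or.inl h1
    · by_cases h2 : y = x + 1
      · exact Or.inr (Or.inl h2)
      · exact Or.inr (Or.inr (exists_strandIn h1 h2))
  refine ⟨⟨f, fun y => ?_, ?_, ?_⟩, hf1, hf3⟩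
  · rcases hcase y with rfl | rfl | ⟨k, rfl⟩
    · rw [hf1, hf2]
    · rw [hf2, hf1]
    · rw [hf3, hf3, C'.invol]
  · refine ((C'.finite_cups.image (strandIn x)).union (Set.toFinite {x, x + 1})).subset
      fun y hy => ?_
    rcases hcase y with h | h | ⟨k, rfl⟩
    · right; simp [h]
    · right; simp [h]
    · left
      refine ⟨k, fun e => hy ?_, rfl⟩
      rw [hf3, e]
  · intro i k h1 h2
    rcases hcase i with rfl | rfl | ⟨i, rfl⟩
    · omega
    · omega
    · rw [hf3] at h2 ⊢
      rcases hcase k with rfl | rfl | ⟨k, rfl⟩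
      · rw [hf1]
        have := strandIn_ne k (C'.partner i)
        omega
      · rw [hf2]
        have := strandIn_ne x i
        omega
      · rw [strandIn_lt] at h1 h2
        have := C'.nested h1 h2
        rw [hf3, strandIn_lt, strandIn_lt]
        exact ⟨fun e => this.1 (strandIn_injective x e), this.2⟩

theorem exists_rightEnds (s : Finset ℤ) : ∃ c : CupDiagram, c.rightEnds = s := by
  obtain ⟨N, hN⟩ : ∃ N, s.card = N := ⟨_, rfl⟩
  induction N generalizing s with
  | zero =>
    refine ⟨CupDiagram.empty, ?_⟩
    rw [Finset.card_eq_zero.1 hN]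
    ext x
    rw [mem_rightEnds]
    simp [CupDiagram.empty]
  | succ N ih =>
    have hne : s.Nonempty := Finset.card_pos.1 (by omega)
    -- The predecessor of the smallest element is free, so the last cup inserted may join it to `b`.
    obtain ⟨b, hb, hmin⟩ := Finset.exists_min_image s id hne
    obtain ⟨t, ht⟩ : ∃ t : Finset ℤ, t = s.preimage (strandIn (b - 1)) (strandIn_injective _).injOn :=
      ⟨_, rfl⟩
    have hts : t.map ⟨strandIn (b - 1), strandIn_injective _⟩ = s.erase b := by
      ext y
      simp only [Finset.mem_map, Function.Embedding.coeFn_mk, Finset.mem_erase, ht,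
        Finset.mem_preimage]
      constructor
      · rintro ⟨k, hk, rfl⟩
        have := strandIn_ne (b - 1) k
        exact ⟨by omega, hk⟩
      · rintro ⟨h1, h2⟩
        have := hmin y h2
        simp only [id] at this
        obtain ⟨k, rfl⟩ := exists_strandIn (x := b - 1) (y := y) (by omega) (by omega)
        exact ⟨k, h2, rfl⟩
    obtain ⟨c', hc'⟩ := ih t (by
      rw [← Finset.card_map, hts, Finset.card_erase_of_mem hb, hN]; rfl)
    obtain ⟨c, h⟩ := exists_insert c' (b - 1)
    refine ⟨c, ?_⟩
    ext y
    by_cases h1 : y = b - 1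
    · subst h1
      refine iff_of_false h.not_mem fun hin => ?_
      have := hmin _ hin
      simp only [id] at this
      omega
    · by_cases h2 : y = b - 1 + 1
      · subst h2
        exact iff_of_true h.succ_mem (by rwa [sub_add_cancel])
      · obtain ⟨k, rfl⟩ := exists_strandIn h1 h2
        rw [h.rightEnds, hc', ht, Finset.mem_preimage]

theorem card_dots (c : CupDiagram) : (dots c).card = c.numCups :=
  Finset.card_image_of_injective _ fun _ _ h => by simpa using h

theorem dots_injective : Injective dots := fun _ _ h =>
  rightEnds_injective (Finset.image_injective (fun _ _ h => by simpa using h) h)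

theorem IsNabla.card {ν : Finset ℤ} {l : CupDiagram} (h : IsNabla ν l) : ν.card = l.numCups := by
  obtain ⟨f, -, hinj, rfl⟩ := h
  exact Finset.card_image_of_injOn hinj

/-- Each state is the set of dots of a cup diagram. -/
theorem exists_dots (ν : Finset ℤ) : ∃ c : CupDiagram, dots c = ν := by
  obtain ⟨c, hc⟩ := exists_rightEnds (ν.image (fun k => k - 1))
  refine ⟨c, ?_⟩
  rw [dots, hc, Finset.image_image]
  simp [Function.comp_def]

/-- If the inequality failed at `i`, the elements of `s` up to the `i`-th one would be mapped
injectively to elements of `t` below its `i`-th one, of which there are too few. -/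
theorem orderEmb_le {n : ℕ} {s t : Finset ℤ} (hs : s.card = n) (ht : t.card = n) {g : ℤ → ℤ}
    (hg : ∀ b ∈ s, g b ≤ b) (hst : s.image g = t) (i : Fin n) :
    t.orderEmbOfFin ht i ≤ s.orderEmbOfFin hs i := by
  by_contra hcon
  push Not at hcon
  have h1 : (Finset.univ.filter (· ≤ i)).image (s.orderEmbOfFin hs) ⊆ s := by
    intro x hx
    obtain ⟨j, -, rfl⟩ := Finset.mem_image.1 hx
    exact s.orderEmbOfFin_mem hs j
  have hinj : Set.InjOn g s := Finset.card_image_iff.1 (by rw [hst, hs, ht])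
  have h2 : (((Finset.univ.filter (· ≤ i)).image (s.orderEmbOfFin hs)).image g) ⊆
      (Finset.univ.filter (· < i)).image (t.orderEmbOfFin ht) := by
    intro y hy
    obtain ⟨x, hx, rfl⟩ := Finset.mem_image.1 hy
    have hxs := h1 hx
    obtain ⟨j, hj, rfl⟩ := Finset.mem_image.1 hx
    have hyt : g (s.orderEmbOfFin hs j) ∈ t := hst ▸ Finset.mem_image_of_mem g hxs
    have : g (s.orderEmbOfFin hs j) ∈ Set.range (t.orderEmbOfFin ht) := by
      rw [Finset.range_orderEmbOfFin]; exact hyt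
    obtain ⟨k, hk⟩ := this
    refine Finset.mem_image.2 ⟨k, Finset.mem_filter.2 ⟨Finset.mem_univ _, ?_⟩, hk⟩
    rw [← (t.orderEmbOfFin ht).lt_iff_lt, hk]
    have h3 := hg _ hxs
    have h4 := (s.orderEmbOfFin hs).monotone (Finset.mem_filter.1 hj).2
    exact (h3.trans h4).trans_lt hcon
  have h3 := Finset.card_le_card h2
  rw [Finset.card_image_of_injOn (hinj.mono (by exact_mod_cast h1)),
    Finset.card_image_of_injective _ (s.orderEmbOfFin hs).injective,
    Finset.card_image_of_injective _ (t.orderEmbOfFin ht).injective] at h3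
  have h4 : (Finset.univ.filter (· < i)) ⊂ (Finset.univ.filter (· ≤ i)) :=
    ⟨fun j hj => by
      rw [Finset.mem_filter] at hj ⊢; exact ⟨hj.1, hj.2.le⟩, fun hsub => by
      have := hsub (Finset.mem_filter.2 ⟨Finset.mem_univ i, le_rfl⟩)
      exact lt_irrefl _ (Finset.mem_filter.1 this).2⟩
  exact absurd (Finset.card_lt_card h4) (not_lt.2 h3)

/-! ### The partial order and finiteness -/

section order
variable {n : ℕ}

theorem weightLE_refl (l : Lambda n) : weightLE l l := fun _ => le_rfl

theorem weightLE_trans {l m p : Lambda n} (h1 : weightLE l m) (h2 : weightLE m p) :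
    weightLE l p := fun i => (h2 i).trans (h1 i)

theorem lambda_ext {l m : Lambda n}
    (h : ∀ i, l.1.rightEnds.orderEmbOfFin l.2 i = m.1.rightEnds.orderEmbOfFin m.2 i) : l = m := by
  apply Subtype.ext
  apply rightEnds_injective
  apply Finset.coe_injective
  rw [← Finset.range_orderEmbOfFin l.1.rightEnds l.2, ← Finset.range_orderEmbOfFin m.1.rightEnds m.2,
    funext h]

theorem weightLE_antisymm {l m : Lambda n} (h1 : weightLE l m) (h2 : weightLE m l) : l = m :=
  lambda_ext fun i => le_antisymm (h2 i) (h1 i)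

theorem interval_finite (l m : Lambda n) : {p | weightLE l p ∧ weightLE p m}.Finite := by
  have : Function.Injective (fun (p : Lambda n) (i : Fin n) => p.1.rightEnds.orderEmbOfFin p.2 i) :=
    fun p q h => lambda_ext (congrFun h)
  refine ((Set.finite_Icc (fun i => m.1.rightEnds.orderEmbOfFin m.2 i)
    (fun i => l.1.rightEnds.orderEmbOfFin l.2 i)).preimage this.injOn).subset fun p hp => ?_
  exact ⟨hp.2, hp.1⟩

theorem weightLE_of_isNabla {l m : Lambda n} (h : IsNabla (dots l.1) m.1) : weightLE m l := by
  obtain ⟨f, hf, -, h2⟩ := h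
  refine fun i => orderEmb_le m.2 l.2 (g := fun b => f b - 1) (fun b hb => ?_) ?_ i
  · have h1 := m.1.mem_rightEnds.1 hb
    rcases hf b hb with h | h <;> simp only [h] <;> omega
  · have h3 := congrArg (Finset.image (fun k => k - 1)) h2
    rw [dots, Finset.image_image, Finset.image_image] at h3
    simpa [Function.comp_def] using h3

theorem weightLE_of_isDelta {l m : Lambda n} (h : IsDelta (dots l.1) m.1) : weightLE m l := by
  obtain ⟨f, hf, h2⟩ := isDelta_iff.1 h
  rw [rightEnds_cap] at hf h2
  refine fun i => orderEmb_le m.2 l.2 (g := fun b => f (b + 1) - 1) (fun b hb => ?_) ?_ i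
  · have := (hf (b + 1) (Finset.mem_image_of_mem _ hb)).1.2
    omega
  · have h3 := congrArg (Finset.image (fun k => k - 1)) h2
    rw [dots, Finset.image_image, Finset.image_image, Finset.image_image] at h3
    simpa [Function.comp_def] using h3

/-- Every point below a cup is an endpoint, and there are only `2 * numCups` endpoints. This bounds
the diagrams with a given orientation. -/
theorem le_partner_add (c : CupDiagram) {b : ℤ} (hb : b ∈ c.rightEnds) :
    b ≤ c.partner b + 2 * c.numCups := by
  have h1 : Finset.Icc (c.partner b) b ⊆ c.rightEnds ∪ c.rightEnds.image c.partner := by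
    intro x hx
    rw [Finset.mem_Icc] at hx
    have hb' := c.mem_rightEnds.1 hb
    have hne : c.partner x ≠ x := by
      by_cases h1 : x = c.partner b
      · rw [h1, c.invol]; omega
      · by_cases h2 : x = b
        · rw [h2]; omega
        · exact (c.nested' (b := b) (k := x) (by omega) (by omega)).1
    rw [Finset.mem_union, Finset.mem_image]
    by_cases h3 : c.partner x < x
    · exact Or.inl (c.mem_rightEnds.2 h3)
    · exact Or.inr ⟨c.partner x, c.mem_rightEnds.2 (by rw [c.invol]; omega), c.invol x⟩
  have h2 := (Finset.card_le_card h1).trans (Finset.card_union_le _ _)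
  have h3 : (c.rightEnds.image c.partner).card ≤ c.numCups := Finset.card_image_le
  have h4 : c.rightEnds.card = c.numCups := rfl
  rw [Int.card_Icc] at h2
  omega

theorem finite_of_rightEnds_subset (s : Finset ℤ) : {l : Lambda n | l.1.rightEnds ⊆ s}.Finite := by
  have : Injective fun l : Lambda n => l.1.rightEnds := fun _ _ h =>
    Subtype.ext (rightEnds_injective h)
  refine (s.powerset.finite_toSet.preimage this.injOn).subset fun l hl => ?_
  exact Finset.mem_coe.2 (Finset.mem_powerset.2 hl)

theorem finite_isNabla (ν : Finset ℤ) : {l : Lambda n | IsNabla ν l.1}.Finite := by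
  refine (finite_of_rightEnds_subset
    (ν.biUnion fun k => Finset.Icc (k - 1) (k + 2 * n))).subset fun l hl b hb => ?_
  obtain ⟨f, hf, -, rfl⟩ := hl
  refine Finset.mem_biUnion.2 ⟨f b, Finset.mem_image_of_mem f hb, Finset.mem_Icc.2 ?_⟩
  have h1 := le_partner_add l.1 hb
  have h2 := l.1.mem_rightEnds.1 hb
  rw [l.2] at h1
  have := hf b hb
  omega

theorem finite_isDelta (ν : Finset ℤ) : {m : Lambda n | IsDelta ν m.1}.Finite := by
  refine (finite_of_rightEnds_subset
    (ν.biUnion fun k => Finset.Icc (k - 1) (k + 2 * n))).subset fun m hm b hb => ?_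
  obtain ⟨f, hf, rfl⟩ := isDelta_iff.1 hm
  have hb' : b + 1 ∈ m.1.cap.rightEnds := by
    rw [rightEnds_cap]; exact Finset.mem_image_of_mem _ hb
  refine Finset.mem_biUnion.2 ⟨f (b + 1), Finset.mem_image_of_mem f hb', Finset.mem_Icc.2 ?_⟩
  have h1 := le_partner_add m.1 hb
  have h2 := m.1.mem_rightEnds.1 hb
  have h3 := (hf _ hb').1
  unfold Under at h3
  simp only [CupDiagram.cap, add_sub_cancel_right] at h3
  rw [m.2] at h1
  omega

theorem finite_states_nabla (l : CupDiagram) : {ν | IsNabla ν l}.Finite := by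
  refine (l.rightEnds.biUnion fun b => {l.partner b, b + 1}).powerset.finite_toSet.subset
    fun ν hν => ?_
  obtain ⟨f, hf, -, rfl⟩ := hν
  refine Finset.mem_coe.2 (Finset.mem_powerset.2 fun k hk => ?_)
  obtain ⟨b, hb, rfl⟩ := Finset.mem_image.1 hk
  exact Finset.mem_biUnion.2 ⟨b, hb, by simpa using hf b hb⟩

theorem finite_states_delta (m : CupDiagram) : {ν | IsDelta ν m}.Finite := by
  refine (m.cap.rightEnds.biUnion fun b =>
    Finset.Ioc (m.cap.partner b) b).powerset.finite_toSet.subset fun ν hν => ?_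
  obtain ⟨f, hf, rfl⟩ := isDelta_iff.1 hν
  refine Finset.mem_coe.2 (Finset.mem_powerset.2 fun k hk => ?_)
  obtain ⟨b, hb, rfl⟩ := Finset.mem_image.1 hk
  exact Finset.mem_biUnion.2 ⟨b, hb, Finset.mem_Ioc.2 (hf b hb).1⟩

/-- Every good pair has a state; `l` has finitely many states, and each of them orients finitely
many cap diagrams. -/
theorem finite_pair_left (l : Lambda n) : {m : Lambda n | PairInj l.1 m.1}.Finite := by
  refine ((finite_states_nabla l.1).biUnion fun ν _ => finite_isDelta (n := n) ν).subset
    fun m hm => ?_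
  obtain ⟨ν, h1, h2⟩ := exists_state (l.2.trans m.2.symm) hm
  exact Set.mem_biUnion h1 h2

theorem finite_pair_right (m : Lambda n) : {l : Lambda n | PairInj l.1 m.1}.Finite := by
  refine ((finite_states_delta m.1).biUnion fun ν _ => finite_isNabla (n := n) ν).subset
    fun l hl => ?_
  obtain ⟨ν, h1, h2⟩ := exists_state (l.2.trans m.2.symm) hl
  exact Set.mem_biUnion h2 h1

/-- The state of a circle diagram as a weight. -/
theorem exists_weight {l m : Lambda n} (h : PairInj l.1 m.1) :
    ∃ N : Lambda n, IsNabla (dots N.1) l.1 ∧ IsDelta (dots N.1) m.1 := by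
  obtain ⟨ν, h1, h2⟩ := exists_state (l.2.trans m.2.symm) h
  obtain ⟨c, rfl⟩ := exists_dots ν
  exact ⟨⟨c, by rw [← card_dots, h1.card, l.2]⟩, h1, h2⟩

theorem weight_unique {l m N N' : Lambda n} (h1 : IsNabla (dots N.1) l.1)
    (h2 : IsDelta (dots N.1) m.1) (h1' : IsNabla (dots N'.1) l.1)
    (h2' : IsDelta (dots N'.1) m.1) : N = N' :=
  Subtype.ext (dots_injective (state_unique (l.2.trans m.2.symm) h1 h2 h1' h2'))

end order

/-! ### The algebra -/

section algebra
variable {n : ℕ}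

/-- Basis diagrams of the quotient algebra. -/
def GoodPair (p : Lambda n × Lambda n) : Prop := PairInj p.1.1 p.2.1

theorem goodPair_iff {p : Lambda n × Lambda n} : GoodPair p ↔
    Orientable p.1.1 CupDiagram.empty p.2.1 ∧ ¬ HasNonPropagating p.1.1 CupDiagram.empty p.2.1 :=
  pairInj_iff (p.1.2.trans p.2.2.symm)

theorem circ_mem_nonPropSpan {l m : Lambda n} (h : ¬ GoodPair (l, m)) :
    circ l m ∈ nonPropSpan n := by
  by_cases ho : Orientable l.1 CupDiagram.empty m.1
  · refine Submodule.subset_span ⟨l, m, ho, ?_, rfl⟩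
    by_contra hn
    exact h (goodPair_iff.2 ⟨ho, hn⟩)
  · rw [circ, dif_neg ho]; exact Submodule.zero_mem _

theorem knCirc_eq_zero {l m : Lambda n} (h : ¬ GoodPair (l, m)) : knCirc l m = 0 := by
  rw [knCirc, Submodule.mkQ_apply, Submodule.Quotient.mk_eq_zero]
  exact circ_mem_nonPropSpan h

theorem truncMul_circ {l c c' m : Lambda n} (h1 : Orientable l.1 CupDiagram.empty c.1)
    (h2 : Orientable c'.1 CupDiagram.empty m.1) :
    truncMul n (circ l c) (circ c' m) = circMul (l, c) (c', m) := by
  simp [truncMul, circ, dif_pos h1, dif_pos h2]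

theorem trunc_induction {P : Trunc n → Prop} (h0 : P 0) (hadd : ∀ x y, P x → P y → P (x + y))
    (hsmul : ∀ (a : ℂ) x, P x → P (a • x))
    (hcirc : ∀ l m : Lambda n, Orientable l.1 CupDiagram.empty m.1 → P (circ l m)) (x : Trunc n) :
    P x := by
  induction x using Finsupp.induction_linear with
  | zero => exact h0
  | add x y hx hy => exact hadd x y hx hy
  | single p a =>
    have : Finsupp.single p a = a • circ p.1.1 p.1.2 := by
      rw [circ, dif_pos p.2]; simp
    rw [this]
    exact hsmul _ _ (hcirc _ _ p.2)

/-- Contrapositively, if the product has only propagating lines, `prodInj_of_orientable` makes every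
intermediate diagram good, and both factors are good. -/
theorem circMul_mem {l c c' m : Lambda n} (h : ¬ (GoodPair (l, c) ∧ GoodPair (c', m))) :
    circMul (l, c) (c', m) ∈ nonPropSpan n := by
  unfold circMul
  split_ifs with hc
  · refine circ_mem_nonPropSpan fun hlm => h ?_
    obtain ⟨rfl, hd⟩ : c = c' ∧ _ := hc
    have hp := prodInj_of_orientable (l.2.trans m.2.symm) hlm hd
    exact ⟨hp.pair_left, hp.pair_right (l.2.trans c.2.symm)⟩
  · exact Submodule.zero_mem _

variable (n) in
theorem isTwoSided_nonPropSpan : IsTwoSided (truncMul n) (nonPropSpan n) := by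
  intro a x hx
  refine Submodule.span_induction (p := fun x _ => truncMul n a x ∈ nonPropSpan n ∧
    truncMul n x a ∈ nonPropSpan n) ?_ ?_ ?_ ?_ hx
  · rintro x ⟨c', m, ho, hn, rfl⟩
    have hg : ¬ GoodPair (c', m) := fun h => (goodPair_iff.1 h).2 hn
    refine trunc_induction (P := fun a => truncMul n a (circ c' m) ∈ nonPropSpan n ∧
      truncMul n (circ c' m) a ∈ nonPropSpan n) ?_ ?_ ?_ ?_ a
    · simp
    · intro x y hx hy
      simp only [map_add, LinearMap.add_apply]
      exact ⟨Submodule.add_mem _ hx.1 hy.1, Submodule.add_mem _ hx.2 hy.2⟩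
    · intro r x hx
      simp only [map_smul, LinearMap.smul_apply]
      exact ⟨Submodule.smul_mem _ _ hx.1, Submodule.smul_mem _ _ hx.2⟩
    · intro l c h
      rw [truncMul_circ h ho, truncMul_circ ho h]
      exact ⟨circMul_mem fun h => hg h.2, circMul_mem fun h => hg h.1⟩
  · simp
  · intro x y _ _ hx hy
    simp only [map_add, LinearMap.add_apply]
    exact ⟨Submodule.add_mem _ hx.1 hy.1, Submodule.add_mem _ hx.2 hy.2⟩
  · intro r x _ hx
    simp only [map_smul, LinearMap.smul_apply]
    exact ⟨Submodule.smul_mem _ _ hx.1, Submodule.smul_mem _ _ hx.2⟩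

theorem kn_induction {P : Kn n → Prop} (h0 : P 0) (hadd : ∀ x y, P x → P y → P (x + y))
    (hsmul : ∀ (a : ℂ) x, P x → P (a • x)) (hcirc : ∀ l m : Lambda n, P (knCirc l m)) (x : Kn n) :
    P x := by
  obtain ⟨x, rfl⟩ := (nonPropSpan n).mkQ_surjective x
  refine trunc_induction (P := fun x => P ((nonPropSpan n).mkQ x)) ?_ ?_ ?_ ?_ x
  · rw [map_zero]; exact h0
  · intro x y hx hy; rw [map_add]; exact hadd _ _ hx hy
  · intro a x hx; rw [map_smul]; exact hsmul _ _ hx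
  · intro l m _; exact hcirc l m

open Classical in
/-- The coordinates of an element of the quotient algebra. -/
def knCoord (n : ℕ) : Kn n →ₗ[ℂ] (Lambda n × Lambda n →₀ ℂ) :=
  (nonPropSpan n).liftQ (Finsupp.linearCombination ℂ
    (fun p => if GoodPair p.1 then Finsupp.single p.1 1 else 0)) (by
      rw [nonPropSpan, Submodule.span_le]
      rintro x ⟨l, m, ho, hn, rfl⟩
      have hg : ¬ GoodPair (l, m) := fun h => (goodPair_iff.1 h).2 hn
      simp [circ, dif_pos ho, hg])

theorem knCoord_circ {l m : Lambda n} (h : GoodPair (l, m)) :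
    knCoord n (knCirc l m) = Finsupp.single (l, m) 1 := by
  rw [knCirc, knCoord, Submodule.mkQ_apply, Submodule.liftQ_apply, circ,
    dif_pos (goodPair_iff.1 h).1]
  simp [h]

theorem knCirc_independent :
    LinearIndependent ℂ (fun p : {p : Lambda n × Lambda n // GoodPair p} => knCirc p.1.1 p.1.2) := by
  refine LinearIndependent.of_comp (knCoord n) ?_
  have : (knCoord n) ∘ (fun p : {p : Lambda n × Lambda n // GoodPair p} => knCirc p.1.1 p.1.2) =
      (fun p : Lambda n × Lambda n => Finsupp.single p (1 : ℂ)) ∘ Subtype.val :=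
    funext fun p => knCoord_circ p.2
  rw [this]
  exact (Finsupp.basisSingleOne.linearIndependent (R := ℂ)).comp _ Subtype.val_injective

variable (h : IsTwoSided (truncMul n) (nonPropSpan n))

open Classical in
-- Modulo the ideal, orientability of the intermediate diagrams may be replaced by uniqueness. The
-- resulting rule also covers diagrams that vanish in the quotient, because `ProdInj` forces both
-- factors and the result to be good.
theorem knMul_circ (l c c' m : Lambda n) : knMul n h (knCirc l c) (knCirc c' m) =
    if c = c' ∧ ProdInj l.1 c.1 m.1 then knCirc l m else 0 := by
  by_cases h1 : GoodPair (l, c)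
  · by_cases h2 : GoodPair (c', m)
    · rw [knMul, knCirc, knCirc, quotMul_mk,
        truncMul_circ (goodPair_iff.1 h1).1 (goodPair_iff.1 h2).1]
      by_cases h3 : GoodPair (l, m)
      · unfold circMul
        have : (c = c' ∧ ∀ d : CupDiagram, d.IsSub c.1 → Orientable l.1 d m.1) ↔
            (c = c' ∧ ProdInj l.1 c.1 m.1) :=
          and_congr_right fun _ => ⟨prodInj_of_orientable (l.2.trans m.2.symm) h3,
            fun hp d hd => hp.orientable (l.2.trans m.2.symm) hd⟩
        rw [if_congr this rfl rfl]
        split_ifs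
        · rfl
        · exact map_zero _
      · rw [if_neg fun hp => h3 hp.2.pair, Submodule.mkQ_apply, Submodule.Quotient.mk_eq_zero]
        unfold circMul
        split_ifs
        · exact circ_mem_nonPropSpan h3
        · exact Submodule.zero_mem _
    · rw [knCirc_eq_zero h2, map_zero, if_neg]
      rintro ⟨rfl, hp⟩
      exact h2 (hp.pair_right (l.2.trans c.2.symm))
  · rw [knCirc_eq_zero h1, map_zero, LinearMap.zero_apply, if_neg]
    rintro ⟨rfl, hp⟩
    exact h1 hp.pair_left

open Classical in
theorem knIdem_mul (i l m : Lambda n) :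
    knMul n h (knIdem i) (knCirc l m) = if i = l then knCirc l m else 0 := by
  rw [knIdem, knMul_circ]
  by_cases hil : i = l
  · subst hil
    by_cases hg : GoodPair (i, m)
    · rw [if_pos ⟨rfl, prodInj_left_unit hg⟩, if_pos rfl]
    · rw [knCirc_eq_zero hg]; simp
  · rw [if_neg (fun hp => hil hp.1), if_neg hil]

open Classical in
theorem mul_knIdem (j l m : Lambda n) :
    knMul n h (knCirc l m) (knIdem j) = if m = j then knCirc l m else 0 := by
  rw [knIdem, knMul_circ]
  by_cases hil : m = j
  · subst hil
    by_cases hg : GoodPair (l, m)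
    · rw [if_pos ⟨rfl, prodInj_right_unit hg⟩, if_pos rfl]
    · rw [knCirc_eq_zero hg]; simp
  · rw [if_neg (fun hp => hil hp.1), if_neg hil]

theorem knMul_assoc (a b c : Kn n) :
    knMul n h (knMul n h a b) c = knMul n h a (knMul n h b c) := by
  classical
  induction a using kn_induction with
  | h0 => simp
  | hadd x y hx hy => simp [hx, hy]
  | hsmul r x hx => simp [hx]
  | hcirc a₁ a₂ =>
  induction b using kn_induction with
  | h0 => simp
  | hadd x y hx hy => simp [hx, hy]
  | hsmul r x hx => simp [hx]
  | hcirc b₁ b₂ =>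
  induction c using kn_induction with
  | h0 => simp
  | hadd x y hx hy => simp [hx, hy]
  | hsmul r x hx => simp [hx]
  | hcirc c₁ c₂ =>
  rw [knMul_circ, knMul_circ]
  by_cases h1 : a₂ = b₁
  · by_cases h2 : b₂ = c₁
    · subst h1 h2
      have := prodInj_assoc (l := a₁.1) (c := a₂.1) (c' := b₂.1) (m := c₂.1) (a₁.2.trans a₂.2.symm)
        (a₂.2.trans b₂.2.symm) (b₂.2.trans c₂.2.symm)
      simp only [true_and]
      split_ifs with h3 h4 h4
      · rw [knMul_circ, knMul_circ]
        simp only [true_and]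
        exact if_congr ⟨fun hh => (this.1 ⟨h3, hh⟩).2, fun hh => (this.2 ⟨h4, hh⟩).2⟩ rfl rfl
      · rw [knMul_circ, map_zero, if_neg]
        tauto
      · rw [knMul_circ, map_zero, LinearMap.zero_apply, if_neg]
        tauto
      · simp
    · rw [if_neg (c := b₂ = c₁ ∧ _) (fun hp => h2 hp.1), map_zero]
      split_ifs
      · rw [knMul_circ, if_neg (fun hp => h2 hp.1)]
      · simp
  · rw [if_neg (c := a₂ = b₁ ∧ _) (fun hp => h1 hp.1), map_zero, LinearMap.zero_apply]
    split_ifs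
    · rw [knMul_circ, if_neg (fun hp => h1 hp.1)]
    · simp

theorem peirce_eq (i j : Lambda n) :
    peirce (knMul n h) knIdem i j = Submodule.span ℂ {knCirc i j} := by
  classical
  apply le_antisymm
  · rintro _ ⟨x, rfl⟩
    induction x using kn_induction with
    | h0 => simp
    | hadd x y hx hy => rw [map_add]; exact Submodule.add_mem _ hx hy
    | hsmul r x hx => rw [map_smul]; exact Submodule.smul_mem _ _ hx
    | hcirc l m =>
      simp only [LinearMap.comp_apply, LinearMap.flip_apply, mul_knIdem]
      split_ifs with h1
      · rw [knIdem_mul]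
        split_ifs with h2
        · rw [h1, h2]; exact Submodule.mem_span_singleton_self _
        · exact Submodule.zero_mem _
      · rw [map_zero]; exact Submodule.zero_mem _
  · rw [Submodule.span_singleton_le_iff_mem]
    refine ⟨knCirc i j, ?_⟩
    rw [LinearMap.comp_apply, LinearMap.flip_apply, mul_knIdem, if_pos rfl, knIdem_mul, if_pos rfl]

theorem peirce_isInternal [DecidableEq (Lambda n × Lambda n)] :
    DirectSum.IsInternal (fun p : Lambda n × Lambda n => peirce (knMul n h) knIdem p.1 p.2) := by
  simp only [peirce_eq]
  rw [DirectSum.isInternal_submodule_iff_iSupIndep_and_iSup_eq_top]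
  constructor
  · rw [iSupIndep_def]
    intro p
    rw [Submodule.disjoint_def]
    intro x hx hx'
    by_cases hp : GoodPair p
    · have hle : ⨆ q, ⨆ (_ : q ≠ p), Submodule.span ℂ {knCirc q.1 q.2} ≤
          LinearMap.ker ((Finsupp.lapply p).comp (knCoord n)) := by
        refine iSup₂_le fun q hq => ?_
        rw [Submodule.span_singleton_le_iff_mem, LinearMap.mem_ker, LinearMap.comp_apply]
        by_cases hgq : GoodPair q
        · rw [knCoord_circ hgq, Finsupp.lapply_apply]
          exact Finsupp.single_eq_of_ne (Ne.symm hq)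
        · rw [knCirc_eq_zero hgq, map_zero, map_zero]
      have h0 := hle hx'
      obtain ⟨a, rfl⟩ := Submodule.mem_span_singleton.1 hx
      rw [LinearMap.mem_ker, LinearMap.comp_apply, map_smul, knCoord_circ hp] at h0
      have : a = 0 := by simpa using h0
      rw [this, zero_smul]
    · rw [knCirc_eq_zero hp, Submodule.span_zero_singleton] at hx
      exact hx
  · rw [eq_top_iff]
    rintro x -
    induction x using kn_induction with
    | h0 => exact Submodule.zero_mem _
    | hadd x y hx hy => exact Submodule.add_mem _ hx hy
    | hsmul r x hx => exact Submodule.smul_mem _ _ hx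
    | hcirc l m =>
      exact Submodule.mem_iSup_of_mem (l, m) (Submodule.mem_span_singleton_self _)

theorem finite_left (j : Lambda n) :
    FiniteDimensional ℂ (LinearMap.range ((knMul n h).flip (knIdem j))) := by
  classical
  have : FiniteDimensional ℂ (Submodule.span ℂ ((fun l => knCirc l j) '' {l | PairInj l.1 j.1})) :=
    FiniteDimensional.span_of_finite ℂ ((finite_pair_right j).image _)
  refine Submodule.finiteDimensional_of_le
    (S₂ := Submodule.span ℂ ((fun l => knCirc l j) '' {l | PairInj l.1 j.1})) ?_
  rintro _ ⟨x, rfl⟩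
  induction x using kn_induction with
  | h0 => rw [map_zero]; exact Submodule.zero_mem _
  | hadd x y hx hy => rw [map_add]; exact Submodule.add_mem _ hx hy
  | hsmul r x hx => rw [map_smul]; exact Submodule.smul_mem _ _ hx
  | hcirc l m =>
    rw [LinearMap.flip_apply, mul_knIdem]
    split_ifs with h1
    · subst h1
      by_cases hg : GoodPair (l, m)
      · exact Submodule.subset_span ⟨l, hg, rfl⟩
      · rw [knCirc_eq_zero hg]; exact Submodule.zero_mem _
    · exact Submodule.zero_mem _

theorem finite_right (i : Lambda n) :
    FiniteDimensional ℂ (LinearMap.range (knMul n h (knIdem i))) := by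
  classical
  have : FiniteDimensional ℂ (Submodule.span ℂ ((fun m => knCirc i m) '' {m | PairInj i.1 m.1})) :=
    FiniteDimensional.span_of_finite ℂ ((finite_pair_left i).image _)
  refine Submodule.finiteDimensional_of_le
    (S₂ := Submodule.span ℂ ((fun m => knCirc i m) '' {m | PairInj i.1 m.1})) ?_
  rintro _ ⟨x, rfl⟩
  induction x using kn_induction with
  | h0 => rw [map_zero]; exact Submodule.zero_mem _
  | hadd x y hx hy => rw [map_add]; exact Submodule.add_mem _ hx hy
  | hsmul r x hx => rw [map_smul]; exact Submodule.smul_mem _ _ hx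
  | hcirc l m =>
    rw [knIdem_mul]
    split_ifs with h1
    · subst h1
      by_cases hg : GoodPair (i, m)
      · exact Submodule.subset_span ⟨m, hg, rfl⟩
      · rw [knCirc_eq_zero hg]; exact Submodule.zero_mem _
    · exact Submodule.zero_mem _

/-- The index set of the products of the sets `Y` and `X`. -/
abbrev StdIndex (n : ℕ) : Type :=
  Σ l : Lambda n, (⋃ i, Yset i l : Set (Kn n)) × (⋃ j, Xset l j : Set (Kn n))

theorem exists_factors (z : StdIndex n) : ∃ p : Lambda n × Lambda n,
    IsNabla (dots z.1.1) p.1.1 ∧ IsDelta (dots z.1.1) p.2.1 ∧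
    (z.2.1 : Kn n) = knCirc p.1 z.1 ∧ (z.2.2 : Kn n) = knCirc z.1 p.2 := by
  obtain ⟨i, hi, hi'⟩ := Set.mem_iUnion.1 z.2.1.2
  obtain ⟨j, hj, hj'⟩ := Set.mem_iUnion.1 z.2.2.2
  exact ⟨(i, j), hi, hj, hi', hj'⟩

theorem knMul_of_state {l N m : Lambda n} (h1 : IsNabla (dots N.1) l.1)
    (h2 : IsDelta (dots N.1) m.1) : knMul n h (knCirc l N) (knCirc N m) = knCirc l m := by
  classical
  rw [knMul_circ, if_pos ⟨rfl, prodInj_of_state h1 h2⟩]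

/-- The product is the basis diagram with the outer factors' bottom and top, and the middle weight
is recovered as its unique state; so distinct indices give distinct basis diagrams. -/
theorem std_independent :
    LinearIndependent ℂ (fun z : StdIndex n => knMul n h (z.2.1 : Kn n) (z.2.2 : Kn n)) := by
  choose p h1 h2 h3 h4 using exists_factors (n := n)
  have hg : ∀ z, GoodPair (p z) := fun z => pairInj_of_state (h1 z) (h2 z)
  have : (fun z : StdIndex n => knMul n h (z.2.1 : Kn n) (z.2.2 : Kn n)) =
      (fun q : {q : Lambda n × Lambda n // GoodPair q} => knCirc q.1.1 q.1.2) ∘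
        (fun z => ⟨p z, hg z⟩) :=
    funext fun z => by
      rw [h3, h4, knMul_of_state h (h1 z) (h2 z)]; rfl
  rw [this]
  refine knCirc_independent.comp _ fun z z' hz => ?_
  have hz : p z = p z' := congrArg Subtype.val hz
  have hl : z.1 = z'.1 := weight_unique (h1 z) (h2 z) (hz ▸ h1 z') (hz ▸ h2 z')
  have h5 : (z.2.1 : Kn n) = z'.2.1 := by rw [h3, h3, hz, hl]
  have h6 : (z.2.2 : Kn n) = z'.2.2 := by rw [h4, h4, hz, hl]
  obtain ⟨l, y, x⟩ := z
  obtain ⟨l', y', x'⟩ := z'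
  simp only at hl h5 h6
  subst hl
  rw [Subtype.ext h5, Subtype.ext h6]

theorem std_span : Submodule.span ℂ (Set.range
    (fun z : StdIndex n => knMul n h (z.2.1 : Kn n) (z.2.2 : Kn n))) = ⊤ := by
  rw [eq_top_iff]
  rintro x -
  induction x using kn_induction with
  | h0 => exact Submodule.zero_mem _
  | hadd x y hx hy => exact Submodule.add_mem _ hx hy
  | hsmul r x hx => exact Submodule.smul_mem _ _ hx
  | hcirc l m =>
    by_cases hg : GoodPair (l, m)
    · obtain ⟨N, h1, h2⟩ := exists_weight hg
      exact Submodule.subset_span ⟨⟨N, ⟨knCirc l N, Set.mem_iUnion.2 ⟨l, h1, rfl⟩⟩,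
        ⟨knCirc N m, Set.mem_iUnion.2 ⟨m, h2, rfl⟩⟩⟩, knMul_of_state h h1 h2⟩
    · rw [knCirc_eq_zero hg]; exact Submodule.zero_mem _

theorem isEssFiniteBasedQuasiHereditary :
    IsEssFiniteBasedQuasiHereditary (knMul n h) (knIdem (n := n))
      (Function.Embedding.refl (Lambda n)) weightLE Yset Xset where
  assoc := knMul_assoc h
  idem i := by
    classical
    rw [show knMul n h (knIdem i) (knIdem i) = _ from knIdem_mul h i i i, if_pos rfl]; rfl
  orthogonal i j hij := by
    classical
    rw [show knMul n h (knIdem i) (knIdem j) = _ from knIdem_mul h i j j, if_neg hij]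
  locally_unital := by classical exact peirce_isInternal h
  finite_left := finite_left h
  finite_right := finite_right h
  le_refl := weightLE_refl
  le_trans _ _ _ := weightLE_trans
  le_antisymm _ _ := weightLE_antisymm
  interval_finite := interval_finite
  Y_subset i l := by
    rintro _ ⟨-, rfl⟩
    rw [peirce_eq]; exact Submodule.mem_span_singleton_self _
  X_subset l j := by
    rintro _ ⟨-, rfl⟩
    rw [peirce_eq]; exact Submodule.mem_span_singleton_self _
  linearIndependent := std_independent h
  span_eq_top := std_span h
  Y_triangular _ _ := fun ⟨_, hy⟩ => weightLE_of_isNabla hy.1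
  X_triangular _ _ := fun ⟨_, hx⟩ => weightLE_of_isDelta hx.1
  Y_diag l := Set.ext fun _ => and_iff_right (isNabla_dots l.1)
  X_diag l := Set.ext fun _ => and_iff_right (isDelta_dots l.1)

end algebra

end KhovanovP
end

theorem mainTheorem10 (n : ℕ) :
    ∃ h : KhovanovP.IsTwoSided (KhovanovP.truncMul n) (KhovanovP.nonPropSpan n),
      KhovanovP.IsEssFiniteBasedQuasiHereditary (KhovanovP.knMul n h)
        (KhovanovP.knIdem (n := n)) (Function.Embedding.refl (KhovanovP.Lambda n))
        KhovanovP.weightLE KhovanovP.Yset KhovanovP.Xset :=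
  ⟨KhovanovP.isTwoSided_nonPropSpan n, KhovanovP.isEssFiniteBasedQuasiHereditary _⟩
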